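/- Let $(M,g,I)$ be a weak Kähler Banach manifold: a smooth Banach manifold $M$ with a smooth, possibly only weak, Riemannian metric $g$ (a field of continuous positive definite symmetric bilinear forms on the tangent spaces) which has a smooth Levi-Civita connection $\nabla$, and a smooth almost complex structure $I$ which is a fibrewise isometry and is parallel. Let a Banach Lie group $G$ with Lie algebra $\mathfrak g$ act smoothly on $M$ with a moment map, i.e. a smooth equivariant map $\mu:M\to\mathfrak g^*$ such that $\langle d\mu(v),\rho\rangle=g(v,I\check\rho)$ for all tangent vectors $v$ and all $\rho\in\mathfrak g$, where $\check\rho$ is the fundamental vector field of $\rho$. Put $\check{\mathfrak g}_m=\{\check\rho_m:\rho\in\mathfrak g\}$. Let $c\in\mathfrak g^*$ be fixed by the coadjoint action, and suppose that $M_c=\mu^{-1}(c)$ is a submanifold of $M$ with $T_mM_c=\operatorname{Ker} d\mu_m$ for all $m\in M_c$, and that the action of $G$ on $M_c$ is free, proper, isometric and elliptic; elliptic means that $\Lambda(T_mM)=\Lambda(\check{\mathfrak g}_m)$ for every $m\in M_c$, where $\Lambda(v)(\rho)=g(v,\check\rho)$. Let $Q=M_c/G$ be the Kähler quotient, with its quotient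 manifold structure, its quotient metric and its Levi-Civita connection. For $m\in M_c$ let $H_m=(\check{\mathfrak g}_m\oplus I\check{\mathfrak g}_m)^\perp\subset T_mM$, which is identified with the tangent space of $Q$ at the orbit of $m$. For $X,Y\in H_m$ let $A(X,Y)$ be the $\check{\mathfrak g}_m$-component of $\nabla_X\tilde Y$, where $\tilde Y$ is any local vector field which extends $Y$ and takes values in $H$ along $M_c$, and let $$V(m)=\sup\Bigl\{\frac{|A(X,Y)|}{|X||Y|}\;:\;X,Y\in H_m\setminus\{0\}\Bigr\}\in[0,+\infty].$$ Then for every $p\in Q$, every $m\in M_c$ projecting to $p$ and every plane $\pi\subset T_pQ$ with horizontal lift $\tilde\pi\subset H_m\subset T_mM$, the sectional curvatures satisfy $$|K_Q(p)(\pi)-K_M(m)(\tilde\pi)|\le 5V(m)^2.$$ Moreover, if $T_pQ\neq 0$, then $$\sup_{\pi}\bigl(K_Q(p)(\pi)-K_M(m)(\tilde\pi)\bigr)\ge V(m)^2,$$ where the supremum, possibly $+\infty$, is taken over all planes $\pi\subset T_pQ$. -/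

import Mathlib

open scoped Manifold ContDiff Topology ENNReal Bundle
open Bundle

noncomputable section

/-! ### Weak Riemannian and weak Kähler Banach manifolds -/

section Metric

variable (E : Type*) [NormedAddCommGroup E] [NormedSpace ℝ E] [CompleteSpace E]
  (M : Type*) [TopologicalSpace M] [ChartedSpace E M] [IsManifold 𝓘(ℝ, E) ∞ M]

/-- A weak Riemannian structure on a smooth Banach manifold `M` modelled on `E`, with a smooth
Levi-Civita connection: a smooth field of continuous positive definite symmetric bilinear forms on
the tangent spaces (which need not induce their topology), and a smooth torsion-free connection
which is compatible with it. As the metric is weak, the existence of the connection is part of the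
data; its uniqueness follows from the Koszul formula. -/
structure WeakRiemannianStructure where
  /-- The metric tensor. -/
  metric (x : M) : TangentSpace 𝓘(ℝ, E) x →L[ℝ] TangentSpace 𝓘(ℝ, E) x →L[ℝ] ℝ
  metric_symm : ∀ x v w, metric x v w = metric x w v
  metric_pos : ∀ x v, v ≠ 0 → 0 < metric x v v
  metric_smooth : ContMDiff 𝓘(ℝ, E) (𝓘(ℝ, E).prod 𝓘(ℝ, E →L[ℝ] E →L[ℝ] ℝ)) ∞
    (fun x ↦ TotalSpace.mk' (E →L[ℝ] E →L[ℝ] ℝ)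
      (E := fun x : M ↦ TangentSpace 𝓘(ℝ, E) x →L[ℝ] TangentSpace 𝓘(ℝ, E) x →L[ℝ] ℝ)
      x (metric x))
  /-- The Levi-Civita connection; `cov Y x u` is the covariant derivative of `Y` at `x` along the
  tangent vector `u`. -/
  cov : CovariantDerivative 𝓘(ℝ, E) E (TangentSpace 𝓘(ℝ, E) : M → Type _)
  cov_smooth : ∀ U : Set M, IsOpen U → ContMDiffCovariantDerivativeOn E ∞ cov.toFun U
  cov_metric : ∀ (Y Z : Π x : M, TangentSpace 𝓘(ℝ, E) x) (x : M) (u : TangentSpace 𝓘(ℝ, E) x),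
    MDiffAt (T% Y) x → MDiffAt (T% Z) x →
      mvfderiv 𝓘(ℝ, E) (fun y ↦ metric y (Y y) (Z y)) x u =
        metric x (cov Y x u) (Z x) + metric x (Y x) (cov Z x u)
  cov_torsion : ∀ (X Y : Π x : M, TangentSpace 𝓘(ℝ, E) x) (x : M),
    MDiffAt (T% X) x → MDiffAt (T% Y) x →
      cov Y x (X x) - cov X x (Y x) = VectorField.mlieBracket 𝓘(ℝ, E) X Y x

/-- A weak Kähler structure: a weak Riemannian structure with Levi-Civita connection, together with
a smooth almost complex structure which is a fibrewise isometry and is parallel. -/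
structure WeakKahlerStructure extends WeakRiemannianStructure E M where
  /-- The almost complex structure. -/
  J (x : M) : TangentSpace 𝓘(ℝ, E) x →L[ℝ] TangentSpace 𝓘(ℝ, E) x
  J_smooth : ContMDiff 𝓘(ℝ, E) (𝓘(ℝ, E).prod 𝓘(ℝ, E →L[ℝ] E)) ∞
    (fun x ↦ TotalSpace.mk' (E →L[ℝ] E)
      (E := fun x : M ↦ TangentSpace 𝓘(ℝ, E) x →L[ℝ] TangentSpace 𝓘(ℝ, E) x) x (J x))
  J_sq : ∀ x v, J x (J x v) = -v
  J_isometry : ∀ x v w, metric x (J x v) (J x w) = metric x v w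
  J_parallel : ∀ (Y : Π x : M, TangentSpace 𝓘(ℝ, E) x) (x : M) (u : TangentSpace 𝓘(ℝ, E) x),
    MDiffAt (T% Y) x → cov (fun y ↦ J y (Y y)) x u = J x (cov Y x u)

end Metric

/-! ### Curvature -/

namespace WeakRiemannianStructure

variable {E : Type*} [NormedAddCommGroup E] [NormedSpace ℝ E] [CompleteSpace E]
  {M : Type*} [TopologicalSpace M] [ChartedSpace E M] [IsManifold 𝓘(ℝ, E) ∞ M]
  (S : WeakRiemannianStructure E M)

/-- The length of a tangent vector. -/
def length {x : M} (v : TangentSpace 𝓘(ℝ, E) x) : ℝ := √(S.metric x v v)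

/-- The curvature `R(u, v) w = ∇_U ∇_V W - ∇_V ∇_U W - ∇_[U, V] W` at `x`, where `U`, `V`, `W` are
the extensions of `u`, `v`, `w` to smooth local vector fields that are constant in the preferred
chart at `x`. -/
def curvature {x : M} (u v w : TangentSpace 𝓘(ℝ, E) x) : TangentSpace 𝓘(ℝ, E) x :=
  letI U : Π y : M, TangentSpace 𝓘(ℝ, E) y := FiberBundle.extend E u
  letI V : Π y : M, TangentSpace 𝓘(ℝ, E) y := FiberBundle.extend E v
  letI W : Π y : M, TangentSpace 𝓘(ℝ, E) y := FiberBundle.extend E w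
  S.cov (fun y ↦ S.cov W y (V y)) x u - S.cov (fun y ↦ S.cov W y (U y)) x v
    - S.cov W x (VectorField.mlieBracket 𝓘(ℝ, E) U V x)

/-- `u`, `v` is an orthonormal basis of the plane `P`. -/
def IsOrthonormalBasisOf {x : M} (P : Submodule ℝ (TangentSpace 𝓘(ℝ, E) x))
    (b : TangentSpace 𝓘(ℝ, E) x × TangentSpace 𝓘(ℝ, E) x) : Prop :=
  S.metric x b.1 b.1 = 1 ∧ S.metric x b.2 b.2 = 1 ∧ S.metric x b.1 b.2 = 0 ∧
    Submodule.span ℝ {b.1, b.2} = P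

open Classical in
/-- The sectional curvature `K(P) = g(R(u, v) v, u)` of a plane `P` in the tangent space at `x`,
where `u`, `v` is an orthonormal basis of `P` (and zero if `P` is not two-dimensional). -/
def sectionalCurvature {x : M} (P : Submodule ℝ (TangentSpace 𝓘(ℝ, E) x)) : ℝ :=
  if h : ∃ b, S.IsOrthonormalBasisOf P b then
    S.metric x (S.curvature h.choose.1 h.choose.2 h.choose.2) h.choose.1
  else 0

end WeakRiemannianStructure

/-! ### Group actions and moment maps

`G` is a Banach Lie group modelled on the Banach space `EG`. Its Lie algebra, the tangent space
at `1`, is by definition the space `EG`, and its dual is the Banach space `EG →L[ℝ] ℝ`. -/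

section Action

variable {E : Type*} [NormedAddCommGroup E] [NormedSpace ℝ E] [CompleteSpace E]
  {M : Type*} [TopologicalSpace M] [ChartedSpace E M] [IsManifold 𝓘(ℝ, E) ∞ M]
  {EG : Type*} [NormedAddCommGroup EG] [NormedSpace ℝ EG] [CompleteSpace EG]
  (G : Type*) [TopologicalSpace G] [ChartedSpace EG G] [Group G] [LieGroup 𝓘(ℝ, EG) ∞ G]
  [MulAction G M] [ContMDiffSMul 𝓘(ℝ, EG) 𝓘(ℝ, E) ∞ G M]

/-- The infinitesimal action at `m`: `fundamental G m ρ` is the value at `m` of the fundamental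
vector field of the Lie algebra element `ρ`. -/
def fundamental (m : M) : EG →L[ℝ] TangentSpace 𝓘(ℝ, E) m :=
  mfderiv 𝓘(ℝ, EG) 𝓘(ℝ, E) (fun a : G ↦ a • m) 1

/-- The tangent space to the orbit: the image of the Lie algebra in the tangent space at `m`. -/
def orbitTangent (m : M) : Submodule ℝ (TangentSpace 𝓘(ℝ, E) m) :=
  (fundamental (E := E) (EG := EG) G m).range

variable {G} in
/-- The adjoint action of `a` on the Lie algebra. -/
def adjointAction (a : G) : EG →L[ℝ] EG :=
  mfderiv 𝓘(ℝ, EG) 𝓘(ℝ, EG) (fun b : G ↦ a * b * a⁻¹) 1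

variable {G} in
/-- The coadjoint action of `a` on the dual of the Lie algebra. -/
def coadjointAction (a : G) (ξ : EG →L[ℝ] ℝ) : EG →L[ℝ] ℝ :=
  ξ ∘L adjointAction (EG := EG) a⁻¹

/-- The pointwise adjoint `Λ` of the infinitesimal action: `Λ(v)(ρ)` is the inner product of `v`
with the fundamental vector field of `ρ`. -/
def WeakRiemannianStructure.Lam (S : WeakRiemannianStructure E M) (m : M) :
    TangentSpace 𝓘(ℝ, E) m →ₗ[ℝ] (EG →L[ℝ] ℝ) where
  toFun v := (S.metric m v) ∘L fundamental (E := E) (EG := EG) G m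
  map_add' v w := by ext; simp
  map_smul' r v := by ext; simp

/-- The action is elliptic at `m`: `Λ` has the same image on the whole tangent space and on the
tangent space to the orbit. -/
def WeakRiemannianStructure.IsEllipticAt (S : WeakRiemannianStructure E M) (m : M) : Prop :=
  LinearMap.range (S.Lam (EG := EG) G m) =
    (orbitTangent (E := E) (EG := EG) G m).map (S.Lam (EG := EG) G m)

/-- `μ` is a moment map for the action of `G` on the weak Kähler manifold `M`: it is smooth,
equivariant, and `⟨dμ(v), ρ⟩ = g(v, J ρ̌)` for all tangent vectors `v` and all `ρ` in the
Lie algebra, where `ρ̌` is the fundamental vector field of `ρ`. The action is Hamiltonian if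
it has a moment map. -/
structure WeakKahlerStructure.IsMomentMap (S : WeakKahlerStructure E M)
    (G : Type*) [TopologicalSpace G] [ChartedSpace EG G] [Group G] [LieGroup 𝓘(ℝ, EG) ∞ G]
    [MulAction G M] [ContMDiffSMul 𝓘(ℝ, EG) 𝓘(ℝ, E) ∞ G M]
    (μ : M → (EG →L[ℝ] ℝ)) : Prop where
  smooth : ContMDiff 𝓘(ℝ, E) 𝓘(ℝ, EG →L[ℝ] ℝ) ∞ μ
  equivariant : ∀ (a : G) (m : M), μ (a • m) = coadjointAction a (μ m)
  moment : ∀ (m : M) (v : TangentSpace 𝓘(ℝ, E) m) (ρ : EG),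
    mvfderiv 𝓘(ℝ, E) μ m v ρ = S.metric m v (S.J m (fundamental G m ρ))

end Action

/-! ### The Kähler quotient -/

section Quotient

variable {E : Type*} [NormedAddCommGroup E] [NormedSpace ℝ E] [CompleteSpace E]
  {M : Type*} [TopologicalSpace M] [ChartedSpace E M] [IsManifold 𝓘(ℝ, E) ∞ M]
  {EG : Type*} [NormedAddCommGroup EG] [NormedSpace ℝ EG] [CompleteSpace EG]
  (G : Type*) [TopologicalSpace G] [ChartedSpace EG G] [Group G] [LieGroup 𝓘(ℝ, EG) ∞ G]
  [MulAction G M] [ContMDiffSMul 𝓘(ℝ, EG) 𝓘(ℝ, E) ∞ G M]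

/-- The `c`-level set of the moment map, with the subspace topology. -/
abbrev LevelSet (μ : M → (EG →L[ℝ] ℝ)) (c : EG →L[ℝ] ℝ) : Type _ := {m : M // μ m = c}

/-- The space of `G`-orbits in the `c`-level set, with the quotient topology. -/
abbrev KahlerQuotient (μ : M → (EG →L[ℝ] ℝ)) (c : EG →L[ℝ] ℝ) : Type _ :=
  Quotient ((MulAction.orbitRel G M).comap (Subtype.val : LevelSet μ c → M))

/-- The orbit projection of the level set. -/
def quotientProj (μ : M → (EG →L[ℝ] ℝ)) (c : EG →L[ℝ] ℝ) (m : LevelSet μ c) :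
    KahlerQuotient G μ c := Quotient.mk _ m

section

variable {EN : Type*} [NormedAddCommGroup EN] [NormedSpace ℝ EN]
  (μ : M → (EG →L[ℝ] ℝ)) (c : EG →L[ℝ] ℝ) [ChartedSpace EN (LevelSet μ c)]

/-- The differential at `m` of the inclusion of the level set in `M`. -/
def inclDeriv (m : LevelSet μ c) :
    TangentSpace 𝓘(ℝ, EN) m →L[ℝ] TangentSpace 𝓘(ℝ, E) (m : M) :=
  mfderiv 𝓘(ℝ, EN) 𝓘(ℝ, E) (Subtype.val : LevelSet μ c → M) m

/-- The given manifold structure makes the level set a (regular) submanifold of `M`: the inclusion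
is a smooth embedding, and the tangent space of the level set at `m` is the kernel of `dμ`. -/
structure IsLevelSubmanifold (E EN : Type*) [NormedAddCommGroup E] [NormedSpace ℝ E]
    [NormedAddCommGroup EN] [NormedSpace ℝ EN]
    {M : Type*} [TopologicalSpace M] [ChartedSpace E M]
    (μ : M → (EG →L[ℝ] ℝ)) (c : EG →L[ℝ] ℝ) [ChartedSpace EN (LevelSet μ c)] : Prop where
  embedding : Manifold.IsSmoothEmbedding 𝓘(ℝ, EN) 𝓘(ℝ, E) ∞ (Subtype.val : LevelSet μ c → M)
  tangent : ∀ m : LevelSet μ c,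
    (mfderiv 𝓘(ℝ, EN) 𝓘(ℝ, E) (Subtype.val : LevelSet μ c → M) m).range =
      (mvfderiv 𝓘(ℝ, E) μ (m : M)).ker

/-- The restriction of the action to the level set is free, proper, isometric (for the metric
induced on the level set) and elliptic. -/
structure WeakRiemannianStructure.IsGoodOnLevel (S : WeakRiemannianStructure E M)
    (EN : Type*) [NormedAddCommGroup EN] [NormedSpace ℝ EN]
    (G : Type*) [TopologicalSpace G] [ChartedSpace EG G] [Group G] [LieGroup 𝓘(ℝ, EG) ∞ G]
    [MulAction G M] [ContMDiffSMul 𝓘(ℝ, EG) 𝓘(ℝ, E) ∞ G M]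
    (μ : M → (EG →L[ℝ] ℝ)) (c : EG →L[ℝ] ℝ) [ChartedSpace EN (LevelSet μ c)] : Prop where
  free : ∀ (a : G) (m : LevelSet μ c), a • (m : M) = m → a = 1
  proper : IsProperMap (fun q : G × LevelSet μ c ↦ (q.1 • (q.2 : M), (q.2 : M)))
  isometric : ∀ (a : G) (m : LevelSet μ c) (v w : TangentSpace 𝓘(ℝ, EN) m),
    S.metric (a • (m : M))
        (mfderiv 𝓘(ℝ, E) 𝓘(ℝ, E) (fun x : M ↦ a • x) (m : M) (inclDeriv μ c m v))
        (mfderiv 𝓘(ℝ, E) 𝓘(ℝ, E) (fun x : M ↦ a • x) (m : M) (inclDeriv μ c m w)) =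
      S.metric (m : M) (inclDeriv μ c m v) (inclDeriv μ c m w)
  elliptic : ∀ m : LevelSet μ c, S.IsEllipticAt (EG := EG) G (m : M)

end

namespace WeakKahlerStructure

variable (S : WeakKahlerStructure E M)

/-- The horizontal space at `m`: the tangent vectors orthogonal to the tangent space of the orbit
and to its image under the complex structure. -/
def horizontal (m : M) : Submodule ℝ (TangentSpace 𝓘(ℝ, E) m) where
  carrier := {v | ∀ ρ : EG, S.metric m v (fundamental G m ρ) = 0 ∧
    S.metric m v (S.J m (fundamental G m ρ)) = 0}
  add_mem' hv hw ρ := by simp [(hv ρ).1, (hv ρ).2, (hw ρ).1, (hw ρ).2]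
  zero_mem' ρ := by simp
  smul_mem' r v hv ρ := by simp [(hv ρ).1, (hv ρ).2]

/-- `Z = A(X, Y)`, where `A` is the O'Neill tensor: `X` and `Y` are horizontal at the point `m` of
the level set, and `Z` is the component in the tangent space of the orbit of the covariant
derivative along `X` of a local vector field which extends `Y` and is horizontal along the level
set. -/
def IsONeill (μ : M → (EG →L[ℝ] ℝ)) (m : M)
    (X Y Z : TangentSpace 𝓘(ℝ, E) m) : Prop :=
  X ∈ S.horizontal (EG := EG) G m ∧ Y ∈ S.horizontal (EG := EG) G m ∧
  Z ∈ orbitTangent (E := E) (EG := EG) G m ∧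
  ∃ Yext : Π x : M, TangentSpace 𝓘(ℝ, E) x,
    CMDiffAt ∞ (T% Yext) m ∧ Yext m = Y ∧
    (∀ᶠ x in 𝓝 m, μ x = μ m → Yext x ∈ S.horizontal (EG := EG) G x) ∧
    ∀ W ∈ orbitTangent (E := E) (EG := EG) G m, S.metric m (S.cov Yext m X - Z) W = 0

/-- The pointwise norm `V(m)` of the O'Neill tensor, possibly infinite: the supremum of
`|A(X, Y)| / (|X| |Y|)` over all nonzero horizontal vectors `X`, `Y` at `m`. -/
def oneillNorm (μ : M → (EG →L[ℝ] ℝ)) (m : M) : ℝ≥0∞ :=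
  ⨆ (X : TangentSpace 𝓘(ℝ, E) m) (Y : TangentSpace 𝓘(ℝ, E) m) (Z : TangentSpace 𝓘(ℝ, E) m)
    (_ : X ≠ 0) (_ : Y ≠ 0) (_ : S.IsONeill G μ m X Y Z),
    ENNReal.ofReal (S.length Z / (S.length X * S.length Y))

variable {EN : Type*} [NormedAddCommGroup EN] [NormedSpace ℝ EN]
  {EQ : Type*} [NormedAddCommGroup EQ] [NormedSpace ℝ EQ] [CompleteSpace EQ]
  (μ : M → (EG →L[ℝ] ℝ)) (c : EG →L[ℝ] ℝ) [ChartedSpace EN (LevelSet μ c)]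
  [ChartedSpace EQ (KahlerQuotient G μ c)]

/-- The differential at `m` of the orbit projection of the level set. -/
def projDeriv (m : LevelSet μ c) :
    TangentSpace 𝓘(ℝ, EN) m →L[ℝ] TangentSpace 𝓘(ℝ, EQ) (quotientProj G μ c m) :=
  mfderiv 𝓘(ℝ, EN) 𝓘(ℝ, EQ) (quotientProj G μ c) m

/-- The weak Riemannian structure `T` is the one of the Kähler quotient: the orbit space carries
its quotient manifold structure, for which the orbit projection is a submersion, and the metric for
which the differential of the projection is isometric on horizontal vectors. -/
structure IsKahlerQuotientStructure [IsManifold 𝓘(ℝ, EQ) ∞ (KahlerQuotient G μ c)]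
    (EN : Type*) [NormedAddCommGroup EN] [NormedSpace ℝ EN] [ChartedSpace EN (LevelSet μ c)]
    (T : WeakRiemannianStructure EQ (KahlerQuotient G μ c)) : Prop where
  submersion : Manifold.IsSubmersion 𝓘(ℝ, EN) 𝓘(ℝ, EQ) ∞ (quotientProj G μ c)
  metric : ∀ (m : LevelSet μ c) (v w : TangentSpace 𝓘(ℝ, EN) m),
    inclDeriv μ c m v ∈ S.horizontal (EG := EG) G (m : M) →
    inclDeriv μ c m w ∈ S.horizontal (EG := EG) G (m : M) →
      T.metric (quotientProj G μ c m) (projDeriv G μ c m v) (projDeriv G μ c m w) =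
        S.metric (m : M) (inclDeriv μ c m v) (inclDeriv μ c m w)

/-- The horizontal lift to the tangent space of `M` at `m` of a subspace `P` of the tangent space
of the quotient at the orbit of `m`: all horizontal vectors which are tangent to the level set and
project into `P`. -/
def horizontalLift (EN : Type*) [NormedAddCommGroup EN] [NormedSpace ℝ EN]
    [ChartedSpace EN (LevelSet μ c)] (m : LevelSet μ c)
    (P : Submodule ℝ (TangentSpace 𝓘(ℝ, EQ) (quotientProj G μ c m))) :
    Submodule ℝ (TangentSpace 𝓘(ℝ, E) (m : M)) :=
  (P.comap (projDeriv (EN := EN) G μ c m).toLinearMap).map (inclDeriv μ c m).toLinearMap ⊓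
    S.horizontal (EG := EG) G (m : M)

end WeakKahlerStructure

end Quotient

end


/-!
Let `ψ` be the inclusion of the level set, `p` its projection to the quotient and `P` the orthogonal
projection onto the directions of the orbits. The metrics are related by
`ψ^* g - p^* g_Q = g (P dψ ·) (P dψ ·)`, and the right-hand side vanishes on horizontal vectors.
Hence, when the Riemann tensors of the two sides are compared in a chart, only the squares of first
derivatives survive, and these are the terms of the Gauss and O'Neill equations: for an orthonormal
horizontal pair `X`, `Y`,
`K_Q - K_M = 3 |A(X, Y)|² + ⟨B(X, X), B(Y, Y)⟩ - |B(X, Y)|²`,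
where `I B` is, up to sign, the second fundamental form of the level set. Since `I` is parallel,
`A(X, I Y) = B(X, Y)`, so `V` bounds `A` and `B` alike and the difference lies between `-2 V²` and
`4 V²`.

On the plane spanned by `X` and `I X` the difference is `4 |B(X, X)|²`. As `B` is symmetric, `V` is
already the supremum of `|B(X, X)|` over unit vectors, by polarisation, so the supremum of the
differences is at least `4 V²`.
-/

noncomputable section

/-! ### Second derivatives of bilinear expressions -/

section Calculus

variable {X Y E F : Type*} [NormedAddCommGroup X] [NormedSpace ℝ X] [NormedAddCommGroup Y]
  [NormedSpace ℝ Y] [NormedAddCommGroup E] [NormedSpace ℝ E] [NormedAddCommGroup F]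
  [NormedSpace ℝ F] {x : X}

/-- The second derivative `∂ᵤ∂_w f` at `x`. It is an iterated directional derivative, rather than
`fderiv ℝ (fderiv ℝ f)`, so that fields `f` of bilinear forms do not lead to deeply nested spaces
of continuous linear maps. -/
def secondDeriv (f : X → F) (x u w : X) : F := fderiv ℝ (fun y ↦ fderiv ℝ f y w) x u

lemma eventually_differentiableAt_of_contDiffAt_two {f : X → F} (hf : ContDiffAt ℝ 2 f x) :
    ∀ᶠ y in 𝓝 x, DifferentiableAt ℝ f y :=
  (hf.eventually (by simp)).mono fun _ hy ↦ hy.differentiableAt (by norm_num)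

lemma differentiableAt_fderiv_of_contDiffAt_two {f : X → F} (hf : ContDiffAt ℝ 2 f x) :
    DifferentiableAt ℝ (fderiv ℝ f) x :=
  (hf.fderiv_right (m := 1) (by norm_num)).differentiableAt (by norm_num)

lemma differentiableAt_fderiv_apply {f : X → F} (hf : ContDiffAt ℝ 2 f x) (w : X) :
    DifferentiableAt ℝ (fun y ↦ fderiv ℝ f y w) x :=
  (differentiableAt_fderiv_of_contDiffAt_two hf).clm_apply (by fun_prop)

lemma fderiv_eval {α : X → Y →L[ℝ] E} (hα : DifferentiableAt ℝ α x) (u : X) (a : Y) :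
    fderiv ℝ (fun y ↦ α y a) x u = fderiv ℝ α x u a := by
  rw [fderiv_clm_apply hα (by fun_prop)]
  simp

lemma secondDeriv_eq_fderiv_fderiv {f : X → F} (hf : ContDiffAt ℝ 2 f x) (u w : X) :
    secondDeriv f x u w = fderiv ℝ (fderiv ℝ f) x u w :=
  fderiv_eval (differentiableAt_fderiv_of_contDiffAt_two hf) u w

lemma secondDeriv_comm {f : X → F} (hf : ContDiffAt ℝ 2 f x) (u w : X) :
    secondDeriv f x u w = secondDeriv f x w u := by
  rw [secondDeriv_eq_fderiv_fderiv hf, secondDeriv_eq_fderiv_fderiv hf]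
  exact hf.isSymmSndFDerivAt (by simp) u w

lemma secondDeriv_congr {f f' : X → F} (h : f =ᶠ[𝓝 x] f') (u w : X) :
    secondDeriv f x u w = secondDeriv f' x u w := by
  have first : (fun y ↦ fderiv ℝ f y w) =ᶠ[𝓝 x] fun y ↦ fderiv ℝ f' y w :=
    (h.fderiv (𝕜 := ℝ)).mono fun y hy ↦ congrArg (· w) hy
  rw [secondDeriv, secondDeriv, first.fderiv_eq]

lemma secondDeriv_add {f f' : X → F} (hf : ContDiffAt ℝ 2 f x) (hf' : ContDiffAt ℝ 2 f' x)
    (u w : X) :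
    secondDeriv (fun y ↦ f y + f' y) x u w = secondDeriv f x u w + secondDeriv f' x u w := by
  have first : (fun y ↦ fderiv ℝ (fun y ↦ f y + f' y) y w) =ᶠ[𝓝 x]
      fun y ↦ fderiv ℝ f y w + fderiv ℝ f' y w := by
    filter_upwards [eventually_differentiableAt_of_contDiffAt_two hf,
      eventually_differentiableAt_of_contDiffAt_two hf'] with y hy hy'
    rw [fderiv_fun_add hy hy', add_apply]
  rw [secondDeriv, first.fderiv_eq, fderiv_fun_add (differentiableAt_fderiv_apply hf w)
    (differentiableAt_fderiv_apply hf' w)]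
  rfl

lemma secondDeriv_eval {α : X → Y →L[ℝ] E} (hα : ContDiffAt ℝ 2 α x) (u w : X) (a : Y) :
    secondDeriv (fun y ↦ α y a) x u w = secondDeriv α x u w a := by
  have first : (fun y ↦ fderiv ℝ (fun y ↦ α y a) y w) =ᶠ[𝓝 x] fun y ↦ fderiv ℝ α y w a := by
    filter_upwards [eventually_differentiableAt_of_contDiffAt_two hα] with y hy
    exact fderiv_eval hy w a
  rw [secondDeriv, first.fderiv_eq, fderiv_eval (differentiableAt_fderiv_apply hα w)]
  rfl

lemma secondDeriv_fderiv_comm_right {f : X → F} (hf : ContDiffAt ℝ 3 f x) (u v w : X) :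
    secondDeriv (fderiv ℝ f) x u v w = secondDeriv (fderiv ℝ f) x u w v := by
  have hf' : ContDiffAt ℝ 2 (fderiv ℝ f) x := hf.fderiv_right (by norm_num)
  have comm : (fun y ↦ fderiv ℝ (fderiv ℝ f) y v w) =ᶠ[𝓝 x]
      fun y ↦ fderiv ℝ (fderiv ℝ f) y w v := by
    filter_upwards [(hf.of_le (m := 2) (by norm_num)).eventually (by simp)] with y hy
    exact hy.isSymmSndFDerivAt (by simp) v w
  rw [secondDeriv, secondDeriv, ← fderiv_eval (differentiableAt_fderiv_apply hf' v),
    ← fderiv_eval (differentiableAt_fderiv_apply hf' w), comm.fderiv_eq]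

lemma fderiv_comp_eval {f : E → F} {ψ : X → E} (hf : DifferentiableAt ℝ f (ψ x))
    (hψ : DifferentiableAt ℝ ψ x) (u : X) :
    fderiv ℝ (fun y ↦ f (ψ y)) x u = fderiv ℝ f (ψ x) (fderiv ℝ ψ x u) := by
  rw [fderiv_fun_comp x hf hψ, ContinuousLinearMap.comp_apply]

lemma secondDeriv_comp {f : E → F} {ψ : X → E} (hf : ContDiffAt ℝ 2 f (ψ x))
    (hψ : ContDiffAt ℝ 2 ψ x) (u w : X) :
    secondDeriv (fun y ↦ f (ψ y)) x u w =
      secondDeriv f (ψ x) (fderiv ℝ ψ x u) (fderiv ℝ ψ x w)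
        + fderiv ℝ f (ψ x) (secondDeriv ψ x u w) := by
  have first : (fun y ↦ fderiv ℝ (fun y ↦ f (ψ y)) y w) =ᶠ[𝓝 x]
      fun y ↦ fderiv ℝ f (ψ y) (fderiv ℝ ψ y w) := by
    filter_upwards [hψ.continuousAt.eventually (eventually_differentiableAt_of_contDiffAt_two hf),
      eventually_differentiableAt_of_contDiffAt_two hψ] with y hf hψ
    exact fderiv_comp_eval hf hψ w
  have hf' := differentiableAt_fderiv_of_contDiffAt_two hf
  have hψ₁ : DifferentiableAt ℝ ψ x := hψ.differentiableAt (by norm_num)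
  rw [secondDeriv, first.fderiv_eq, fderiv_clm_apply (hf'.fun_comp' x hψ₁)
    (differentiableAt_fderiv_apply hψ w), secondDeriv_eq_fderiv_fderiv hf]
  simp only [add_apply, ContinuousLinearMap.comp_apply, ContinuousLinearMap.flip_apply]
  rw [fderiv_comp_eval hf' hψ₁, add_comm]
  rfl

lemma fderiv_bilinear_eval {G : X → E →L[ℝ] F →L[ℝ] ℝ} {a : X → E} {b : X → F}
    (hG : DifferentiableAt ℝ G x) (ha : DifferentiableAt ℝ a x) (hb : DifferentiableAt ℝ b x)
    (u : X) :
    fderiv ℝ (fun y ↦ G y (a y) (b y)) x u =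
      fderiv ℝ G x u (a x) (b x) + G x (fderiv ℝ a x u) (b x) + G x (a x) (fderiv ℝ b x u) := by
  rw [fderiv_clm_apply (hG.clm_apply ha) hb, fderiv_clm_apply hG ha]
  simp only [add_apply, ContinuousLinearMap.comp_apply, ContinuousLinearMap.flip_apply]
  ring

lemma secondDeriv_bilinear {G : X → E →L[ℝ] F →L[ℝ] ℝ} {a : X → E} {b : X → F}
    (hG : ContDiffAt ℝ 2 G x) (ha : ContDiffAt ℝ 2 a x) (hb : ContDiffAt ℝ 2 b x) (u w : X) :
    secondDeriv (fun y ↦ G y (a y) (b y)) x u w =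
      secondDeriv G x u w (a x) (b x)
        + fderiv ℝ G x w (fderiv ℝ a x u) (b x) + fderiv ℝ G x w (a x) (fderiv ℝ b x u)
      + (fderiv ℝ G x u (fderiv ℝ a x w) (b x) + G x (secondDeriv a x u w) (b x)
        + G x (fderiv ℝ a x w) (fderiv ℝ b x u))
      + (fderiv ℝ G x u (a x) (fderiv ℝ b x w) + G x (fderiv ℝ a x u) (fderiv ℝ b x w)
        + G x (a x) (secondDeriv b x u w)) := by
  have hG₁ := hG.differentiableAt (by norm_num)
  have ha₁ := ha.differentiableAt (by norm_num)
  have hb₁ := hb.differentiableAt (by norm_num)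
  have hG₂ := differentiableAt_fderiv_apply hG w
  have ha₂ := differentiableAt_fderiv_apply ha w
  have hb₂ := differentiableAt_fderiv_apply hb w
  have first : (fun y ↦ fderiv ℝ (fun y ↦ G y (a y) (b y)) y w) =ᶠ[𝓝 x] fun y ↦
      fderiv ℝ G y w (a y) (b y) + G y (fderiv ℝ a y w) (b y) + G y (a y) (fderiv ℝ b y w) := by
    filter_upwards [eventually_differentiableAt_of_contDiffAt_two hG,
      eventually_differentiableAt_of_contDiffAt_two ha,
      eventually_differentiableAt_of_contDiffAt_two hb] with y hG ha hb
    exact fderiv_bilinear_eval hG ha hb w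
  rw [secondDeriv, first.fderiv_eq,
    fderiv_fun_add (((hG₂.clm_apply ha₁).clm_apply hb₁).fun_add ((hG₁.clm_apply ha₂).clm_apply hb₁))
      ((hG₁.clm_apply ha₁).clm_apply hb₂),
    fderiv_fun_add ((hG₂.clm_apply ha₁).clm_apply hb₁) ((hG₁.clm_apply ha₂).clm_apply hb₁)]
  simp only [add_apply]
  rw [fderiv_bilinear_eval hG₂ ha₁ hb₁, fderiv_bilinear_eval hG₁ ha₂ hb₁,
    fderiv_bilinear_eval hG₁ ha₁ hb₂]
  rfl

end Calculus

/-! ### Curvature of a metric in a chart -/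

section LocalMetric

variable {X E : Type*} [NormedAddCommGroup X] [NormedSpace ℝ X]
  [NormedAddCommGroup E] [NormedSpace ℝ E]

/-- The Christoffel symbols of the first kind `Γ_{uv,w}` of a field `h` of bilinear forms. -/
def christoffel (h : X → X → X → ℝ) (x u v w : X) : ℝ :=
  (fderiv ℝ (h · v w) x u + fderiv ℝ (h · u w) x v - fderiv ℝ (h · u v) x w) / 2

/-- The part of the Riemann tensor with lowered indices which is linear in the second derivatives
of the field `h` of bilinear forms. -/
def hessianCurvature (h : X → X → X → ℝ) (x u v w z : X) : ℝ :=
  (secondDeriv (h · v z) x u w - secondDeriv (h · v w) x u z - secondDeriv (h · u z) x v w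
    + secondDeriv (h · u w) x v z) / 2

/-- `Γ` are the Christoffel symbols of the second kind of the metric `g` at `x`. For a weak metric
their existence is an additional assumption. -/
def IsChristoffelSymbol (g : X → X →L[ℝ] X →L[ℝ] ℝ) (x : X) (Γ : X → X → X) : Prop :=
  ∀ u v w, g x (Γ u v) w = christoffel (g · · ·) x u v w

/-- The Riemann tensor with lowered indices of the metric `g` at `x`, where `Γ` are its Christoffel
symbols of the second kind at `x`; its sign makes `riemannForm g Γ x u v v u` the numerator of the
sectional curvature. -/
def riemannForm (g : X → X →L[ℝ] X →L[ℝ] ℝ) (Γ : X → X → X) (x u v w z : X) : ℝ :=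
  hessianCurvature (g · · ·) x u v w z - g x (Γ v w) (Γ u z) + g x (Γ u w) (Γ v z)

/-- The pullback `ψ^* g` of a metric. -/
def pullback (g : E → E →L[ℝ] E →L[ℝ] ℝ) (ψ : X → E) (n a b : X) : ℝ :=
  g (ψ n) (fderiv ℝ ψ n a) (fderiv ℝ ψ n b)

/-- The covariant derivative at `n` in the direction `j` of the vector field `∂ₖψ` along `ψ`. -/
def covariantHessian (Γ : E → E → E) (ψ : X → E) (n j k : X) : E :=
  secondDeriv ψ n j k + Γ (fderiv ℝ ψ n j) (fderiv ℝ ψ n k)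

section Congruence

variable {h h' : X → X → X → ℝ} {x : X}

lemma christoffel_congr (hh : ∀ᶠ y in 𝓝 x, ∀ a b, h y a b = h' y a b) (u v w : X) :
    christoffel h x u v w = christoffel h' x u v w := by
  have hab (a b : X) : fderiv ℝ (h · a b) x = fderiv ℝ (h' · a b) x :=
    Filter.EventuallyEq.fderiv_eq (hh.mono fun y hy ↦ hy a b)
  simp only [christoffel, hab]

lemma christoffel_add (hh : ∀ a b, DifferentiableAt ℝ (h · a b) x)
    (hh' : ∀ a b, DifferentiableAt ℝ (h' · a b) x) (u v w : X) :
    christoffel (fun y a b ↦ h y a b + h' y a b) x u v w =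
      christoffel h x u v w + christoffel h' x u v w := by
  simp only [christoffel, fderiv_fun_add (hh _ _) (hh' _ _), add_apply]
  ring

lemma hessianCurvature_congr (hh : ∀ᶠ y in 𝓝 x, ∀ a b, h y a b = h' y a b) (u v w z : X) :
    hessianCurvature h x u v w z = hessianCurvature h' x u v w z := by
  have hab (a b u v : X) : secondDeriv (h · a b) x u v = secondDeriv (h' · a b) x u v :=
    secondDeriv_congr (hh.mono fun y hy ↦ hy a b) u v
  simp only [hessianCurvature, hab]

lemma hessianCurvature_add (hh : ∀ a b, ContDiffAt ℝ 2 (h · a b) x)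
    (hh' : ∀ a b, ContDiffAt ℝ 2 (h' · a b) x) (u v w z : X) :
    hessianCurvature (fun y a b ↦ h y a b + h' y a b) x u v w z =
      hessianCurvature h x u v w z + hessianCurvature h' x u v w z := by
  simp only [hessianCurvature, secondDeriv_add (hh _ _) (hh' _ _)]
  ring

end Congruence

variable {g : E → E →L[ℝ] E →L[ℝ] ℝ} {x : E}

lemma fderiv_eval₂ (hg : DifferentiableAt ℝ g x) (u v w : E) :
    fderiv ℝ (g · v w) x u = fderiv ℝ g x u v w := by
  rw [fderiv_eval (α := (g · v)) (by fun_prop), fderiv_eval hg]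

lemma secondDeriv_eval₂ (hg : ContDiffAt ℝ 2 g x) (u v a b : E) :
    secondDeriv (g · a b) x u v = secondDeriv g x u v a b := by
  rw [secondDeriv_eval (α := (g · a)) (hg.clm_apply contDiffAt_const), secondDeriv_eval hg]

lemma fderiv_metric_symm (hs : ∀ y u v, g y u v = g y v u) (hg : DifferentiableAt ℝ g x)
    (u v w : E) : fderiv ℝ g x u v w = fderiv ℝ g x u w v := by
  rw [← fderiv_eval₂ hg, ← fderiv_eval₂ hg]
  simp only [hs _ v w]

lemma christoffel_eq (hg : DifferentiableAt ℝ g x) (u v w : E) :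
    christoffel (g · · ·) x u v w =
      (fderiv ℝ g x u v w + fderiv ℝ g x v u w - fderiv ℝ g x w u v) / 2 := by
  simp only [christoffel, fderiv_eval₂ hg]

lemma christoffel_comm (hs : ∀ y u v, g y u v = g y v u) (u v w : E) :
    christoffel (g · · ·) x u v w = christoffel (g · · ·) x v u w := by
  simp only [christoffel, hs _ v u]
  ring

variable {ψ : X → E} {n : X}

lemma contDiffAt_pullback {k : WithTop ℕ∞} (hg : ContDiffAt ℝ k g (ψ n))
    (hψ : ContDiffAt ℝ (k + 1) ψ n) (a b : X) : ContDiffAt ℝ k (pullback g ψ · a b) n := by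
  have hdψ : ContDiffAt ℝ k (fderiv ℝ ψ) n := hψ.fderiv_right le_rfl
  exact ((hg.comp n (hψ.of_le le_self_add)).clm_apply (hdψ.clm_apply contDiffAt_const)).clm_apply
    (hdψ.clm_apply contDiffAt_const)

set_option synthInstance.maxHeartbeats 100000 in
-- the normed structure on `E →L[ℝ] E →L[ℝ] E →L[ℝ] ℝ`, where `fderiv ℝ g` takes its values
lemma fderiv_pullback (hg : DifferentiableAt ℝ g (ψ n)) (hψ : ContDiffAt ℝ 2 ψ n) (u a b : X) :
    fderiv ℝ (pullback g ψ · a b) n u =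
      fderiv ℝ g (ψ n) (fderiv ℝ ψ n u) (fderiv ℝ ψ n a) (fderiv ℝ ψ n b)
        + g (ψ n) (secondDeriv ψ n u a) (fderiv ℝ ψ n b)
        + g (ψ n) (fderiv ℝ ψ n a) (secondDeriv ψ n u b) := by
  have hψ₁ := hψ.differentiableAt (by norm_num)
  rw [← fderiv_comp_eval (f := g) hg hψ₁]
  exact fderiv_bilinear_eval (G := fun n ↦ g (ψ n)) (DifferentiableAt.comp (g := g) n hg hψ₁)
    (differentiableAt_fderiv_apply hψ a)
    (differentiableAt_fderiv_apply hψ b) u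

lemma christoffel_pullback {Γ : E → E → E} (hs : ∀ y u v, g y u v = g y v u)
    (hg : DifferentiableAt ℝ g (ψ n)) (hψ : ContDiffAt ℝ 2 ψ n)
    (hΓ : IsChristoffelSymbol g (ψ n) Γ) (u v w : X) :
    christoffel (pullback g ψ) n u v w =
      g (ψ n) (covariantHessian Γ ψ n u v) (fderiv ℝ ψ n w) := by
  simp only [christoffel, fderiv_pullback hg hψ, covariantHessian, map_add, add_apply,
    (hΓ _ _ _).trans (christoffel_eq hg _ _ _)]
  rw [secondDeriv_comm hψ v u, secondDeriv_comm hψ w u, secondDeriv_comm hψ w v,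
    hs _ (fderiv ℝ ψ n v) (secondDeriv ψ n u w), hs _ (fderiv ℝ ψ n u) (secondDeriv ψ n v w)]
  ring

set_option synthInstance.maxHeartbeats 100000 in
-- the normed structure on `E →L[ℝ] E →L[ℝ] E →L[ℝ] ℝ`, where `fderiv ℝ g` takes its values
lemma secondDeriv_pullback (hg : ContDiffAt ℝ 2 g (ψ n)) (hψ : ContDiffAt ℝ 3 ψ n)
    (u w a b : X) :
    secondDeriv (pullback g ψ · a b) n u w =
      secondDeriv g (ψ n) (fderiv ℝ ψ n u) (fderiv ℝ ψ n w) (fderiv ℝ ψ n a) (fderiv ℝ ψ n b)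
        + fderiv ℝ g (ψ n) (secondDeriv ψ n u w) (fderiv ℝ ψ n a) (fderiv ℝ ψ n b)
        + fderiv ℝ g (ψ n) (fderiv ℝ ψ n w) (secondDeriv ψ n u a) (fderiv ℝ ψ n b)
        + fderiv ℝ g (ψ n) (fderiv ℝ ψ n w) (fderiv ℝ ψ n a) (secondDeriv ψ n u b)
      + (fderiv ℝ g (ψ n) (fderiv ℝ ψ n u) (secondDeriv ψ n w a) (fderiv ℝ ψ n b)
        + g (ψ n) (secondDeriv (fderiv ℝ ψ) n u w a) (fderiv ℝ ψ n b)
        + g (ψ n) (secondDeriv ψ n w a) (secondDeriv ψ n u b))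
      + (fderiv ℝ g (ψ n) (fderiv ℝ ψ n u) (fderiv ℝ ψ n a) (secondDeriv ψ n w b)
        + g (ψ n) (secondDeriv ψ n u a) (secondDeriv ψ n w b)
        + g (ψ n) (fderiv ℝ ψ n a) (secondDeriv (fderiv ℝ ψ) n u w b)) := by
  have hψ₂ : ContDiffAt ℝ 2 ψ n := hψ.of_le (by norm_num)
  have hdψ : ContDiffAt ℝ 2 (fderiv ℝ ψ) n := hψ.fderiv_right (by norm_num)
  have hg₁ := hg.differentiableAt (by norm_num)
  have hψ₁ := hψ.differentiableAt (by norm_num)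
  refine (secondDeriv_bilinear (G := fun n ↦ g (ψ n)) (hg.comp n hψ₂)
    (hdψ.clm_apply contDiffAt_const) (hdψ.clm_apply contDiffAt_const) u w).trans ?_
  rw [secondDeriv_comp hg hψ₂, fderiv_comp_eval hg₁ hψ₁, fderiv_comp_eval hg₁ hψ₁,
    secondDeriv_eval hdψ, secondDeriv_eval hdψ]
  rfl

/-- The Gauss equation: as `ψ` need not be isometric, the full covariant derivatives of `dψ` appear
instead of their normal components. -/
lemma hessianCurvature_pullback {Γ : E → E → E} (hs : ∀ y u v, g y u v = g y v u)
    (hg : ContDiffAt ℝ 2 g (ψ n)) (hψ : ContDiffAt ℝ 3 ψ n)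
    (hΓ : IsChristoffelSymbol g (ψ n) Γ) (i j k l : X) :
    hessianCurvature (pullback g ψ) n i j k l =
      riemannForm g Γ (ψ n) (fderiv ℝ ψ n i) (fderiv ℝ ψ n j) (fderiv ℝ ψ n k) (fderiv ℝ ψ n l)
        + g (ψ n) (covariantHessian Γ ψ n j k) (covariantHessian Γ ψ n i l)
        - g (ψ n) (covariantHessian Γ ψ n i k) (covariantHessian Γ ψ n j l) := by
  have hψ₂ : ContDiffAt ℝ 2 ψ n := hψ.of_le (by norm_num)
  have hdψ : ContDiffAt ℝ 2 (fderiv ℝ ψ) n := hψ.fderiv_right (by norm_num)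
  have hg₁ := hg.differentiableAt (by norm_num)
  have metric_symm := hs (ψ n)
  have dmetric_symm := fderiv_metric_symm hs hg₁
  simp only [hessianCurvature, secondDeriv_pullback hg hψ, riemannForm, covariantHessian, map_add,
    add_apply, hΓ _ _ _, (metric_symm _ (Γ _ _)).trans (hΓ _ _ _), christoffel_eq hg₁,
    secondDeriv_eval₂ hg]
  rw [secondDeriv_fderiv_comm_right hψ i l j, secondDeriv_fderiv_comm_right hψ j k i,
    secondDeriv_comm hdψ j i, secondDeriv_fderiv_comm_right hψ j l i, secondDeriv_comm hdψ j i,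
    secondDeriv_fderiv_comm_right hψ i l k, secondDeriv_fderiv_comm_right hψ j l k,
    secondDeriv_fderiv_comm_right hψ i k j,
    secondDeriv_comm hψ₂ j i, secondDeriv_comm hψ₂ k i, secondDeriv_comm hψ₂ k j,
    secondDeriv_comm hψ₂ l i, secondDeriv_comm hψ₂ l j, secondDeriv_comm hψ₂ l k]
  generalize secondDeriv ψ n i j = ij, secondDeriv ψ n i k = ik, secondDeriv ψ n i l = il,
    secondDeriv ψ n j k = jk, secondDeriv ψ n j l = jl, secondDeriv ψ n k l = kl,
    fderiv ℝ ψ n i = vi, fderiv ℝ ψ n j = vj, fderiv ℝ ψ n k = vk, fderiv ℝ ψ n l = vl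
  linarith [metric_symm jl ik, metric_symm il jk, dmetric_symm vi jk vl, dmetric_symm vi jl vk,
    dmetric_symm vj ik vl, dmetric_symm vj il vk]

section Degenerate

variable {G : X → E →L[ℝ] E →L[ℝ] ℝ} {β : X → X →L[ℝ] E} {u v : X}

lemma christoffel_of_degenerate (hG : DifferentiableAt ℝ G n) (hβ : DifferentiableAt ℝ β n)
    (hu : β n u = 0) (hv : β n v = 0) (w : X) :
    christoffel (fun y a b ↦ G y (β y a) (β y b)) n u v w =
      (G n (fderiv ℝ β n u v) (β n w) + G n (fderiv ℝ β n v u) (β n w)) / 2 := by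
  have hβ' (a : X) : DifferentiableAt ℝ (β · a) n := hβ.clm_apply (by fun_prop)
  simp only [christoffel, fderiv_bilinear_eval hG (hβ' _) (hβ' _), fderiv_eval hβ, hu, hv, map_zero,
    zero_apply]
  ring

lemma secondDeriv_of_degenerate (hG : ContDiffAt ℝ 2 G n) (hβ : ContDiffAt ℝ 2 β n)
    (hu : β n u = 0) (hv : β n v = 0) (w z : X) :
    secondDeriv (fun y ↦ G y (β y u) (β y v)) n w z =
      G n (fderiv ℝ β n z u) (fderiv ℝ β n w v) + G n (fderiv ℝ β n w u) (fderiv ℝ β n z v) := by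
  have hβ' (a : X) : ContDiffAt ℝ 2 (β · a) n := hβ.clm_apply contDiffAt_const
  simp only [secondDeriv_bilinear hG (hβ' _) (hβ' _), fderiv_eval (hβ.differentiableAt two_ne_zero),
    hu, hv, map_zero, zero_apply]
  ring

lemma hessianCurvature_of_degenerate (hG : ContDiffAt ℝ 2 G n) (hβ : ContDiffAt ℝ 2 β n)
    (hs : ∀ e f, G n e f = G n f e) (hu : β n u = 0) (hv : β n v = 0) :
    hessianCurvature (fun y a b ↦ G y (β y a) (β y b)) n u v v u =
      G n (fderiv ℝ β n u u) (fderiv ℝ β n v v) + G n (fderiv ℝ β n u v) (fderiv ℝ β n v u)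
        - G n (fderiv ℝ β n u v) (fderiv ℝ β n u v)
        - G n (fderiv ℝ β n v u) (fderiv ℝ β n v u) := by
  simp only [hessianCurvature, secondDeriv_of_degenerate hG hβ hu hu,
    secondDeriv_of_degenerate hG hβ hv hv, secondDeriv_of_degenerate hG hβ hu hv,
    secondDeriv_of_degenerate hG hβ hv hu]
  rw [hs (fderiv ℝ β n v v), hs (fderiv ℝ β n v u) (fderiv ℝ β n u v)]
  ring

end Degenerate

end LocalMetric

/-! ### Inner products, complex structures and orthogonal projections -/

section InnerProduct

variable {V : Type*} [AddCommGroup V] [Module ℝ V] [TopologicalSpace V]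
  {b : V →L[ℝ] V →L[ℝ] ℝ}

/-- A weak inner product: a positive definite symmetric continuous bilinear form, which need not
induce the topology of the space. -/
structure IsInnerProduct (b : V →L[ℝ] V →L[ℝ] ℝ) : Prop where
  symm : ∀ v w, b v w = b w v
  pos : ∀ v, v ≠ 0 → 0 < b v v

namespace IsInnerProduct

lemma nonneg (hb : IsInnerProduct b) (v : V) : 0 ≤ b v v := by
  rcases eq_or_ne v 0 with rfl | hv
  · simp
  · exact (hb.pos v hv).le

lemma eq_zero_of_apply_self (hb : IsInnerProduct b) {v : V} (hv : b v v = 0) : v = 0 := by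
  by_contra hne
  exact (hb.pos v hne).ne' hv

lemma ext (hb : IsInnerProduct b) {v w : V} (h : ∀ z, b v z = b w z) : v = w :=
  sub_eq_zero.1 <| hb.eq_zero_of_apply_self <| by
    rw [map_sub b, sub_apply, h, sub_self]

lemma apply_sq_le (hb : IsInnerProduct b) (v w : V) : b v w ^ 2 ≤ b v v * b w w :=
  LinearMap.BilinForm.apply_sq_le_of_symm b.toLinearMap₁₂ hb.nonneg ⟨hb.symm⟩ v w

lemma exists_smul_apply_self_eq_one (hb : IsInnerProduct b) {v : V} (hv : v ≠ 0) :
    ∃ r : ℝ, b (r • v) (r • v) = 1 := by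
  refine ⟨(√(b v v))⁻¹, ?_⟩
  simp only [map_smul, smul_apply, smul_eq_mul]
  rw [← mul_assoc, ← mul_inv, Real.mul_self_sqrt (hb.nonneg v),
    inv_mul_cancel₀ (hb.pos v hv).ne']

variable {u v : V}

lemma linearIndependent_of_orthonormal (hu : b u u = 1) (hv : b v v = 1) (huv : b u v = 0) :
    LinearIndependent ℝ ![u, v] := by
  rw [LinearIndependent.pair_iff]
  intro s t hst
  have hs : b (s • u + t • v) v = t := by simp [huv, hv]
  have ht : b u (s • u + t • v) = s := by simp [huv, hu]
  rw [hst] at hs ht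
  simp only [map_zero, zero_apply] at hs ht
  exact ⟨ht.symm, hs.symm⟩

lemma finrank_span_of_orthonormal (hu : b u u = 1) (hv : b v v = 1) (huv : b u v = 0) :
    Module.finrank ℝ (Submodule.span ℝ {u, v}) = 2 := by
  have h := finrank_span_eq_card (linearIndependent_of_orthonormal hu hv huv)
  rwa [Matrix.range_cons, Matrix.range_cons, Matrix.range_empty, Set.union_empty,
    Set.singleton_union, Fintype.card_fin] at h

lemma exists_orthonormal_span_eq (hb : IsInnerProduct b) {P : Submodule ℝ V}
    (hP : Module.finrank ℝ P = 2) :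
    ∃ u v, b u u = 1 ∧ b v v = 1 ∧ b u v = 0 ∧ Submodule.span ℝ {u, v} = P := by
  have : FiniteDimensional ℝ P := .of_finrank_eq_succ hP
  have hne : P ≠ ⊥ := by
    rintro rfl
    simp at hP
  obtain ⟨e, heP, he⟩ := P.exists_mem_ne_zero_of_ne_bot hne
  obtain ⟨r, hu⟩ := hb.exists_smul_apply_self_eq_one he
  have huP : r • e ∈ P := P.smul_mem r heP
  generalize r • e = u at hu huP
  obtain ⟨f, hfP, hf⟩ : ∃ f ∈ P, f ∉ Submodule.span ℝ {u} := by
    by_contra! hle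
    have h := (Submodule.finrank_mono (show P ≤ Submodule.span ℝ {u} from hle)).trans
      (finrank_span_le_card {u})
    simp [hP] at h
  have hw : f - b u f • u ≠ 0 := fun h ↦
    hf (Submodule.mem_span_singleton.2 ⟨_, (sub_eq_zero.1 h).symm⟩)
  obtain ⟨s, hv⟩ := hb.exists_smul_apply_self_eq_one hw
  have huv : b u (s • (f - b u f • u)) = 0 := by simp [hu]
  refine ⟨u, _, hu, hv, huv, Submodule.eq_of_le_of_finrank_eq ?_ ?_⟩
  · rw [Submodule.span_le, Set.insert_subset_iff, Set.singleton_subset_iff]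
    exact ⟨huP, P.smul_mem _ (P.sub_mem hfP (P.smul_mem _ huP))⟩
  · rw [hP, finrank_span_of_orthonormal hu hv huv]

section Polarization

variable {W : Type*} [AddCommGroup W] [Module ℝ W] [TopologicalSpace W]
  {a : W →L[ℝ] W →L[ℝ] ℝ} {B : W →ₗ[ℝ] W →ₗ[ℝ] V} {H : Submodule ℝ W} {C : ℝ}

lemma apply_diag_le (ha : IsInnerProduct a)
    (hC : ∀ w ∈ H, a w w = 1 → b (B w w) (B w w) ≤ C) {w : W} (hw : w ∈ H) :
    b (B w w) (B w w) ≤ C * a w w ^ 2 := by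
  rcases eq_or_ne w 0 with rfl | hne
  · simp
  obtain ⟨r, hr⟩ := ha.exists_smul_apply_self_eq_one hne
  have hle := hC _ (H.smul_mem r hw) hr
  simp only [map_smul, LinearMap.smul_apply, smul_apply, smul_eq_mul] at hle hr
  calc b (B w w) (B w w) = (r * (r * a w w)) ^ 2 * b (B w w) (B w w) := by rw [hr]; ring
    _ = r * (r * (r * (r * b (B w w) (B w w)))) * a w w ^ 2 := by ring
    _ ≤ C * a w w ^ 2 := by gcongr

/-- Polarise, `4 B(v, w) = B(v + w, v + w) - B(v - w, v - w)`, and use the Cauchy-Schwarz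
inequality and the parallelogram law. -/
lemma apply_le_of_apply_diag_le (hb : IsInnerProduct b) (ha : IsInnerProduct a)
    (hB : ∀ v w, B v w = B w v) (hC : ∀ w ∈ H, a w w = 1 → b (B w w) (B w w) ≤ C) {v w : W}
    (hv : v ∈ H) (hw : w ∈ H) (hv₁ : a v v = 1) (hw₁ : a w w = 1) :
    b (B v w) (B v w) ≤ C := by
  have hC₀ : 0 ≤ C := (hb.nonneg _).trans (hC v hv hv₁)
  have hadd := ha.apply_diag_le hC (H.add_mem hv hw)
  have hsub := ha.apply_diag_le hC (H.sub_mem hv hw)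
  have parallelogram : a (v + w) (v + w) + a (v - w) (v - w) = 4 := by
    simp only [map_add, map_sub, add_apply, sub_apply, hv₁, hw₁]
    ring
  have polarization : B (v + w) (v + w) - B (v - w) (v - w) = (4 : ℝ) • B v w := by
    simp only [map_add, map_sub, LinearMap.add_apply, LinearMap.sub_apply, hB w v]
    module
  set s := a (v + w) (v + w)
  set t := a (v - w) (v - w)
  set β := B (v + w) (v + w)
  set γ := B (v - w) (v - w)
  have cauchy_schwarz : |b β γ| ≤ C * (s * t) := by
    have hst : 0 ≤ s * t := mul_nonneg (ha.nonneg _) (ha.nonneg _)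
    refine abs_le_of_sq_le_sq ((hb.apply_sq_le β γ).trans ?_) (by positivity)
    calc _ ≤ (C * s ^ 2) * (C * t ^ 2) := mul_le_mul hadd hsub (hb.nonneg _) (by positivity)
      _ = (C * (s * t)) ^ 2 := by ring
  have expand : 16 * b (B v w) (B v w) = b β β - 2 * b β γ + b γ γ := by
    have h := congrArg (fun e ↦ b e e) polarization
    simp only [map_sub, map_smul, sub_apply, smul_apply, smul_eq_mul, hb.symm γ β] at h
    linarith
  have hsum : C * (s + t) ^ 2 = 16 * C := by rw [parallelogram]; ring
  linarith [neg_le_of_abs_le cauchy_schwarz]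

lemma apply_le_mul_of_apply_diag_le (hb : IsInnerProduct b) (ha : IsInnerProduct a)
    (hB : ∀ v w, B v w = B w v) (hC : ∀ w ∈ H, a w w = 1 → b (B w w) (B w w) ≤ C) {v w : W}
    (hv : v ∈ H) (hw : w ∈ H) : b (B v w) (B v w) ≤ C * (a v v * a w w) := by
  rcases eq_or_ne v 0 with rfl | hv₀
  · simp
  rcases eq_or_ne w 0 with rfl | hw₀
  · simp
  obtain ⟨r, hr⟩ := ha.exists_smul_apply_self_eq_one hv₀
  obtain ⟨s, hs⟩ := ha.exists_smul_apply_self_eq_one hw₀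
  have hle := hb.apply_le_of_apply_diag_le ha hB hC (H.smul_mem r hv) (H.smul_mem s hw) hr hs
  simp only [map_smul, LinearMap.smul_apply, smul_apply, smul_eq_mul] at hle hr hs
  have hscale : b (B v w) (B v w) =
      r * (s * (r * (s * b (B v w) (B v w)))) * (a v v * a w w) := by
    linear_combination -b (B v w) (B v w) * (s * (s * a w w) * hr + hs)
  rw [hscale]
  exact mul_le_mul_of_nonneg_right (by linarith) (mul_nonneg (ha.nonneg v) (ha.nonneg w))

end Polarization

end IsInnerProduct

/-- `J` is a complex structure which is an isometry of `b`. -/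
structure IsHermitianStructure (b : V →L[ℝ] V →L[ℝ] ℝ) (J : V →L[ℝ] V) : Prop where
  sq : ∀ v, J (J v) = -v
  isometry : ∀ v w, b (J v) (J w) = b v w

namespace IsHermitianStructure

variable {J : V →L[ℝ] V}

lemma injective (hJ : IsHermitianStructure b J) : Function.Injective J := fun v w h ↦ by
  rw [← neg_inj, ← hJ.sq, ← hJ.sq, h]

lemma apply_left (hJ : IsHermitianStructure b J) (v w : V) : b (J v) w = -b v (J w) := by
  rw [← hJ.isometry v, hJ.sq, map_neg, neg_neg]

lemma apply_self (hJ : IsHermitianStructure b J) (hb : IsInnerProduct b) (v : V) :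
    b v (J v) = 0 := by
  linarith [hJ.apply_left v v, hb.symm v (J v)]

end IsHermitianStructure

/-- `T` is the projection onto `U` which is orthogonal for `b`. -/
structure IsOrthogonalProjection (b : V →L[ℝ] V →L[ℝ] ℝ) (U : Submodule ℝ V) (T : V →L[ℝ] V) :
    Prop where
  mem : ∀ v, T v ∈ U
  orthogonal : ∀ v, ∀ u ∈ U, b (v - T v) u = 0

namespace IsOrthogonalProjection

variable {U : Submodule ℝ V} {T : V →L[ℝ] V} {u v : V}

lemma apply_apply (hT : IsOrthogonalProjection b U T) (v : V) (hu : u ∈ U) :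
    b (T v) u = b v u := by
  have h := hT.orthogonal v u hu
  rw [map_sub b, sub_apply, sub_eq_zero] at h
  exact h.symm

lemma apply_eq (hT : IsOrthogonalProjection b U T) (hb : IsInnerProduct b) (hu : u ∈ U)
    (h : ∀ w ∈ U, b (v - u) w = 0) : T v = u := by
  have hmem : T v - u ∈ U := U.sub_mem (hT.mem v) hu
  refine sub_eq_zero.1 (hb.eq_zero_of_apply_self ?_)
  have hle := h _ hmem
  simp only [map_sub b, sub_apply] at hle ⊢
  rw [hT.apply_apply v hmem, hle]

lemma apply_of_mem (hT : IsOrthogonalProjection b U T) (hb : IsInnerProduct b) (hu : u ∈ U) :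
    T u = u :=
  hT.apply_eq hb hu fun w _ ↦ by simp

lemma apply_eq_zero_iff (hT : IsOrthogonalProjection b U T) (hb : IsInnerProduct b) :
    T v = 0 ↔ ∀ u ∈ U, b v u = 0 :=
  ⟨fun h u hu ↦ by rw [← hT.apply_apply v hu, h, map_zero, zero_apply],
    fun h ↦ hT.apply_eq hb U.zero_mem (by simpa using h)⟩

lemma apply_eq_add (hT : IsOrthogonalProjection b U T) (hb : IsInnerProduct b) (v w : V) :
    b v w = b (v - T v) (w - T w) + b (T v) (T w) := by
  have hv := hT.orthogonal v _ (hT.mem w)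
  have hw := hT.orthogonal w _ (hT.mem v)
  simp only [map_sub, sub_apply] at hv hw ⊢
  linarith [hb.symm w (T v), hb.symm (T w) (T v)]

end IsOrthogonalProjection

end InnerProduct

lemma contDiffAt_inverse_of_bijective {X E F : Type*} [NormedAddCommGroup X] [NormedSpace ℝ X]
    [NormedAddCommGroup E] [NormedSpace ℝ E] [CompleteSpace E]
    [NormedAddCommGroup F] [NormedSpace ℝ F] [CompleteSpace F] {k : WithTop ℕ∞} {x : X}
    {Φ : X → E →L[ℝ] F} (hΦ : ContDiffAt ℝ k Φ x) (hbij : Function.Bijective (Φ x)) :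
    ContDiffAt ℝ k (fun y ↦ (Φ y).inverse) x ∧ ∀ᶠ y in 𝓝 x, (Φ y).IsInvertible := by
  let e : E ≃L[ℝ] F := .ofBijective (Φ x) (LinearMap.ker_eq_bot.2 hbij.1)
    (LinearMap.range_eq_top.2 hbij.2)
  have he : Φ x = e := rfl
  constructor
  · refine ContDiffAt.comp (g := ContinuousLinearMap.inverse) x ?_ hΦ
    rw [he]
    exact contDiffAt_map_inverse e
  · refine hΦ.continuousAt.eventually (p := (·.IsInvertible)) ?_
    rw [he]
    exact e.nhds

lemma completeSpace_of_leftInverse {X E : Type*} [NormedAddCommGroup X] [NormedSpace ℝ X]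
    [NormedAddCommGroup E] [NormedSpace ℝ E] [CompleteSpace E] {f : X →L[ℝ] E} {r : E →L[ℝ] X}
    (h : Function.LeftInverse r f) : CompleteSpace X :=
  Metric.complete_of_cauchySeq_tendsto fun u hu ↦
    have ⟨e, he⟩ := cauchySeq_tendsto_of_complete (f.uniformContinuous.comp_cauchySeq hu)
    ⟨r e, by simpa only [Function.comp_def, h _] using (r.continuous.tendsto e).comp he⟩

lemma exists_kernel_projection {X Q : Type*} [NormedAddCommGroup X] [NormedSpace ℝ X]
    [NormedAddCommGroup Q] [NormedSpace ℝ Q] [CompleteSpace Q] {k : WithTop ℕ∞} {x : X}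
    {α : X → X →L[ℝ] Q} (hα : ContDiffAt ℝ k α x) {s : Q →L[ℝ] X}
    (hs : Function.RightInverse s (α x)) :
    ∃ B : X → X →L[ℝ] X, ContDiffAt ℝ k B x ∧ (∀ᶠ y in 𝓝 x, ∀ w, α y (B y w) = 0) ∧
      ∀ w, α x w = 0 → B x w = w := by
  have hcomp : ContDiffAt ℝ k (fun y ↦ α y ∘L s) x := hα.clm_comp contDiffAt_const
  have hid : ⇑(α x ∘L s) = id := funext hs
  obtain ⟨hinv, hinvertible⟩ :=
    contDiffAt_inverse_of_bijective hcomp (hid ▸ Function.bijective_id)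
  refine ⟨fun y ↦ .id ℝ X - s ∘L (α y ∘L s).inverse ∘L α y,
    contDiffAt_const.sub (contDiffAt_const.clm_comp (hinv.clm_comp hα)), ?_, ?_⟩
  · filter_upwards [hinvertible] with y hy w
    have h := hy.self_apply_inverse (α y w)
    simp only [ContinuousLinearMap.comp_apply] at h
    simp [h]
  · intro w hw
    simp [hw]

lemma IsChristoffelSymbol.exists_bilinear {E : Type*} [NormedAddCommGroup E] [NormedSpace ℝ E]
    {g : E → E →L[ℝ] E →L[ℝ] ℝ} {x : E} {Γ : E → E → E} (hΓ : IsChristoffelSymbol g x Γ)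
    (hg : DifferentiableAt ℝ g x) (hgx : IsInnerProduct (g x)) :
    ∃ Γ' : E →ₗ[ℝ] E →ₗ[ℝ] E, ∀ u v, Γ' u v = Γ u v := by
  have koszul (u v z : E) := (hΓ u v z).trans (christoffel_eq hg u v z)
  generalize fderiv ℝ g x = dg at koszul
  have add_left (u u' v : E) : Γ (u + u') v = Γ u v + Γ u' v := hgx.ext fun z ↦ by
    rw [map_add (g x), add_apply, koszul, koszul, koszul]
    simp only [ContinuousLinearMap.map_add, add_apply]
    ring
  have add_right (u v v' : E) : Γ u (v + v') = Γ u v + Γ u v' := hgx.ext fun z ↦ by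
    rw [map_add (g x), add_apply, koszul, koszul, koszul]
    simp only [ContinuousLinearMap.map_add, add_apply]
    ring
  have smul_left (r : ℝ) (u v : E) : Γ (r • u) v = r • Γ u v := hgx.ext fun z ↦ by
    rw [map_smul (g x), smul_apply, koszul, koszul]
    simp only [ContinuousLinearMap.map_smul, smul_apply, smul_eq_mul]
    ring
  have smul_right (r : ℝ) (u v : E) : Γ u (r • v) = r • Γ u v := hgx.ext fun z ↦ by
    rw [map_smul (g x), smul_apply, koszul, koszul]
    simp only [ContinuousLinearMap.map_smul, smul_apply, smul_eq_mul]
    ring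
  exact ⟨.mk₂ ℝ Γ add_left smul_left add_right smul_right, fun _ _ ↦ rfl⟩

/-! ### The Kähler quotient in charts -/

/-- A Kähler quotient read in charts centred at one point: `ψ` is the inclusion of the level set
in the Kähler manifold, with metric `g` and complex structure `J`, and `p` is the projection to the
quotient, with metric `gQ`. Only the germs at `n₀`, `ψ n₀` and `p n₀` are constrained. -/
structure LocalKahlerQuotient (X E Q : Type*) [NormedAddCommGroup X] [NormedSpace ℝ X]
    [NormedAddCommGroup E] [NormedSpace ℝ E] [NormedAddCommGroup Q] [NormedSpace ℝ Q] where
  g : E → E →L[ℝ] E →L[ℝ] ℝ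
  J : E → E →L[ℝ] E
  gQ : Q → Q →L[ℝ] Q →L[ℝ] ℝ
  ψ : X → E
  p : X → Q
  n₀ : X
  /-- The Christoffel symbols of `g` at `ψ n₀`. -/
  Γ : E → E → E
  /-- The Christoffel symbols of `gQ` at `p n₀`. -/
  ΓQ : Q → Q → Q
  contDiffAt_g : ContDiffAt ℝ ∞ g (ψ n₀)
  contDiffAt_J : ContDiffAt ℝ ∞ J (ψ n₀)
  contDiffAt_gQ : ContDiffAt ℝ ∞ gQ (p n₀)
  contDiffAt_ψ : ContDiffAt ℝ ∞ ψ n₀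
  contDiffAt_p : ContDiffAt ℝ ∞ p n₀
  g_symm : ∀ y v w, g y v w = g y w v
  gQ_symm : ∀ y v w, gQ y v w = gQ y w v
  isInnerProduct_g : ∀ᶠ n in 𝓝 n₀, IsInnerProduct (g (ψ n))
  isInnerProduct_gQ : IsInnerProduct (gQ (p n₀))
  isHermitianStructure_J : ∀ᶠ n in 𝓝 n₀, IsHermitianStructure (g (ψ n)) (J (ψ n))
  isChristoffelSymbol_Γ : IsChristoffelSymbol g (ψ n₀) Γ
  isChristoffelSymbol_ΓQ : IsChristoffelSymbol gQ (p n₀) ΓQ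
  J_parallel : ∀ u v, fderiv ℝ J (ψ n₀) u v + Γ u (J (ψ n₀) v) = J (ψ n₀) (Γ u v)
  exists_leftInverse : ∃ r : E →L[ℝ] X, Function.LeftInverse r (fderiv ℝ ψ n₀)
  exists_rightInverse : ∃ s : Q →L[ℝ] X, Function.RightInverse s (fderiv ℝ p n₀)
  orthogonal : ∀ᶠ n in 𝓝 n₀, ∀ v, ∀ w ∈ (fderiv ℝ p n).ker.map (fderiv ℝ ψ n).toLinearMap,
    g (ψ n) (fderiv ℝ ψ n v) (J (ψ n) w) = 0
  riemannian : ∀ᶠ n in 𝓝 n₀, ∀ v v',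
    (∀ w ∈ (fderiv ℝ p n).ker.map (fderiv ℝ ψ n).toLinearMap, g (ψ n) (fderiv ℝ ψ n v) w = 0) →
    (∀ w ∈ (fderiv ℝ p n).ker.map (fderiv ℝ ψ n).toLinearMap, g (ψ n) (fderiv ℝ ψ n v') w = 0) →
      gQ (p n) (fderiv ℝ p n v) (fderiv ℝ p n v') = g (ψ n) (fderiv ℝ ψ n v) (fderiv ℝ ψ n v')
  elliptic : ∀ e, ∃ u ∈ (fderiv ℝ p n₀).ker.map (fderiv ℝ ψ n₀).toLinearMap,
    ∀ w ∈ (fderiv ℝ p n₀).ker.map (fderiv ℝ ψ n₀).toLinearMap, g (ψ n₀) (e - u) w = 0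
  tangent : ∀ e, (∀ w ∈ (fderiv ℝ p n₀).ker.map (fderiv ℝ ψ n₀).toLinearMap,
    g (ψ n₀) e (J (ψ n₀) w) = 0) → ∃ v, fderiv ℝ ψ n₀ v = e

namespace LocalKahlerQuotient

variable {X E Q : Type*} [NormedAddCommGroup X] [NormedSpace ℝ X]
  [NormedAddCommGroup E] [NormedSpace ℝ E] [NormedAddCommGroup Q] [NormedSpace ℝ Q]
  (K : LocalKahlerQuotient X E Q)

/-- The inner product of the Kähler manifold at the base point. -/
abbrev inner : E →L[ℝ] E →L[ℝ] ℝ := K.g (K.ψ K.n₀)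

/-- The inner product of the quotient at the base point. -/
abbrev innerQ : Q →L[ℝ] Q →L[ℝ] ℝ := K.gQ (K.p K.n₀)

/-- The differential of the inclusion at the base point. -/
abbrev dψ : X →L[ℝ] E := fderiv ℝ K.ψ K.n₀

/-- The differential of the projection at the base point. -/
abbrev dp : X →L[ℝ] Q := fderiv ℝ K.p K.n₀

/-- The complex structure at the base point. -/
abbrev J₀ : E →L[ℝ] E := K.J (K.ψ K.n₀)

/-- The vertical space at `n`: the image in `E` of the tangent space to the fibre of `p`. -/
abbrev vertical (n : X) : Submodule ℝ E := (fderiv ℝ K.p n).ker.map (fderiv ℝ K.ψ n).toLinearMap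

/-- The horizontal space at the base point, as a subspace of the tangent space of the level set. -/
def horizontal : Submodule ℝ X where
  carrier := {v | ∀ w ∈ K.vertical K.n₀, K.inner (K.dψ v) w = 0}
  add_mem' hv hw z hz := by rw [map_add, map_add K.inner, add_apply, hv z hz, hw z hz, add_zero]
  zero_mem' z _ := by rw [map_zero, map_zero, zero_apply]
  smul_mem' r v hv z hz := by rw [map_smul, map_smul K.inner, smul_apply, hv z hz, smul_zero]

lemma mem_vertical {n : X} {e : E} :
    e ∈ K.vertical n ↔ ∃ w, fderiv ℝ K.p n w = 0 ∧ fderiv ℝ K.ψ n w = e := Iff.rfl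

lemma isInnerProduct_inner : IsInnerProduct K.inner := K.isInnerProduct_g.self_of_nhds

lemma isHermitianStructure_J₀ : IsHermitianStructure K.inner K.J₀ :=
  K.isHermitianStructure_J.self_of_nhds

lemma dψ_injective : Function.Injective K.dψ :=
  have ⟨_, hr⟩ := K.exists_leftInverse
  hr.injective

lemma dψ_mem_vertical {w : X} (hw : K.dp w = 0) : K.dψ w ∈ K.vertical K.n₀ := ⟨w, hw, rfl⟩

lemma inner_dψ_J₀ (v : X) {w : E} (hw : w ∈ K.vertical K.n₀) :
    K.inner (K.dψ v) (K.J₀ w) = 0 :=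
  K.orthogonal.self_of_nhds v w hw

lemma inner_J₀_vertical {v w : E} (hv : v ∈ K.vertical K.n₀) (hw : w ∈ K.vertical K.n₀) :
    K.inner (K.J₀ v) w = 0 := by
  obtain ⟨v, -, rfl⟩ := hv
  exact (K.isHermitianStructure_J₀.apply_left _ _).trans (neg_eq_zero.2 (K.inner_dψ_J₀ v hw))

lemma innerQ_dp {v w : X} (hv : v ∈ K.horizontal) (hw : w ∈ K.horizontal) :
    K.innerQ (K.dp v) (K.dp w) = K.inner (K.dψ v) (K.dψ w) :=
  K.riemannian.self_of_nhds v w hv hw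

lemma injOn_dp_horizontal : Set.InjOn K.dp K.horizontal := fun v hv w hw h ↦ by
  have hvw : v - w ∈ K.horizontal := K.horizontal.sub_mem hv hw
  have hdψ : K.inner (K.dψ (v - w)) (K.dψ (v - w)) = 0 := by
    rw [← K.innerQ_dp hvw hvw, map_sub K.dp, h, sub_self, map_zero]
  exact sub_eq_zero.1 <| K.dψ_injective <|
    (K.isInnerProduct_inner.eq_zero_of_apply_self hdψ).trans (map_zero _).symm

lemma exists_vertical_sub_orthogonal (e : E) :
    ∃ w, K.dp w = 0 ∧ ∀ z ∈ K.vertical K.n₀, K.inner (e - K.dψ w) z = 0 := by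
  obtain ⟨_, ⟨w, hw, rfl⟩, h⟩ := K.elliptic e
  exact ⟨w, hw, h⟩

lemma exists_dψ_eq {e : E} (he : ∀ w ∈ K.vertical K.n₀, K.inner e (K.J₀ w) = 0) :
    ∃ v, K.dψ v = e := K.tangent e he

lemma exists_horizontal_dp_eq (q : Q) : ∃ v ∈ K.horizontal, K.dp v = q := by
  obtain ⟨s, hs⟩ := K.exists_rightInverse
  obtain ⟨w, hw, horth⟩ := K.exists_vertical_sub_orthogonal (K.dψ (s q))
  refine ⟨s q - w, fun z hz ↦ ?_, ?_⟩
  · rw [map_sub K.dψ]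
    exact horth z hz
  · rw [map_sub, hw, sub_zero]
    exact hs q

lemma exists_horizontal_dψ_eq_J₀ {v : X} (hv : v ∈ K.horizontal) :
    ∃ v' ∈ K.horizontal, K.dψ v' = K.J₀ (K.dψ v) := by
  obtain ⟨v', hv'⟩ := K.exists_dψ_eq (e := K.J₀ (K.dψ v)) fun w hw ↦
    (K.isHermitianStructure_J₀.isometry _ _).trans (hv w hw)
  refine ⟨v', fun w hw ↦ ?_, hv'⟩
  rw [hv', K.isHermitianStructure_J₀.apply_left, K.inner_dψ_J₀ v hw, neg_zero]

/-! ### The vertical projection -/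

/-- `P` is a smooth family of orthogonal projections onto the vertical spaces. As the metric is
weak, its existence has to be deduced from ellipticity. -/
structure IsVerticalProjection (P : X → E →L[ℝ] E) : Prop where
  contDiffAt : ContDiffAt ℝ ∞ P K.n₀
  eventually : ∀ᶠ n in 𝓝 K.n₀, IsOrthogonalProjection (K.g (K.ψ n)) (K.vertical n) (P n)

lemma bijective_J₀_dψ_add_dψ :
    Function.Bijective ((K.J₀ ∘L K.dψ).coprod (K.dψ ∘L K.dp.ker.subtypeL)) := by
  have hJ := K.isHermitianStructure_J₀
  constructor
  · refine (injective_iff_map_eq_zero _).2 fun ⟨v, w, hw⟩ h ↦ ?_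
    have hsum : K.J₀ (K.dψ v) + K.dψ w = 0 := h
    have hwv : K.dψ w ∈ K.vertical K.n₀ := K.dψ_mem_vertical hw
    have hdψw : K.dψ w = 0 := K.isInnerProduct_inner.eq_zero_of_apply_self <| by
      rw [eq_neg_of_add_eq_zero_right hsum, map_neg K.inner, neg_apply,
        ← eq_neg_of_add_eq_zero_right hsum, hJ.apply_left, K.inner_dψ_J₀ v hwv, neg_zero, neg_zero]
    rw [hdψw, add_zero] at hsum
    have hdψv : K.dψ v = 0 := hJ.injective (hsum.trans (map_zero _).symm)
    have hv : v = 0 := K.dψ_injective (hdψv.trans (map_zero _).symm)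
    have hw₀ : w = 0 := K.dψ_injective (hdψw.trans (map_zero _).symm)
    exact Prod.ext hv (Subtype.ext hw₀)
  · intro e
    obtain ⟨w, hw, horth⟩ := K.exists_vertical_sub_orthogonal e
    obtain ⟨v, hv⟩ := K.exists_dψ_eq (e := -K.J₀ (e - K.dψ w)) fun z hz ↦ by
      rw [map_neg K.inner, neg_apply, hJ.isometry, horth z hz, neg_zero]
    refine ⟨(v, ⟨w, hw⟩), ?_⟩
    change K.J₀ (K.dψ v) + K.dψ w = e
    rw [hv, map_neg, hJ.sq, neg_neg, sub_add_cancel]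

/-- A tangent vector is uniquely of the form `J v + w` with `v` tangent to the level set and `w`
vertical; inverting this smooth family of decompositions yields a smooth vertical projection. -/
lemma exists_isVerticalProjection [CompleteSpace E] [CompleteSpace Q] :
    ∃ P, K.IsVerticalProjection P := by
  obtain ⟨r, hr⟩ := K.exists_leftInverse
  obtain ⟨s, hs⟩ := K.exists_rightInverse
  have : CompleteSpace X := completeSpace_of_leftInverse hr
  have hψ : ContDiffAt ℝ ∞ (fderiv ℝ K.ψ) K.n₀ := K.contDiffAt_ψ.fderiv_right le_rfl
  have hp : ContDiffAt ℝ ∞ (fderiv ℝ K.p) K.n₀ := K.contDiffAt_p.fderiv_right le_rfl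
  have hJ : ContDiffAt ℝ ∞ (fun n ↦ K.J (K.ψ n)) K.n₀ :=
    ContDiffAt.comp (g := K.J) _ K.contDiffAt_J K.contDiffAt_ψ
  obtain ⟨B, hB, hker, hid⟩ := exists_kernel_projection hp hs
  let fst : X × K.dp.ker →L[ℝ] X := .fst ℝ X K.dp.ker
  let snd : X × K.dp.ker →L[ℝ] X := K.dp.ker.subtypeL ∘L .snd ℝ X K.dp.ker
  let Φ (n : X) : X × K.dp.ker →L[ℝ] E :=
    K.J (K.ψ n) ∘L fderiv ℝ K.ψ n ∘L fst + fderiv ℝ K.ψ n ∘L B n ∘L snd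
  have hΦ : ContDiffAt ℝ ∞ Φ K.n₀ :=
    (hJ.clm_comp (hψ.clm_comp contDiffAt_const)).add
      (hψ.clm_comp (hB.clm_comp contDiffAt_const))
  have hΦ₀ : Φ K.n₀ = (K.J₀ ∘L K.dψ).coprod (K.dψ ∘L K.dp.ker.subtypeL) := by
    refine ContinuousLinearMap.ext fun ⟨v, w, hw⟩ ↦ ?_
    change K.J₀ (K.dψ v) + K.dψ (B K.n₀ w) = K.J₀ (K.dψ v) + K.dψ w
    rw [hid w hw]
  obtain ⟨hinv, hinvertible⟩ :=
    contDiffAt_inverse_of_bijective hΦ (hΦ₀ ▸ K.bijective_J₀_dψ_add_dψ)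
  refine ⟨fun n ↦ fderiv ℝ K.ψ n ∘L B n ∘L snd ∘L (Φ n).inverse,
    hψ.clm_comp (hB.clm_comp (contDiffAt_const.clm_comp hinv)), ?_⟩
  filter_upwards [hinvertible, hker, K.orthogonal, K.isHermitianStructure_J]
    with n hΦn hker horth hJn
  refine ⟨fun e ↦ ⟨_, hker _, rfl⟩, fun e w hw ↦ ?_⟩
  have decomposition : K.J (K.ψ n) (fderiv ℝ K.ψ n (fst ((Φ n).inverse e)))
      + fderiv ℝ K.ψ n (B n (snd ((Φ n).inverse e))) = e := hΦn.self_apply_inverse e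
  have heq : e - (fderiv ℝ K.ψ n ∘L B n ∘L snd ∘L (Φ n).inverse) e =
      K.J (K.ψ n) (fderiv ℝ K.ψ n (fst ((Φ n).inverse e))) :=
    sub_eq_of_eq_add decomposition.symm
  rw [heq, hJn.apply_left, horth _ _ hw, neg_zero]

end LocalKahlerQuotient

namespace LocalKahlerQuotient

variable {X E Q : Type*} [NormedAddCommGroup X] [NormedSpace ℝ X]
  [NormedAddCommGroup E] [NormedSpace ℝ E] [NormedAddCommGroup Q] [NormedSpace ℝ Q]
  (K : LocalKahlerQuotient X E Q) {P : X → E →L[ℝ] E}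

/-- The covariant derivative `∇ⱼ∂ₖψ` in the Kähler manifold at the base point. -/
abbrev hessian (j k : X) : E := covariantHessian K.Γ K.ψ K.n₀ j k

/-- The covariant derivative `∇ⱼ∂ₖp` in the quotient at the base point. -/
abbrev hessianQ (j k : X) : Q := covariantHessian K.ΓQ K.p K.n₀ j k

/-- The derivative in the direction `j` of the vertical component of `∂ₖψ`. -/
def verticalDeriv (P : X → E →L[ℝ] E) (j k : X) : E :=
  fderiv ℝ (fun n ↦ P n ∘L fderiv ℝ K.ψ n) K.n₀ j k

lemma hessian_comm (j k : X) : K.hessian j k = K.hessian k j := by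
  have hψ : ContDiffAt ℝ 2 K.ψ K.n₀ := K.contDiffAt_ψ.of_le ENat.LEInfty.out
  have hΓ : K.Γ (K.dψ j) (K.dψ k) = K.Γ (K.dψ k) (K.dψ j) := K.isInnerProduct_inner.ext fun z ↦ by
    rw [K.isChristoffelSymbol_Γ, K.isChristoffelSymbol_Γ, christoffel_comm K.g_symm]
  exact congrArg₂ (· + ·) (secondDeriv_comm hψ j k) hΓ

lemma contDiffAt_g_ψ : ContDiffAt ℝ ∞ (fun n ↦ K.g (K.ψ n)) K.n₀ :=
  ContDiffAt.comp (g := K.g) _ K.contDiffAt_g K.contDiffAt_ψ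

lemma inner_sub_J₀_add_dψ {a b a' b' : E} {z z' : X}
    (ha : a ∈ K.vertical K.n₀) (hb : b ∈ K.vertical K.n₀) (hz : z ∈ K.horizontal)
    (ha' : a' ∈ K.vertical K.n₀) (hb' : b' ∈ K.vertical K.n₀) (hz' : z' ∈ K.horizontal) :
    K.inner (a - K.J₀ b + K.dψ z) (a' - K.J₀ b' + K.dψ z') =
      K.inner a a' + K.inner b b' + K.inner (K.dψ z) (K.dψ z') := by
  have hsymm := K.isInnerProduct_inner.symm
  have haJ : K.inner a (K.J₀ b') = 0 := (hsymm _ _).trans (K.inner_J₀_vertical hb' ha)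
  have haz : K.inner a (K.dψ z') = 0 := (hsymm _ _).trans (hz' a ha)
  have hJz : K.inner (K.J₀ b) (K.dψ z') = 0 := (hsymm _ _).trans (K.inner_dψ_J₀ z' hb)
  simp only [map_sub K.inner, map_add K.inner, map_sub, map_add, add_apply, sub_apply, haJ, haz,
    hJz, K.inner_J₀_vertical hb ha', hz a' ha', K.inner_dψ_J₀ z hb',
    K.isHermitianStructure_J₀.isometry]
  ring

variable {K} in
lemma IsVerticalProjection.self (hP : K.IsVerticalProjection P) :
    IsOrthogonalProjection K.inner (K.vertical K.n₀) (P K.n₀) := hP.eventually.self_of_nhds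

section

variable {K}
variable (hP : K.IsVerticalProjection P) {i j u v : X}
include hP

lemma contDiffAt_verticalPart :
    ContDiffAt ℝ ∞ (fun n ↦ P n ∘L fderiv ℝ K.ψ n) K.n₀ :=
  hP.contDiffAt.clm_comp (K.contDiffAt_ψ.fderiv_right le_rfl)

lemma apply_dψ_eq_zero (hv : v ∈ K.horizontal) : P K.n₀ (K.dψ v) = 0 :=
  (hP.self.apply_eq_zero_iff K.isInnerProduct_inner).2 hv

lemma pullback_eq_add :
    ∀ᶠ n in 𝓝 K.n₀, ∀ a b, pullback K.g K.ψ n a b = pullback K.gQ K.p n a b +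
      K.g (K.ψ n) ((P n ∘L fderiv ℝ K.ψ n) a) ((P n ∘L fderiv ℝ K.ψ n) b) := by
  filter_upwards [hP.eventually, K.riemannian, K.isInnerProduct_g] with n hPn hn hb a b
  have horizontal_part (a : X) : ∃ a', fderiv ℝ K.p n a' = fderiv ℝ K.p n a ∧
      fderiv ℝ K.ψ n a' = fderiv ℝ K.ψ n a - P n (fderiv ℝ K.ψ n a) := by
    obtain ⟨w, hw, hwP⟩ := K.mem_vertical.1 (hPn.mem (fderiv ℝ K.ψ n a))
    exact ⟨a - w, by rw [map_sub, hw, sub_zero], by rw [map_sub, hwP]⟩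
  obtain ⟨a', hpa, hψa⟩ := horizontal_part a
  obtain ⟨b', hpb, hψb⟩ := horizontal_part b
  have hQ := hn a' b' (hψa ▸ hPn.orthogonal _) (hψb ▸ hPn.orthogonal _)
  rw [hpa, hpb, hψa, hψb] at hQ
  rw [pullback, pullback, hQ]
  exact hPn.apply_eq_add hb _ _

lemma inner_hessian_dψ (hu : u ∈ K.horizontal) (hv : v ∈ K.horizontal) (w : X) :
    K.inner (K.hessian u v) (K.dψ w) = K.innerQ (K.hessianQ u v) (K.dp w)
      + (K.inner (K.verticalDeriv P u v) (P K.n₀ (K.dψ w))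
        + K.inner (K.verticalDeriv P v u) (P K.n₀ (K.dψ w))) / 2 := by
  have hβ := (contDiffAt_verticalPart hP).differentiableAt (by simp)
  have hG := K.contDiffAt_g_ψ.differentiableAt (by simp)
  rw [← christoffel_pullback K.g_symm (K.contDiffAt_g.differentiableAt (by simp))
      (K.contDiffAt_ψ.of_le ENat.LEInfty.out) K.isChristoffelSymbol_Γ,
    ← christoffel_pullback K.gQ_symm (K.contDiffAt_gQ.differentiableAt (by simp))
      (K.contDiffAt_p.of_le ENat.LEInfty.out) K.isChristoffelSymbol_ΓQ,
    christoffel_congr (pullback_eq_add hP), christoffel_add]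
  · exact congrArg _ (christoffel_of_degenerate hG hβ (apply_dψ_eq_zero hP hu)
      (apply_dψ_eq_zero hP hv) w)
  · exact fun a b ↦ (contDiffAt_pullback K.contDiffAt_gQ K.contDiffAt_p a b).differentiableAt
      (by simp)
  · fun_prop

lemma apply_verticalDeriv (hv : v ∈ K.horizontal) :
    P K.n₀ (K.verticalDeriv P u v) = K.verticalDeriv P u v := by
  have hPd := hP.contDiffAt.differentiableAt (by simp)
  have hβ := (contDiffAt_verticalPart hP).differentiableAt (by simp)
  have idempotent : (fun n ↦ P n (P n (fderiv ℝ K.ψ n v))) =ᶠ[𝓝 K.n₀]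
      fun n ↦ P n (fderiv ℝ K.ψ n v) := by
    filter_upwards [hP.eventually, K.isInnerProduct_g] with n hPn hb
    exact hPn.apply_of_mem hb (hPn.mem _)
  have hderiv := DFunLike.congr_fun (idempotent.fderiv_eq (𝕜 := ℝ)) u
  have hβv : DifferentiableAt ℝ (fun n ↦ P n (fderiv ℝ K.ψ n v)) K.n₀ :=
    hβ.clm_apply (differentiableAt_const v)
  have hvertical : K.verticalDeriv P u v = fderiv ℝ (fun n ↦ P n (fderiv ℝ K.ψ n v)) K.n₀ u :=
    (fderiv_eval hβ u v).symm
  simp only [fderiv_clm_apply hPd hβv, apply_dψ_eq_zero hP hv, ContinuousLinearMap.comp_apply,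
    map_zero, add_zero] at hderiv
  rwa [hvertical]

lemma apply_hessian (hu : u ∈ K.horizontal) (hv : v ∈ K.horizontal) :
    P K.n₀ (K.hessian u v) = (1 / 2 : ℝ) • (K.verticalDeriv P u v + K.verticalDeriv P v u) := by
  have hmem (u v : X) (hv : v ∈ K.horizontal) : K.verticalDeriv P u v ∈ K.vertical K.n₀ :=
    apply_verticalDeriv hP hv ▸ hP.self.mem _
  refine hP.self.apply_eq K.isInnerProduct_inner
    (Submodule.smul_mem _ _ (add_mem (hmem u v hv) (hmem v u hu))) fun z hz ↦ ?_
  obtain ⟨w, hw, rfl⟩ := K.mem_vertical.1 hz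
  rw [map_sub K.inner, map_smul K.inner, map_add K.inner, sub_apply, smul_apply, add_apply,
    inner_hessian_dψ hP hu hv, hw, map_zero, hP.self.apply_of_mem K.isInnerProduct_inner hz,
    smul_eq_mul]
  ring

lemma eq_apply_add_dψ (e : E) :
    ∃ z ∈ K.horizontal, e = P K.n₀ e - K.J₀ (P K.n₀ (K.J₀ e)) + K.dψ z := by
  have hJ := K.isHermitianStructure_J₀
  obtain ⟨z, hz⟩ := K.exists_dψ_eq (e := e - P K.n₀ e + K.J₀ (P K.n₀ (K.J₀ e))) fun w hw ↦ by
    obtain ⟨a, -, ha⟩ := K.mem_vertical.1 (hP.self.mem e)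
    rw [map_add K.inner, map_sub K.inner, add_apply, sub_apply, hJ.isometry,
      hP.self.apply_apply _ hw, ← ha, K.inner_dψ_J₀ a hw, hJ.apply_left]
    ring
  refine ⟨z, fun w hw ↦ ?_, by rw [hz]; abel⟩
  rw [hz, map_add K.inner, add_apply, hP.self.orthogonal e w hw,
    K.inner_J₀_vertical (hP.self.mem _) hw, add_zero]

lemma dp_eq_hessianQ (hu : u ∈ K.horizontal) (hv : v ∈ K.horizontal) {z : X}
    (hz : z ∈ K.horizontal)
    (h : K.hessian u v =
      P K.n₀ (K.hessian u v) - K.J₀ (P K.n₀ (K.J₀ (K.hessian u v))) + K.dψ z) :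
    K.dp z = K.hessianQ u v := by
  refine K.isInnerProduct_gQ.ext fun q ↦ ?_
  obtain ⟨w, hw, rfl⟩ := K.exists_horizontal_dp_eq q
  have hQ := inner_hessian_dψ hP hu hv w
  have hvert : K.inner (P K.n₀ (K.hessian u v)) (K.dψ w) = 0 :=
    (K.isInnerProduct_inner.symm _ _).trans (hw _ (hP.self.mem _))
  have hJvert : K.inner (K.J₀ (P K.n₀ (K.J₀ (K.hessian u v)))) (K.dψ w) = 0 :=
    (K.isInnerProduct_inner.symm _ _).trans (K.inner_dψ_J₀ w (hP.self.mem _))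
  rw [apply_dψ_eq_zero hP hw, map_zero, map_zero, add_zero, zero_div, add_zero, h,
    map_add K.inner, map_sub K.inner, add_apply, sub_apply, hvert, hJvert, sub_zero, zero_add] at hQ
  exact (K.innerQ_dp hz hw).trans hQ

lemma inner_hessian_hessian {u' v' : X} (hu : u ∈ K.horizontal) (hv : v ∈ K.horizontal)
    (hu' : u' ∈ K.horizontal) (hv' : v' ∈ K.horizontal) :
    K.inner (K.hessian u v) (K.hessian u' v') =
      K.inner (P K.n₀ (K.hessian u v)) (P K.n₀ (K.hessian u' v'))
        + K.inner (P K.n₀ (K.J₀ (K.hessian u v))) (P K.n₀ (K.J₀ (K.hessian u' v')))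
        + K.innerQ (K.hessianQ u v) (K.hessianQ u' v') := by
  obtain ⟨z, hz, h⟩ := eq_apply_add_dψ hP (K.hessian u v)
  obtain ⟨z', hz', h'⟩ := eq_apply_add_dψ hP (K.hessian u' v')
  rw [← dp_eq_hessianQ hP hu hv hz h, ← dp_eq_hessianQ hP hu' hv' hz' h', K.innerQ_dp hz hz',
    ← K.inner_sub_J₀_add_dψ (hP.self.mem _) (hP.self.mem _) hz (hP.self.mem _) (hP.self.mem _) hz',
    ← h, ← h']

end
end LocalKahlerQuotient

/-! ### The O'Neill tensor -/

namespace LocalKahlerQuotient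

variable {X E Q : Type*} [NormedAddCommGroup X] [NormedSpace ℝ X]
  [NormedAddCommGroup E] [NormedSpace ℝ E] [NormedAddCommGroup Q] [NormedSpace ℝ Q]
  (K : LocalKahlerQuotient X E Q) (P : X → E →L[ℝ] E)

/-- The horizontal component of the vector field `∂ₖψ` along `ψ`. -/
def horizontalField (k n : X) : E := fderiv ℝ K.ψ n k - P n (fderiv ℝ K.ψ n k)

/-- The O'Neill tensor, for a vertical projection `P`: the vertical component of the covariant
derivative in the direction `j` of a field along `ψ` which is orthogonal to the vertical spaces and
takes the value `e` at the base point. -/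
def oneill (j : X) (e : E) : E := P K.n₀ (K.Γ (K.dψ j) e) - fderiv ℝ P K.n₀ j e

/-- The component of the second fundamental form of the level set in the image under `J` of the
vertical space, which is identified with the vertical space. -/
def secondForm (j k : X) : E := P K.n₀ (K.J₀ (K.hessian j k))

/-- The numerator of the sectional curvature of the quotient minus that of the Kähler manifold. -/
def curvatureDefect (i j : X) : ℝ :=
  riemannForm K.gQ K.ΓQ (K.p K.n₀) (K.dp i) (K.dp j) (K.dp j) (K.dp i)
    - riemannForm K.g K.Γ (K.ψ K.n₀) (K.dψ i) (K.dψ j) (K.dψ j) (K.dψ i)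

lemma secondForm_comm (j k : X) : K.secondForm P j k = K.secondForm P k j := by
  rw [secondForm, secondForm, hessian_comm]

lemma exists_bilinear_secondForm :
    ∃ B : X →ₗ[ℝ] X →ₗ[ℝ] E, ∀ j k, B j k = K.secondForm P j k := by
  obtain ⟨Γ, hΓ⟩ := K.isChristoffelSymbol_Γ.exists_bilinear
    (K.contDiffAt_g.differentiableAt (by simp)) K.isInnerProduct_inner
  have hψ : ContDiffAt ℝ 2 K.ψ K.n₀ := K.contDiffAt_ψ.of_le ENat.LEInfty.out
  refine ⟨((fderiv ℝ (fderiv ℝ K.ψ) K.n₀).toLinearMap₁₂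
    + Γ.compl₁₂ K.dψ.toLinearMap K.dψ.toLinearMap).compr₂ (P K.n₀ ∘L K.J₀).toLinearMap,
    fun j k ↦ ?_⟩
  rw [secondForm, hessian, covariantHessian, secondDeriv_eq_fderiv_fderiv hψ, ← hΓ]
  rfl

variable {K P}
variable (hP : K.IsVerticalProjection P) {i j k v v' : X}
include hP

lemma contDiffAt_horizontalField (k : X) : ContDiffAt ℝ ∞ (K.horizontalField P k) K.n₀ := by
  have hψ : ContDiffAt ℝ ∞ (fun n ↦ fderiv ℝ K.ψ n k) K.n₀ :=
    (K.contDiffAt_ψ.fderiv_right le_rfl).clm_apply contDiffAt_const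
  exact hψ.sub (hP.contDiffAt.clm_apply hψ)

lemma inner_horizontalField (k : X) : ∀ᶠ n in 𝓝 K.n₀, ∀ w ∈ K.vertical n,
    K.g (K.ψ n) (K.horizontalField P k n) w = 0 ∧
      K.g (K.ψ n) (K.horizontalField P k n) (K.J (K.ψ n) w) = 0 := by
  filter_upwards [hP.eventually, K.orthogonal] with n hPn horth w hw
  refine ⟨hPn.orthogonal _ w hw, ?_⟩
  obtain ⟨a, -, ha⟩ := K.mem_vertical.1 (hPn.mem (fderiv ℝ K.ψ n k))
  rw [horizontalField, ← ha, ← map_sub]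
  exact horth _ w hw

lemma horizontalField_self (hk : k ∈ K.horizontal) : K.horizontalField P k K.n₀ = K.dψ k := by
  rw [horizontalField, apply_dψ_eq_zero hP hk, sub_zero]

lemma fderiv_horizontalField (j k : X) :
    fderiv ℝ (K.horizontalField P k) K.n₀ j
      = secondDeriv K.ψ K.n₀ j k - K.verticalDeriv P j k := by
  have hβ := (contDiffAt_verticalPart hP).differentiableAt (by simp)
  rw [verticalDeriv, ← fderiv_eval hβ, secondDeriv]
  exact congrArg (· j) (fderiv_fun_sub
    (differentiableAt_fderiv_apply (K.contDiffAt_ψ.of_le ENat.LEInfty.out) k)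
    (hβ.clm_apply (differentiableAt_const k)))

lemma apply_fderiv_add_christoffel {y : X → E} (hy : DifferentiableAt ℝ y K.n₀)
    (hPy : ∀ᶠ n in 𝓝 K.n₀, P n (y n) = 0) (j : X) :
    P K.n₀ (fderiv ℝ y K.n₀ j + K.Γ (K.dψ j) (y K.n₀)) = K.oneill P j (y K.n₀) := by
  have hderiv := DFunLike.congr_fun (Filter.EventuallyEq.fderiv_eq (𝕜 := ℝ) hPy) j
  rw [fderiv_clm_apply (hP.contDiffAt.differentiableAt (by simp)) hy, fderiv_fun_const] at hderiv
  have hPy' : P K.n₀ (fderiv ℝ y K.n₀ j) = -fderiv ℝ P K.n₀ j (y K.n₀) :=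
    eq_neg_of_add_eq_zero_left hderiv
  rw [map_add, hPy', oneill, neg_add_eq_sub]

lemma oneill_dψ (hk : k ∈ K.horizontal) :
    K.oneill P j (K.dψ k) = P K.n₀ (K.hessian j k) - K.verticalDeriv P j k := by
  have hzero : ∀ᶠ n in 𝓝 K.n₀, P n (K.horizontalField P k n) = 0 := by
    filter_upwards [hP.eventually, K.isInnerProduct_g, inner_horizontalField hP k] with n hPn hb hn
    exact (hPn.apply_eq_zero_iff hb).2 fun w hw ↦ (hn w hw).1
  have h := apply_fderiv_add_christoffel hP
    ((contDiffAt_horizontalField hP k).differentiableAt (by simp)) hzero j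
  rw [horizontalField_self hP hk, fderiv_horizontalField hP] at h
  rw [← h, ← apply_verticalDeriv hP hk, ← map_sub, hessian, covariantHessian]
  congr 1
  rw [apply_verticalDeriv hP hk]
  abel

lemma oneill_eq (hj : j ∈ K.horizontal) (hk : k ∈ K.horizontal) :
    K.oneill P j (K.dψ k) =
      (1 / 2 : ℝ) • (K.verticalDeriv P k j - K.verticalDeriv P j k) := by
  rw [oneill_dψ hP hk, apply_hessian hP hj hk]
  module

lemma oneill_antisymm (hj : j ∈ K.horizontal) (hk : k ∈ K.horizontal) :
    K.oneill P j (K.dψ k) = -K.oneill P k (K.dψ j) := by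
  rw [oneill_eq hP hj hk, oneill_eq hP hk hj]
  module

lemma fderiv_J_horizontalField (hk : k ∈ K.horizontal) (j : X) :
    fderiv ℝ (fun n ↦ K.J (K.ψ n) (K.horizontalField P k n)) K.n₀ j
        + K.Γ (K.dψ j) (K.J₀ (K.dψ k)) =
      K.J₀ (K.hessian j k) - K.J₀ (K.verticalDeriv P j k) := by
  have hy := (contDiffAt_horizontalField hP k).differentiableAt (by simp)
  have hJ := K.contDiffAt_J.differentiableAt (by simp)
  have hψ := K.contDiffAt_ψ.differentiableAt (by simp)
  have hderiv : fderiv ℝ (fun n ↦ K.J (K.ψ n)) K.n₀ j = fderiv ℝ K.J (K.ψ K.n₀) (K.dψ j) :=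
    congrArg (· j) (fderiv_comp K.n₀ hJ hψ)
  have hparallel : fderiv ℝ K.J (K.ψ K.n₀) (K.dψ j) (K.dψ k) =
      K.J₀ (K.Γ (K.dψ j) (K.dψ k)) - K.Γ (K.dψ j) (K.J₀ (K.dψ k)) :=
    eq_sub_of_add_eq (K.J_parallel _ _)
  have hJψ : DifferentiableAt ℝ (fun n ↦ K.J (K.ψ n)) K.n₀ := hJ.comp K.n₀ hψ
  rw [fderiv_clm_apply hJψ hy]
  simp only [add_apply, ContinuousLinearMap.comp_apply, ContinuousLinearMap.flip_apply, hderiv,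
    fderiv_horizontalField hP, horizontalField_self hP hk, hparallel, hessian, covariantHessian,
    map_add, map_sub]
  abel

/-- The horizontal field with value `k`, multiplied by the parallel tensor `J`, is again horizontal,
so that its covariant derivative computes both sides. -/
lemma oneill_J₀ (hk : k ∈ K.horizontal) : K.oneill P j (K.J₀ (K.dψ k)) = K.secondForm P j k := by
  have hJ : DifferentiableAt ℝ (fun n ↦ K.J (K.ψ n)) K.n₀ :=
    DifferentiableAt.comp (g := K.J) _ (K.contDiffAt_J.differentiableAt (by simp))
      (K.contDiffAt_ψ.differentiableAt (by simp))
  have hy := (contDiffAt_horizontalField hP k).differentiableAt (by simp)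
  have hzero : ∀ᶠ n in 𝓝 K.n₀, P n (K.J (K.ψ n) (K.horizontalField P k n)) = 0 := by
    filter_upwards [hP.eventually, K.isInnerProduct_g, K.isHermitianStructure_J,
      inner_horizontalField hP k] with n hPn hb hJn hn
    refine (hPn.apply_eq_zero_iff hb).2 fun w hw ↦ ?_
    rw [hJn.apply_left, (hn w hw).2, neg_zero]
  have hPJ : P K.n₀ (K.J₀ (K.verticalDeriv P j k)) = 0 := by
    rw [hP.self.apply_eq_zero_iff K.isInnerProduct_inner]
    exact fun w hw ↦ K.inner_J₀_vertical (apply_verticalDeriv hP hk ▸ hP.self.mem _) hw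
  have h := apply_fderiv_add_christoffel hP (hJ.clm_apply hy) hzero j
  rw [horizontalField_self hP hk, fderiv_J_horizontalField hP hk, map_sub, hPJ, sub_zero] at h
  exact h.symm

/-- Compares the Gauss equation of the level set with the O'Neill equation of the projection,
through the curvature of the pullback of the metric to the level set. -/
lemma curvatureDefect_eq_verticalDeriv (hi : i ∈ K.horizontal) (hj : j ∈ K.horizontal) :
    K.curvatureDefect i j =
      K.inner (P K.n₀ (K.hessian i i)) (P K.n₀ (K.hessian j j))
        + K.inner (K.secondForm P i i) (K.secondForm P j j)
        - K.inner (P K.n₀ (K.hessian i j)) (P K.n₀ (K.hessian i j))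
        - K.inner (K.secondForm P i j) (K.secondForm P i j)
        - K.inner (K.verticalDeriv P i i) (K.verticalDeriv P j j)
        - K.inner (K.verticalDeriv P i j) (K.verticalDeriv P j i)
        + K.inner (K.verticalDeriv P i j) (K.verticalDeriv P i j)
        + K.inner (K.verticalDeriv P j i) (K.verticalDeriv P j i) := by
  have hβ := contDiffAt_verticalPart hP
  have hG := K.contDiffAt_g_ψ
  have htotal := hessianCurvature_congr (pullback_eq_add hP) i j j i
  rw [hessianCurvature_add
      (fun a b ↦ (contDiffAt_pullback K.contDiffAt_gQ K.contDiffAt_p a b).of_le ENat.LEInfty.out)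
      (fun a b ↦ ((hG.clm_apply (hβ.clm_apply contDiffAt_const)).clm_apply
        (hβ.clm_apply contDiffAt_const)).of_le ENat.LEInfty.out),
    hessianCurvature_pullback K.g_symm (K.contDiffAt_g.of_le ENat.LEInfty.out)
      (K.contDiffAt_ψ.of_le ENat.LEInfty.out) K.isChristoffelSymbol_Γ,
    hessianCurvature_pullback K.gQ_symm (K.contDiffAt_gQ.of_le ENat.LEInfty.out)
      (K.contDiffAt_p.of_le ENat.LEInfty.out) K.isChristoffelSymbol_ΓQ,
    hessianCurvature_of_degenerate (hG.of_le ENat.LEInfty.out) (hβ.of_le ENat.LEInfty.out)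
      (K.g_symm _) (apply_dψ_eq_zero hP hi) (apply_dψ_eq_zero hP hj),
    inner_hessian_hessian hP hj hj hi hi, inner_hessian_hessian hP hi hj hj hi,
    K.hessian_comm j i, K.isInnerProduct_inner.symm (P K.n₀ (K.hessian j j)),
    K.isInnerProduct_inner.symm (P K.n₀ (K.J₀ (K.hessian j j)))] at htotal
  simp only [curvatureDefect, secondForm, verticalDeriv]
  linarith

lemma curvatureDefect_eq (hi : i ∈ K.horizontal) (hj : j ∈ K.horizontal) :
    K.curvatureDefect i j =
      3 * K.inner (K.oneill P i (K.dψ j)) (K.oneill P i (K.dψ j))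
        + K.inner (K.secondForm P i i) (K.secondForm P j j)
        - K.inner (K.secondForm P i j) (K.secondForm P i j) := by
  have hdiag {k : X} (hk : k ∈ K.horizontal) :
      P K.n₀ (K.hessian k k) = K.verticalDeriv P k k := by
    rw [apply_hessian hP hk hk]
    module
  rw [curvatureDefect_eq_verticalDeriv hP hi hj, hdiag hi, hdiag hj, apply_hessian hP hi hj,
    oneill_eq hP hi hj]
  simp only [map_smul K.inner, map_add K.inner, map_sub K.inner, map_smul, map_add, map_sub,
    smul_apply, add_apply, sub_apply, smul_eq_mul,
    K.isInnerProduct_inner.symm (K.verticalDeriv P j i) (K.verticalDeriv P i j)]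
  ring

/-- `A(v, v') = B(v, v) = B(v', v')` and `B(v, v') = A(v', v') = 0`. -/
lemma curvatureDefect_J₀ (hv : v ∈ K.horizontal) (hv' : v' ∈ K.horizontal)
    (hJ : K.dψ v' = K.J₀ (K.dψ v)) :
    K.curvatureDefect v v' = 4 * K.inner (K.secondForm P v v) (K.secondForm P v v) := by
  obtain ⟨B, hB⟩ := K.exists_bilinear_secondForm P
  have hJ' : K.dψ (-v) = K.J₀ (K.dψ v') := by
    rw [hJ, K.isHermitianStructure_J₀.sq, map_neg]
  have hA (j : X) : K.oneill P j (K.dψ v') = K.secondForm P j v := by rw [hJ, oneill_J₀ hP hv]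
  have hmixed : K.secondForm P v v' = 0 := by
    rw [secondForm_comm, ← hA, oneill_eq hP hv' hv', sub_self, smul_zero]
  have hdiag : K.secondForm P v' v' = K.secondForm P v v := by
    rw [← oneill_J₀ hP hv', ← hJ', oneill_antisymm hP hv' (neg_mem hv), hA, ← hB, ← hB, map_neg,
      LinearMap.neg_apply, neg_neg]
  rw [curvatureDefect_eq hP hv hv', hA, hmixed, hdiag, map_zero]
  ring

section Bounds

variable {C : ℝ}

lemma secondForm_le_of_oneill_le
    (hC : ∀ v ∈ K.horizontal, ∀ w ∈ K.horizontal, K.inner (K.dψ v) (K.dψ v) = 1 →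
      K.inner (K.dψ w) (K.dψ w) = 1 →
        K.inner (K.oneill P v (K.dψ w)) (K.oneill P v (K.dψ w)) ≤ C)
    (hj : j ∈ K.horizontal) (hk : k ∈ K.horizontal) (hj₁ : K.inner (K.dψ j) (K.dψ j) = 1)
    (hk₁ : K.inner (K.dψ k) (K.dψ k) = 1) :
    K.inner (K.secondForm P j k) (K.secondForm P j k) ≤ C := by
  obtain ⟨k', hk', hJ⟩ := K.exists_horizontal_dψ_eq_J₀ hk
  have h := hC j hj k' hk' hj₁ (by rw [hJ, K.isHermitianStructure_J₀.isometry, hk₁])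
  rwa [hJ, oneill_J₀ hP hk] at h

lemma abs_curvatureDefect_le
    (hC : ∀ v ∈ K.horizontal, ∀ w ∈ K.horizontal, K.inner (K.dψ v) (K.dψ v) = 1 →
      K.inner (K.dψ w) (K.dψ w) = 1 →
        K.inner (K.oneill P v (K.dψ w)) (K.oneill P v (K.dψ w)) ≤ C)
    (hi : i ∈ K.horizontal) (hj : j ∈ K.horizontal) (hi₁ : K.inner (K.dψ i) (K.dψ i) = 1)
    (hj₁ : K.inner (K.dψ j) (K.dψ j) = 1) : |K.curvatureDefect i j| ≤ 4 * C := by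
  have hb := K.isInnerProduct_inner
  have hA := hC i hi j hj hi₁ hj₁
  have hii := secondForm_le_of_oneill_le hP hC hi hi hi₁ hi₁
  have hjj := secondForm_le_of_oneill_le hP hC hj hj hj₁ hj₁
  have hij := secondForm_le_of_oneill_le hP hC hi hj hi₁ hj₁
  have hC₀ : 0 ≤ C := (hb.nonneg _).trans hA
  have hiijj : |K.inner (K.secondForm P i i) (K.secondForm P j j)| ≤ C :=
    abs_le_of_sq_le_sq ((hb.apply_sq_le _ _).trans
      (by rw [sq]; exact mul_le_mul hii hjj (hb.nonneg _) hC₀)) hC₀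
  rw [curvatureDefect_eq hP hi hj]
  have hA₀ := hb.nonneg (K.oneill P i (K.dψ j))
  have hij₀ := hb.nonneg (K.secondForm P i j)
  exact abs_le.2 ⟨by linarith [(abs_le.1 hiijj).1], by linarith [(abs_le.1 hiijj).2]⟩

lemma oneill_le_of_secondForm_le
    (hC : ∀ v ∈ K.horizontal, K.inner (K.dψ v) (K.dψ v) = 1 →
      K.inner (K.secondForm P v v) (K.secondForm P v v) ≤ C)
    (hj : j ∈ K.horizontal) (hk : k ∈ K.horizontal) :
    K.inner (K.oneill P j (K.dψ k)) (K.oneill P j (K.dψ k)) ≤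
      C * (K.inner (K.dψ j) (K.dψ j) * K.inner (K.dψ k) (K.dψ k)) := by
  obtain ⟨B, hB⟩ := K.exists_bilinear_secondForm P
  obtain ⟨k', hk', hJ⟩ := K.exists_horizontal_dψ_eq_J₀ hk
  have hJneg : K.dψ k = K.J₀ (K.dψ (-k')) := by
    rw [map_neg, hJ, map_neg, K.isHermitianStructure_J₀.sq, neg_neg]
  have ha : IsInnerProduct (K.inner.bilinearComp K.dψ K.dψ) :=
    ⟨fun v w ↦ K.isInnerProduct_inner.symm _ _, fun v hv ↦ K.isInnerProduct_inner.pos _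
      fun h ↦ hv (K.dψ_injective (h.trans (map_zero _).symm))⟩
  have h := K.isInnerProduct_inner.apply_le_mul_of_apply_diag_le ha
    (B := B) (H := K.horizontal) (C := C) (fun v w ↦ by rw [hB, hB, secondForm_comm])
    (fun v hv hv₁ ↦ by rw [hB]; exact hC v hv hv₁) hj (neg_mem hk')
  rw [hB] at h
  rw [hJneg, oneill_J₀ hP (neg_mem hk'), K.isHermitianStructure_J₀.isometry]
  exact h

end Bounds

end LocalKahlerQuotient

section Frame

variable {E : Type*} [NormedAddCommGroup E] [NormedSpace ℝ E]
  {M : Type*} [TopologicalSpace M] [ChartedSpace E M]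

lemma eventually_extChartAt_symm_mem_source (m : M) : ∀ᶠ y in 𝓝 (extChartAt 𝓘(ℝ, E) m m),
    (extChartAt 𝓘(ℝ, E) m).symm y ∈ (extChartAt 𝓘(ℝ, E) m).source ∧
      extChartAt 𝓘(ℝ, E) m ((extChartAt 𝓘(ℝ, E) m).symm y) = y := by
  filter_upwards [extChartAt_target_mem_nhds (I := 𝓘(ℝ, E)) m] with y hy
  exact ⟨(extChartAt 𝓘(ℝ, E) m).map_target hy, (extChartAt 𝓘(ℝ, E) m).right_inv hy⟩

lemma tendsto_extChartAt_symm (m : M) : Filter.Tendsto (extChartAt 𝓘(ℝ, E) m).symm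
    (𝓝 (extChartAt 𝓘(ℝ, E) m m)) (𝓝 m) := by
  have := continuousAt_extChartAt_symm (I := 𝓘(ℝ, E)) m
  rwa [ContinuousAt, extChartAt_to_inv] at this

variable [IsManifold 𝓘(ℝ, E) ∞ M]

/-- The frame of the tangent bundle given by the preferred chart at `m`: the tangent vector at `x`
with coordinates `u`. -/
def chartFrame (m x : M) : E →L[ℝ] TangentSpace 𝓘(ℝ, E) x :=
  (trivializationAt E (TangentSpace 𝓘(ℝ, E)) m).symmL ℝ x

/-- The coordinates of a tangent vector at `x` in the frame of the preferred chart at `m`. -/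
def chartCoord (m x : M) : TangentSpace 𝓘(ℝ, E) x →L[ℝ] E :=
  (trivializationAt E (TangentSpace 𝓘(ℝ, E)) m).continuousLinearMapAt ℝ x

lemma mem_baseSet_of_mem_source {m x : M} (hx : x ∈ (extChartAt 𝓘(ℝ, E) m).source) :
    x ∈ (trivializationAt E (TangentSpace 𝓘(ℝ, E)) m).baseSet := by
  simpa using hx

lemma chartFrame_eq_mfderiv {m x : M} (hx : x ∈ (extChartAt 𝓘(ℝ, E) m).source) (u : E) :
    (chartFrame m x u : TangentSpace 𝓘(ℝ, E) x) =
      (mfderiv 𝓘(ℝ, E) 𝓘(ℝ, E) (extChartAt 𝓘(ℝ, E) m).symm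
        (extChartAt 𝓘(ℝ, E) m x) : E →L[ℝ] E) u := by
  rw [extChartAt_source] at hx
  have h := TangentBundle.symmL_trivializationAt (I := 𝓘(ℝ, E)) hx
  simp only [modelWithCornersSelf_coe, Set.range_id, mfderivWithin_univ] at h
  exact DFunLike.congr_fun h u

lemma chartCoord_eq_mfderiv {m x : M} (hx : x ∈ (extChartAt 𝓘(ℝ, E) m).source) :
    chartCoord m x = mfderiv 𝓘(ℝ, E) 𝓘(ℝ, E) (extChartAt 𝓘(ℝ, E) m) x := by
  rw [extChartAt_source] at hx
  rw [chartCoord, TangentBundle.continuousLinearMapAt_trivializationAt hx]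

lemma chartFrame_chartCoord {m x : M} (hx : x ∈ (extChartAt 𝓘(ℝ, E) m).source)
    (v : TangentSpace 𝓘(ℝ, E) x) : chartFrame m x (chartCoord m x v) = v :=
  Trivialization.symmL_continuousLinearMapAt _ (mem_baseSet_of_mem_source hx) v

lemma chartCoord_chartFrame {m x : M} (hx : x ∈ (extChartAt 𝓘(ℝ, E) m).source)
    (v : E) : chartCoord m x (chartFrame m x v) = v :=
  Trivialization.continuousLinearMapAt_symmL _ (mem_baseSet_of_mem_source hx) v

lemma chartFrame_injective {m x : M} (hx : x ∈ (extChartAt 𝓘(ℝ, E) m).source) :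
    Function.Injective (chartFrame m x : E → TangentSpace 𝓘(ℝ, E) x) :=
  Function.LeftInverse.injective (chartCoord_chartFrame hx)

lemma extend_chartFrame {m x : M} (hx : x ∈ (extChartAt 𝓘(ℝ, E) m).source) (u : E) :
    FiberBundle.extend E (chartFrame m m u) x = chartFrame m x u := by
  have hm := mem_baseSet_of_mem_source (mem_extChartAt_source (I := 𝓘(ℝ, E)) m)
  have hu : (trivializationAt E (TangentSpace 𝓘(ℝ, E)) m ⟨m, chartFrame m m u⟩).2 = u := by
    rw [← Trivialization.continuousLinearMapAt_apply_of_mem ℝ _ hm]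
    exact chartCoord_chartFrame (mem_extChartAt_source m) u
  simp only [FiberBundle.extend]
  rw [hu]
  exact (Trivialization.symmL_apply _ (mem_baseSet_of_mem_source hx) u).symm

lemma mvfderiv_chartFrame {F : Type*} [NormedAddCommGroup F] [NormedSpace ℝ F] {f : M → F}
    {m x : M} (hx : x ∈ (extChartAt 𝓘(ℝ, E) m).source)
    (hf : MDifferentiableAt 𝓘(ℝ, E) 𝓘(ℝ, F) f x) (u : E) :
    mvfderiv 𝓘(ℝ, E) f x (chartFrame m x u) =
      fderiv ℝ (f ∘ (extChartAt 𝓘(ℝ, E) m).symm) (extChartAt 𝓘(ℝ, E) m x) u := by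
  have h_symm : MDifferentiableAt 𝓘(ℝ, E) 𝓘(ℝ, E) (extChartAt 𝓘(ℝ, E) m).symm
      (extChartAt 𝓘(ℝ, E) m x) := by
    have := mdifferentiableWithinAt_extChartAt_symm ((extChartAt 𝓘(ℝ, E) m).map_source hx)
    rwa [modelWithCornersSelf_coe, Set.range_id, mdifferentiableWithinAt_univ] at this
  have h_comp := mfderiv_comp_apply_of_eq (extChartAt 𝓘(ℝ, E) m x) hf h_symm
    ((extChartAt 𝓘(ℝ, E) m).left_inv hx) u
  rw [mfderiv_eq_fderiv] at h_comp
  refine Eq.trans ?_ h_comp.symm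
  exact congrArg (mvfderiv 𝓘(ℝ, E) f x) (chartFrame_eq_mfderiv hx u)

lemma contDiffAt_comp_extChartAt_symm {F : Type*} [NormedAddCommGroup F] [NormedSpace ℝ F]
    {f : M → F} {m : M} (hf : ContMDiffAt 𝓘(ℝ, E) 𝓘(ℝ, F) ∞ f m) :
    ContDiffAt ℝ ∞ (f ∘ (extChartAt 𝓘(ℝ, E) m).symm) (extChartAt 𝓘(ℝ, E) m m) := by
  rw [← contMDiffAt_iff_contDiffAt]
  exact ContMDiffAt.comp_of_eq hf
    ((contMDiffOn_extChartAt_symm m).contMDiffAt (extChartAt_target_mem_nhds m))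
    (extChartAt_to_inv m)

lemma differentiableAt_comp_extChartAt_symm {F : Type*} [NormedAddCommGroup F] [NormedSpace ℝ F]
    {f : M → F} {m : M} (hf : MDifferentiableAt 𝓘(ℝ, E) 𝓘(ℝ, F) f m) :
    DifferentiableAt ℝ (f ∘ (extChartAt 𝓘(ℝ, E) m).symm) (extChartAt 𝓘(ℝ, E) m m) := by
  rw [← mdifferentiableAt_iff_differentiableAt]
  have h_symm := (contMDiffOn_extChartAt_symm (I := 𝓘(ℝ, E)) (n := ∞) m).contMDiffAt
    (extChartAt_target_mem_nhds m)
  exact MDifferentiableAt.comp_of_eq _ hf (h_symm.mdifferentiableAt (by simp))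
    (extChartAt_to_inv m)

lemma contMDiffAt_section_iff_chartCoord {m x : M} (hx : x ∈ (extChartAt 𝓘(ℝ, E) m).source)
    {n : ℕ∞} (Y : Π x : M, TangentSpace 𝓘(ℝ, E) x) :
    CMDiffAt n (T% Y) x ↔ CMDiffAt n (fun x ↦ chartCoord m x (Y x)) x := by
  have hb := mem_baseSet_of_mem_source hx
  have : ContMDiffVectorBundle n E (TangentSpace 𝓘(ℝ, E) : M → Type _) 𝓘(ℝ, E) :=
    .of_le (n := ∞) (by exact_mod_cast le_top)
  rw [(trivializationAt E (TangentSpace 𝓘(ℝ, E)) m).contMDiffAt_section_iff hb]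
  refine Filter.EventuallyEq.contMDiffAt_iff ?_
  filter_upwards [(trivializationAt E (TangentSpace 𝓘(ℝ, E)) m).open_baseSet.mem_nhds hb] with y hy
  exact (Trivialization.continuousLinearMapAt_apply_of_mem ℝ _ hy _).symm

lemma mdifferentiableAt_section_iff_chartCoord {m x : M}
    (hx : x ∈ (extChartAt 𝓘(ℝ, E) m).source) (Y : Π x : M, TangentSpace 𝓘(ℝ, E) x) :
    MDiffAt (T% Y) x ↔ MDiffAt (fun x ↦ chartCoord m x (Y x)) x := by
  have hb := mem_baseSet_of_mem_source hx
  rw [(trivializationAt E (TangentSpace 𝓘(ℝ, E)) m).mdifferentiableAt_section_iff 𝓘(ℝ, E) _ hb]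
  refine Filter.EventuallyEq.mdifferentiableAt_iff ?_
  filter_upwards [(trivializationAt E (TangentSpace 𝓘(ℝ, E)) m).open_baseSet.mem_nhds hb] with y hy
  exact (Trivialization.continuousLinearMapAt_apply_of_mem ℝ _ hy _).symm

lemma contMDiffAt_chartFrame {m x : M} (hx : x ∈ (extChartAt 𝓘(ℝ, E) m).source)
    {n : ℕ∞} {f : M → E} (hf : CMDiffAt n f x) :
    CMDiffAt n (T% (fun x : M ↦ chartFrame m x (f x))) x := by
  rw [contMDiffAt_section_iff_chartCoord hx]
  refine hf.congr_of_eventuallyEq ?_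
  filter_upwards [(isOpen_extChartAt_source m).mem_nhds hx] with y hy
  exact chartCoord_chartFrame hy _

lemma mdifferentiableAt_chartFrame {m x : M} (hx : x ∈ (extChartAt 𝓘(ℝ, E) m).source) (v : E) :
    MDiffAt (T% (fun x : M ↦ chartFrame m x v)) x :=
  (contMDiffAt_chartFrame (n := 1) hx contMDiffAt_const).mdifferentiableAt (by simp)

lemma chartFrame_eq_mpullback {m x : M}
    (hx : x ∈ (extChartAt 𝓘(ℝ, E) m).source) (v : E) :
    chartFrame m x v =
      VectorField.mpullback 𝓘(ℝ, E) 𝓘(ℝ, E) (extChartAt 𝓘(ℝ, E) m) (fun _ ↦ v) x := by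
  have hv : (mfderiv 𝓘(ℝ, E) 𝓘(ℝ, E) (extChartAt 𝓘(ℝ, E) m) x) (chartFrame m x v) = v := by
    have := chartCoord_chartFrame hx v
    rwa [chartCoord_eq_mfderiv hx] at this
  exact ((congrArg _ hv).symm.trans
    ((isInvertible_mfderiv_extChartAt hx).inverse_apply_self (chartFrame m x v))).symm

lemma mlieBracket_eq_lieBracket (V W : Π y : E, TangentSpace 𝓘(ℝ, E) y) :
    VectorField.mlieBracket 𝓘(ℝ, E) V W = VectorField.lieBracket ℝ V W := by
  rw [← VectorField.mlieBracketWithin_univ, VectorField.mlieBracketWithin_eq_lieBracketWithin]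
  exact VectorField.lieBracketWithin_univ

lemma mlieBracket_chartFrame {m x : M} [CompleteSpace E]
    (hx : x ∈ (extChartAt 𝓘(ℝ, E) m).source) (v w : E) :
    VectorField.mlieBracket 𝓘(ℝ, E) (fun x : M ↦ chartFrame m x v)
      (fun x : M ↦ chartFrame m x w) x = 0 := by
  have h_two : minSmoothness ℝ 2 ≤ (∞ : WithTop ℕ∞) := by
    rw [minSmoothness_of_isRCLikeNormedField]
    exact ENat.LEInfty.out
  have : IsManifold 𝓘(ℝ, E) (minSmoothness ℝ 2) M := .of_le h_two
  have h_frame (v : E) : (fun y : M ↦ chartFrame m y v) =ᶠ[𝓝 x]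
      VectorField.mpullback 𝓘(ℝ, E) 𝓘(ℝ, E) (extChartAt 𝓘(ℝ, E) m) (fun _ ↦ v) := by
    filter_upwards [(isOpen_extChartAt_source m).mem_nhds hx] with y hy
    exact chartFrame_eq_mpullback hy v
  have h_const (v : E) : MDifferentiableAt 𝓘(ℝ, E) 𝓘(ℝ, E).tangent
      (fun y : E ↦ (⟨y, v⟩ : TangentBundle 𝓘(ℝ, E) E)) (extChartAt 𝓘(ℝ, E) m x) :=
    (contMDiffAt_vectorSpace_iff_contDiffAt.2
      (contDiffAt_const (n := 1))).mdifferentiableAt one_ne_zero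
  have h_bracket : VectorField.lieBracket ℝ (fun _ : E ↦ v) (fun _ ↦ w) = 0 := by
    ext y
    simp [VectorField.lieBracket_eq]
  have h_mlieBracket := (mlieBracket_eq_lieBracket (fun _ ↦ v) (fun _ ↦ w)).trans h_bracket
  rw [Filter.EventuallyEq.mlieBracket_vectorField_eq (h_frame v) (h_frame w)]
  refine (VectorField.mpullback_mlieBracket (n := ∞) (h_const v) (h_const w)
    (contMDiffAt_extChartAt' (by simpa using hx)) h_two).symm.trans ?_
  exact (congrArg _ (congrFun h_mlieBracket _)).trans (map_zero _)

end Frame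

section RiemannForm

variable {E : Type*} [NormedAddCommGroup E] [NormedSpace ℝ E]
  {g : E → E →L[ℝ] E →L[ℝ] ℝ} {x : E} {Γ : E → E → E}

lemma fderiv_christoffel {h : E → E → E → ℝ} (hh : ∀ a b, ContDiffAt ℝ 2 (h · a b) x)
    (u v w z : E) :
    fderiv ℝ (fun y ↦ christoffel h y v w z) x u =
      (secondDeriv (h · w z) x u v + secondDeriv (h · v z) x u w
        - secondDeriv (h · v w) x u z) / 2 := by
  have hd (a b k : E) := (differentiableAt_fderiv_apply (hh a b) k).hasFDerivAt
  have hsum := (((hd w z v).add (hd v z w)).sub (hd v w z)).const_smul (2⁻¹ : ℝ)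
  have hchristoffel := hsum.congr_of_eventuallyEq (f₁ := fun y ↦ christoffel h y v w z)
    (.of_forall fun y ↦ by simp [christoffel, div_eq_inv_mul])
  rw [hchristoffel.fderiv, div_eq_inv_mul]
  rfl

lemma riemannForm_eq_fderiv_christoffel_sub (hg : ContDiffAt ℝ 2 g x) (u v w z : E) :
    riemannForm g Γ x u v w z =
      (fderiv ℝ (fun y ↦ christoffel (g · · ·) y v w z) x u - g x (Γ v w) (Γ u z)) -
        (fderiv ℝ (fun y ↦ christoffel (g · · ·) y u w z) x v - g x (Γ u w) (Γ v z)) := by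
  have hg' (a b : E) : ContDiffAt ℝ 2 (g · a b) x :=
    (hg.clm_apply contDiffAt_const).clm_apply contDiffAt_const
  rw [fderiv_christoffel hg', fderiv_christoffel hg', secondDeriv_comm (hg' w z) v u,
    riemannForm, hessianCurvature]
  ring

lemma apply_comb_of_skew {V : Type*} [AddCommGroup V] [Module ℝ V] {F : V → V → ℝ}
    (skew : ∀ u v, F u v = -F v u)
    (comb_left : ∀ (a b : ℝ) (u u' v : V), F (a • u + b • u') v = a * F u v + b * F u' v)
    (a b c d : ℝ) (u v : V) :
    F (a • u + b • v) (c • u + d • v) = (a * d - b * c) * F u v := by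
  have self (u : V) : F u u = 0 := self_eq_neg.1 (skew u u)
  have comb_right (u : V) {v v' : V} : F u (c • v + d • v') = c * F u v + d * F u v' := by
    rw [skew, comb_left, skew v, skew v']
    ring
  rw [comb_left, comb_right, comb_right, self, self, skew v u]
  ring

lemma riemannForm_swap_left (u v w z : E) :
    riemannForm g Γ x u v w z = -riemannForm g Γ x v u w z := by
  unfold riemannForm hessianCurvature
  ring

lemma riemannForm_swap_right (hs : ∀ u v, g x u v = g x v u) (u v w z : E) :
    riemannForm g Γ x u v w z = -riemannForm g Γ x u v z w := by
  unfold riemannForm hessianCurvature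
  rw [hs (Γ v z), hs (Γ u z)]
  ring

lemma riemannForm_comb_left (hg : ContDiffAt ℝ 2 g x) (hgx : IsInnerProduct (g x))
    (hΓ : IsChristoffelSymbol g x Γ) (a b : ℝ) (u u' v w z : E) :
    riemannForm g Γ x (a • u + b • u') v w z =
      a * riemannForm g Γ x u v w z + b * riemannForm g Γ x u' v w z := by
  obtain ⟨Γ', hΓ'⟩ := hΓ.exists_bilinear (hg.differentiableAt two_ne_zero) hgx
  simp only [riemannForm, hessianCurvature, secondDeriv_eval₂ hg, secondDeriv_eq_fderiv_fderiv hg,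
    ← hΓ']
  simp only [ContinuousLinearMap.map_add, ContinuousLinearMap.map_smul, LinearMap.map_add,
    LinearMap.map_smul, LinearMap.add_apply, LinearMap.smul_apply, add_apply, smul_apply,
    smul_eq_mul]
  ring

lemma riemannForm_comb_right (hg : ContDiffAt ℝ 2 g x) (hgx : IsInnerProduct (g x))
    (hΓ : IsChristoffelSymbol g x Γ) (a b : ℝ) (u v w w' z : E) :
    riemannForm g Γ x u v (a • w + b • w') z =
      a * riemannForm g Γ x u v w z + b * riemannForm g Γ x u v w' z := by
  obtain ⟨Γ', hΓ'⟩ := hΓ.exists_bilinear (hg.differentiableAt two_ne_zero) hgx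
  simp only [riemannForm, hessianCurvature, secondDeriv_eval₂ hg, secondDeriv_eq_fderiv_fderiv hg,
    ← hΓ']
  simp only [ContinuousLinearMap.map_add, ContinuousLinearMap.map_smul, LinearMap.map_add,
    LinearMap.map_smul, add_apply, smul_apply, smul_eq_mul]
  ring

lemma riemannForm_eq_of_orthonormal (hg : ContDiffAt ℝ 2 g x) (hgx : IsInnerProduct (g x))
    (hΓ : IsChristoffelSymbol g x Γ) {u v u' v' : E}
    (hu : g x u u = 1) (hv : g x v v = 1) (huv : g x u v = 0)
    (hu' : g x u' u' = 1) (hv' : g x v' v' = 1) (huv' : g x u' v' = 0)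
    (hu'_mem : u' ∈ Submodule.span ℝ {u, v}) (hv'_mem : v' ∈ Submodule.span ℝ {u, v}) :
    riemannForm g Γ x u' v' v' u' = riemannForm g Γ x u v v u := by
  obtain ⟨a, b, rfl⟩ := Submodule.mem_span_pair.1 hu'_mem
  obtain ⟨c, d, rfl⟩ := Submodule.mem_span_pair.1 hv'_mem
  have hvu : g x v u = 0 := by rw [hgx.symm, huv]
  simp only [map_add, map_smul, add_apply, smul_apply, smul_eq_mul, hu, hv, huv, hvu, mul_one,
    mul_zero, add_zero, zero_add] at hu' hv' huv'
  have hdet : (a * d - b * c) ^ 2 = 1 := by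
    have lagrange : (a * d - b * c) ^ 2 =
        (a * a + b * b) * (c * c + d * d) - (c * a + d * b) ^ 2 := by ring
    rw [lagrange, hu', hv', huv']
    norm_num
  rw [apply_comb_of_skew (F := fun p q ↦ riemannForm g Γ x p q _ _)
      (fun p q ↦ riemannForm_swap_left p q _ _)
      (fun a b p p' q ↦ riemannForm_comb_left hg hgx hΓ a b p p' q _ _),
    apply_comb_of_skew (F := fun p q ↦ riemannForm g Γ x u v p q)
      (fun p q ↦ riemannForm_swap_right hgx.symm u v p q)
      (fun a b p p' q ↦ riemannForm_comb_right hg hgx hΓ a b u v p p' q),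
    riemannForm_swap_right hgx.symm u v u v]
  linear_combination hdet * riemannForm g Γ x u v v u

end RiemannForm

section ChartField

variable {E : Type*} [NormedAddCommGroup E] [NormedSpace ℝ E]
  {M : Type*} [TopologicalSpace M] [ChartedSpace E M] [IsManifold 𝓘(ℝ, E) ∞ M]

/-- The coordinate expression of a vector field in the preferred chart at `m`. -/
def chartField (m : M) (Y : Π x : M, TangentSpace 𝓘(ℝ, E) x) (y : E) : E :=
  chartCoord m ((extChartAt 𝓘(ℝ, E) m).symm y) (Y ((extChartAt 𝓘(ℝ, E) m).symm y))

lemma chartFrame_chartField {m x : M} (hx : x ∈ (extChartAt 𝓘(ℝ, E) m).source)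
    (Y : Π x : M, TangentSpace 𝓘(ℝ, E) x) :
    chartFrame m x (chartField m Y (extChartAt 𝓘(ℝ, E) m x)) = Y x := by
  rw [chartField, (extChartAt 𝓘(ℝ, E) m).left_inv hx, chartFrame_chartCoord hx]

lemma differentiableAt_chartField {m : M} {Y : Π x : M, TangentSpace 𝓘(ℝ, E) x}
    (hY : MDiffAt (T% Y) m) : DifferentiableAt ℝ (chartField m Y) (extChartAt 𝓘(ℝ, E) m m) :=
  differentiableAt_comp_extChartAt_symm
    ((mdifferentiableAt_section_iff_chartCoord (mem_extChartAt_source m) Y).1 hY)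

end ChartField

namespace WeakRiemannianStructure

variable {E : Type*} [NormedAddCommGroup E] [NormedSpace ℝ E]
  {M : Type*} [TopologicalSpace M] [ChartedSpace E M] [IsManifold 𝓘(ℝ, E) ∞ M]
  (S : WeakRiemannianStructure E M)

/-- The metric at `x` in the frame of the preferred chart at `m`. -/
def frameMetric (m x : M) : E →L[ℝ] E →L[ℝ] ℝ :=
  ContinuousLinearMap.bilinearComp (E := E) (F := E) (E' := E) (F' := E) (G := ℝ)
    (S.metric x) (chartFrame m x) (chartFrame m x)

/-- The metric in the preferred chart at `m`. -/
def chartMetric (m : M) (y : E) : E →L[ℝ] E →L[ℝ] ℝ :=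
  S.frameMetric m ((extChartAt 𝓘(ℝ, E) m).symm y)

/-- The Christoffel symbols of the second kind in the preferred chart at `m`, at the point `m`. -/
def chartChristoffel (m : M) (u v : E) : E :=
  chartCoord m m (S.cov (fun x ↦ chartFrame m x v) m (chartFrame m m u))

lemma frameMetric_apply (m x : M) (v w : E) :
    S.frameMetric m x v w = S.metric x (chartFrame m x v) (chartFrame m x w) := rfl

lemma chartMetric_apply {m x : M} (hx : x ∈ (extChartAt 𝓘(ℝ, E) m).source) (v w : E) :
    S.chartMetric m (extChartAt 𝓘(ℝ, E) m x) v w =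
      S.metric x (chartFrame m x v) (chartFrame m x w) := by
  rw [chartMetric, (extChartAt 𝓘(ℝ, E) m).left_inv hx, frameMetric_apply]

lemma contMDiffAt_frameMetric (m : M) : CMDiffAt ∞ (S.frameMetric m) m := by
  have h := ((contMDiffAt_hom_bundle (n := ∞) (x₀ := m) _).1 S.metric_smooth.contMDiffAt).2
  refine h.congr_of_eventuallyEq ?_
  filter_upwards [extChartAt_source_mem_nhds (I := 𝓘(ℝ, E)) m] with x hx
  have hb := mem_baseSet_of_mem_source hx
  ext v w
  rw [inCoordinates_apply_eq₂ hb hb (Set.mem_univ _), frameMetric_apply, chartFrame,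
    Trivialization.symmL_apply _ hb, Trivialization.symmL_apply _ hb]
  simp

lemma contDiffAt_chartMetric (m : M) :
    ContDiffAt ℝ ∞ (S.chartMetric m) (extChartAt 𝓘(ℝ, E) m m) :=
  contDiffAt_comp_extChartAt_symm (S.contMDiffAt_frameMetric m)

lemma chartMetric_symm (m : M) (y v w : E) : S.chartMetric m y v w = S.chartMetric m y w v :=
  S.metric_symm ((extChartAt 𝓘(ℝ, E) m).symm y) (chartFrame m _ v) (chartFrame m _ w)

lemma isInnerProduct_chartMetric {m x : M} (hx : x ∈ (extChartAt 𝓘(ℝ, E) m).source) :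
    IsInnerProduct (S.chartMetric m (extChartAt 𝓘(ℝ, E) m x)) where
  symm := S.chartMetric_symm m _
  pos v hv := by
    rw [S.chartMetric_apply hx]
    exact S.metric_pos x _ fun h ↦ hv (chartFrame_injective hx (h.trans (map_zero _).symm))

lemma ext_of_metric_chartFrame {m : M} {v w : TangentSpace 𝓘(ℝ, E) m}
    (h : ∀ z, S.metric m v (chartFrame m m z) = S.metric m w (chartFrame m m z)) : v = w := by
  have hm := mem_extChartAt_source (I := 𝓘(ℝ, E)) m
  rw [← chartFrame_chartCoord hm v, ← chartFrame_chartCoord hm w] at h ⊢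
  refine congrArg (chartFrame m m) ((S.isInnerProduct_chartMetric hm).ext fun z ↦ ?_)
  rw [S.chartMetric_apply hm, S.chartMetric_apply hm, h]

lemma mdifferentiableAt_metric {Y Z : Π x : M, TangentSpace 𝓘(ℝ, E) x} {x : M}
    (hY : MDiffAt (T% Y) x) (hZ : MDiffAt (T% Z) x) :
    MDiffAt (fun y ↦ S.metric y (Y y) (Z y)) x := by
  have h : MDifferentiableAt 𝓘(ℝ, E) (𝓘(ℝ, E).prod 𝓘(ℝ, ℝ))
      (fun y : M ↦ TotalSpace.mk' ℝ (E := Bundle.Trivial M ℝ) y (S.metric y (Y y) (Z y))) x :=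
    MDifferentiableAt.clm_bundle_apply₂ (F₁ := E) (F₂ := E)
      (S.metric_smooth.mdifferentiableAt (by simp)) hY hZ
  exact ((mdifferentiableAt_totalSpace _ _).1 h).2

lemma cov_congr {Y Z : Π x : M, TangentSpace 𝓘(ℝ, E) x} {x : M} (hZ : MDiffAt (T% Z) x)
    (h : ∀ᶠ y in 𝓝 x, Y y = Z y) : S.cov Y x = S.cov Z x := by
  have hY : MDiffAt (T% Y) x :=
    hZ.congr_of_eventuallyEq (h.mono fun y hy ↦ by simp only [hy])
  exact (S.cov.isCovariantDerivativeOn (s := Set.univ)).congr_of_eventuallyEq hY hZ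
    Filter.univ_mem h

lemma mvfderiv_metric_chartFrame {m x : M} (hx : x ∈ (extChartAt 𝓘(ℝ, E) m).source)
    (u v w : E) :
    mvfderiv 𝓘(ℝ, E) (fun y ↦ S.metric y (chartFrame m y v) (chartFrame m y w)) x
      (chartFrame m x u) = fderiv ℝ (S.chartMetric m · v w) (extChartAt 𝓘(ℝ, E) m x) u :=
  mvfderiv_chartFrame hx (S.mdifferentiableAt_metric (mdifferentiableAt_chartFrame hx v)
    (mdifferentiableAt_chartFrame hx w)) u

lemma mvfderiv_metric_chartField {m : M} {Y : Π x : M, TangentSpace 𝓘(ℝ, E) x}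
    (hY : MDiffAt (T% Y) m) (u z : E) :
    mvfderiv 𝓘(ℝ, E) (fun x ↦ S.metric x (Y x) (chartFrame m x z)) m (chartFrame m m u) =
      fderiv ℝ (S.chartMetric m) (extChartAt 𝓘(ℝ, E) m m) u
          (chartField m Y (extChartAt 𝓘(ℝ, E) m m)) z +
        S.chartMetric m (extChartAt 𝓘(ℝ, E) m m)
          (fderiv ℝ (chartField m Y) (extChartAt 𝓘(ℝ, E) m m) u) z := by
  have hm := mem_extChartAt_source (I := 𝓘(ℝ, E)) m
  have in_chart : (fun x ↦ S.metric x (Y x) (chartFrame m x z)) ∘ (extChartAt 𝓘(ℝ, E) m).symm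
      =ᶠ[𝓝 (extChartAt 𝓘(ℝ, E) m m)] fun y ↦ S.chartMetric m y (chartField m Y y) z := by
    filter_upwards [eventually_extChartAt_symm_mem_source m] with y hy
    have h := S.chartMetric_apply hy.1 (chartField m Y y) z
    have hY := chartFrame_chartField hy.1 Y
    rw [hy.2] at h hY
    rw [h, hY, Function.comp_apply]
  rw [mvfderiv_chartFrame hm (S.mdifferentiableAt_metric hY (mdifferentiableAt_chartFrame hm z)),
    in_chart.fderiv_eq, fderiv_bilinear_eval
      ((S.contDiffAt_chartMetric m).differentiableAt (by simp)) (differentiableAt_chartField hY)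
      (differentiableAt_const z), fderiv_const_apply, zero_apply, map_zero, add_zero]

lemma chartFrame_chartChristoffel (m : M) (u v : E) :
    chartFrame m m (S.chartChristoffel m u v) =
      S.cov (fun x ↦ chartFrame m x v) m (chartFrame m m u) :=
  chartFrame_chartCoord (mem_extChartAt_source m) _

lemma mdifferentiableAt_cov_chartFrame (m : M) (v w : E) :
    MDiffAt (T% (fun y ↦ S.cov (fun y ↦ chartFrame m y w) y (chartFrame m y v))) m := by
  have hm := mem_extChartAt_source (I := 𝓘(ℝ, E)) m
  have ho := isOpen_extChartAt_source (I := 𝓘(ℝ, E)) m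
  have smooth := (S.cov_smooth _ ho).contMDiff (σ := fun y ↦ chartFrame m y w)
    (fun y hy ↦ (contMDiffAt_chartFrame hy (n := ⊤) contMDiffAt_const).contMDiffWithinAt)
  exact MDifferentiableAt.clm_bundle_apply
    (((smooth m hm).contMDiffAt (ho.mem_nhds hm)).mdifferentiableAt (by simp))
    (mdifferentiableAt_chartFrame hm v)

variable [CompleteSpace E]

-- The Koszul formula: the bracket terms vanish, as the fields are constant in the chart.
lemma metric_cov_chartFrame {m x : M} (hx : x ∈ (extChartAt 𝓘(ℝ, E) m).source) (u v w : E) :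
    S.metric x (S.cov (fun y ↦ chartFrame m y v) x (chartFrame m x u)) (chartFrame m x w) =
      christoffel (S.chartMetric m · · ·) (extChartAt 𝓘(ℝ, E) m x) u v w := by
  have hd (v : E) := mdifferentiableAt_chartFrame hx v
  have compatible (u v w : E) := (S.mvfderiv_metric_chartFrame hx u v w).symm.trans
    (S.cov_metric _ _ x (chartFrame m x u) (hd v) (hd w))
  have torsion_free (u v : E) : S.cov (fun y ↦ chartFrame m y v) x (chartFrame m x u) =
      S.cov (fun y ↦ chartFrame m y u) x (chartFrame m x v) :=
    sub_eq_zero.1 ((S.cov_torsion _ _ x (hd u) (hd v)).trans (mlieBracket_chartFrame hx u v))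
  rw [christoffel, compatible u v w, compatible v u w, compatible w u v, torsion_free v u,
    torsion_free w u, torsion_free w v, S.metric_symm x (chartFrame m x v),
    S.metric_symm x (chartFrame m x u)]
  ring

lemma isChristoffelSymbol_chartChristoffel (m : M) :
    IsChristoffelSymbol (S.chartMetric m) (extChartAt 𝓘(ℝ, E) m m) (S.chartChristoffel m) := by
  intro u v w
  rw [S.chartMetric_apply (mem_extChartAt_source m), chartFrame_chartChristoffel,
    S.metric_cov_chartFrame (mem_extChartAt_source m)]

lemma cov_eq_chartFrame {m : M} {Y : Π x : M, TangentSpace 𝓘(ℝ, E) x}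
    (hY : MDiffAt (T% Y) m) (u : E) :
    S.cov Y m (chartFrame m m u) = chartFrame m m
      (fderiv ℝ (chartField m Y) (extChartAt 𝓘(ℝ, E) m m) u +
        S.chartChristoffel m u (chartField m Y (extChartAt 𝓘(ℝ, E) m m))) := by
  have hm := mem_extChartAt_source (I := 𝓘(ℝ, E)) m
  have hg := (S.contDiffAt_chartMetric m).differentiableAt (by simp)
  have hΓ := S.isChristoffelSymbol_chartChristoffel m
  refine S.ext_of_metric_chartFrame fun z ↦ ?_
  have compatible := (S.mvfderiv_metric_chartField hY u z).symm.trans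
    (S.cov_metric Y _ m _ hY (mdifferentiableAt_chartFrame hm z))
  rw [← chartFrame_chartChristoffel, ← chartFrame_chartField hm Y, ← S.chartMetric_apply hm,
    S.chartMetric_symm _ _ _ (S.chartChristoffel m u z), hΓ,
    christoffel_eq hg] at compatible
  rw [← S.chartMetric_apply hm, map_add, add_apply, hΓ, christoffel_eq hg]
  rw [fderiv_metric_symm (S.chartMetric_symm m) hg u z] at compatible
  linarith

lemma metric_cov_cov_chartFrame (m : M) (u v w z : E) :
    S.metric m (S.cov (fun y ↦ S.cov (fun y ↦ chartFrame m y w) y (chartFrame m y v)) m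
        (chartFrame m m u)) (chartFrame m m z) =
      fderiv ℝ (fun y ↦ christoffel (S.chartMetric m · · ·) y v w z)
          (extChartAt 𝓘(ℝ, E) m m) u
        - S.chartMetric m (extChartAt 𝓘(ℝ, E) m m)
          (S.chartChristoffel m v w) (S.chartChristoffel m u z) := by
  have hm := mem_extChartAt_source (I := 𝓘(ℝ, E)) m
  have hcov := S.mdifferentiableAt_cov_chartFrame m v w
  have hz := mdifferentiableAt_chartFrame hm z
  have in_chart : (fun x ↦ S.metric x (S.cov (fun y ↦ chartFrame m y w) x (chartFrame m x v))
        (chartFrame m x z)) ∘ (extChartAt 𝓘(ℝ, E) m).symm =ᶠ[𝓝 (extChartAt 𝓘(ℝ, E) m m)]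
      fun y ↦ christoffel (S.chartMetric m · · ·) y v w z := by
    filter_upwards [eventually_extChartAt_symm_mem_source m] with y hy
    rw [Function.comp_apply, S.metric_cov_chartFrame hy.1, hy.2]
  have compatible := S.cov_metric _ _ m (chartFrame m m u) hcov hz
  rw [mvfderiv_chartFrame hm (S.mdifferentiableAt_metric hcov hz), in_chart.fderiv_eq] at compatible
  rw [S.chartMetric_apply hm, chartFrame_chartChristoffel, chartFrame_chartChristoffel, compatible,
    add_sub_cancel_right]

lemma curvature_chartFrame (m : M) (u v w : E) :
    S.curvature (chartFrame m m u) (chartFrame m m v) (chartFrame m m w) =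
      S.cov (fun y ↦ S.cov (fun y ↦ chartFrame m y w) y (chartFrame m y v)) m (chartFrame m m u) -
      S.cov (fun y ↦ S.cov (fun y ↦ chartFrame m y w) y (chartFrame m y u)) m
        (chartFrame m m v) := by
  have hsource := extChartAt_source_mem_nhds (I := 𝓘(ℝ, E)) m
  have hextend (v : E) :
      ∀ᶠ y in 𝓝 m, FiberBundle.extend E (chartFrame m m v) y = chartFrame m y v :=
    Filter.mem_of_superset hsource fun y hy ↦ extend_chartFrame hy v
  have hcov (v : E) : S.cov (fun y ↦ S.cov (FiberBundle.extend E (chartFrame m m w)) y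
        (FiberBundle.extend E (chartFrame m m v) y)) m =
      S.cov (fun y ↦ S.cov (fun y ↦ chartFrame m y w) y (chartFrame m y v)) m := by
    refine S.cov_congr (S.mdifferentiableAt_cov_chartFrame m v w) ?_
    filter_upwards [hextend v, (hextend w).eventually_nhds, hsource] with y hv hw hy
    rw [hv, S.cov_congr (mdifferentiableAt_chartFrame hy w) hw]
  have hbracket : VectorField.mlieBracket 𝓘(ℝ, E) (FiberBundle.extend E (chartFrame m m u))
      (FiberBundle.extend E (chartFrame m m v)) m = 0 :=
    (Filter.EventuallyEq.mlieBracket_vectorField_eq (I := 𝓘(ℝ, E)) (hextend u) (hextend v)).trans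
      (mlieBracket_chartFrame (mem_extChartAt_source m) u v)
  rw [curvature, hcov v, hcov u, hbracket, map_zero, sub_zero]

lemma metric_curvature_chartFrame (m : M) (u v w z : E) :
    S.metric m (S.curvature (chartFrame m m u) (chartFrame m m v) (chartFrame m m w))
        (chartFrame m m z) =
      riemannForm (S.chartMetric m) (S.chartChristoffel m) (extChartAt 𝓘(ℝ, E) m m) u v w z := by
  rw [curvature_chartFrame, map_sub (S.metric m), sub_apply, metric_cov_cov_chartFrame,
    metric_cov_cov_chartFrame,
    riemannForm_eq_fderiv_christoffel_sub ((S.contDiffAt_chartMetric m).of_le ENat.LEInfty.out)]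

lemma sectionalCurvature_span_chartFrame {m : M} {u v : E}
    (hu : S.chartMetric m (extChartAt 𝓘(ℝ, E) m m) u u = 1)
    (hv : S.chartMetric m (extChartAt 𝓘(ℝ, E) m m) v v = 1)
    (huv : S.chartMetric m (extChartAt 𝓘(ℝ, E) m m) u v = 0) :
    S.sectionalCurvature (Submodule.span ℝ {chartFrame m m u, chartFrame m m v}) =
      riemannForm (S.chartMetric m) (S.chartChristoffel m) (extChartAt 𝓘(ℝ, E) m m) u v v u := by
  have hm := mem_extChartAt_source (I := 𝓘(ℝ, E)) m
  set P := Submodule.span ℝ {chartFrame m m u, chartFrame m m v} with hP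
  have hex : ∃ b, S.IsOrthonormalBasisOf P b :=
    ⟨(chartFrame m m u, chartFrame m m v), by rwa [← S.chartMetric_apply hm],
      by rwa [← S.chartMetric_apply hm], by rwa [← S.chartMetric_apply hm], rfl⟩
  rw [sectionalCurvature, dif_pos hex]
  obtain ⟨hu', hv', huv', hspan⟩ := hex.choose_spec
  generalize hex.choose = b at hu' hv' huv' hspan
  have mem_span {w : TangentSpace 𝓘(ℝ, E) m} (hw : w ∈ ({b.1, b.2} : Set _)) :
      ∃ w' ∈ Submodule.span ℝ {u, v}, chartFrame m m w' = w := by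
    have hw : w ∈ P := hspan.le (Submodule.subset_span hw)
    rw [hP, ← Set.image_pair, ← ContinuousLinearMap.coe_coe, ← Submodule.map_span] at hw
    exact hw
  obtain ⟨u', hu'_mem, hbu⟩ := mem_span (w := b.1) (by simp)
  obtain ⟨v', hv'_mem, hbv⟩ := mem_span (w := b.2) (by simp)
  rw [← hbu, ← S.chartMetric_apply hm] at hu'
  rw [← hbv, ← S.chartMetric_apply hm] at hv'
  rw [← hbu, ← hbv, ← S.chartMetric_apply hm] at huv'
  rw [← hbu, ← hbv, metric_curvature_chartFrame]
  exact riemannForm_eq_of_orthonormal ((S.contDiffAt_chartMetric m).of_le ENat.LEInfty.out)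
    (S.isInnerProduct_chartMetric hm) (S.isChristoffelSymbol_chartChristoffel m) hu hv huv
    hu' hv' huv' hu'_mem hv'_mem

end WeakRiemannianStructure

section ChartMap

variable {E : Type*} [NormedAddCommGroup E] [NormedSpace ℝ E]
  {M : Type*} [TopologicalSpace M] [ChartedSpace E M]
  {F : Type*} [NormedAddCommGroup F] [NormedSpace ℝ F]
  {N : Type*} [TopologicalSpace N] [ChartedSpace F N]

/-- The coordinate expression of the map `f` in the preferred charts at `m` and `f m`. -/
def chartMap (f : M → N) (m : M) (y : E) : F :=
  extChartAt 𝓘(ℝ, F) (f m) (f ((extChartAt 𝓘(ℝ, E) m).symm y))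

lemma chartMap_extChartAt (f : M → N) {m x : M} (hx : x ∈ (extChartAt 𝓘(ℝ, E) m).source) :
    chartMap (E := E) (F := F) f m (extChartAt 𝓘(ℝ, E) m x) =
      extChartAt 𝓘(ℝ, F) (f m) (f x) := by
  rw [chartMap, (extChartAt 𝓘(ℝ, E) m).left_inv hx]

lemma chartMap_self (f : M → N) (m : M) :
    chartMap (E := E) (F := F) f m (extChartAt 𝓘(ℝ, E) m m) = extChartAt 𝓘(ℝ, F) (f m) (f m) :=
  chartMap_extChartAt f (mem_extChartAt_source m)

variable [IsManifold 𝓘(ℝ, E) ∞ M]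

lemma contDiffAt_chartMap {f : M → N} {m : M} (hf : CMDiffAt ∞ f m) :
    ContDiffAt ℝ ∞ (chartMap (E := E) (F := F) f m) (extChartAt 𝓘(ℝ, E) m m) :=
  contDiffAt_comp_extChartAt_symm (f := fun x ↦ extChartAt 𝓘(ℝ, F) (f m) (f x))
    (contMDiffAt_extChartAt.comp m hf)

variable [IsManifold 𝓘(ℝ, F) ∞ N]

lemma chartFrame_fderiv_chartMap {f : M → N} {m x : M} (hx : x ∈ (extChartAt 𝓘(ℝ, E) m).source)
    (hfx : f x ∈ (extChartAt 𝓘(ℝ, F) (f m)).source) (hf : MDiffAt f x) (u : E) :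
    chartFrame (f m) (f x)
      (fderiv ℝ (chartMap (E := E) (F := F) f m) (extChartAt 𝓘(ℝ, E) m x) u) =
      mfderiv 𝓘(ℝ, E) 𝓘(ℝ, F) f x (chartFrame m x u) := by
  have hchart : MDifferentiableAt 𝓘(ℝ, F) 𝓘(ℝ, F) (extChartAt 𝓘(ℝ, F) (f m)) (f x) :=
    mdifferentiableAt_extChartAt (by simpa using hfx)
  have hfderiv : fderiv ℝ (chartMap (E := E) (F := F) f m) (extChartAt 𝓘(ℝ, E) m x) u =
      chartCoord (f m) (f x) (mfderiv 𝓘(ℝ, E) 𝓘(ℝ, F) f x (chartFrame m x u)) :=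
    (mvfderiv_chartFrame hx (hchart.comp x hf) u).symm.trans
      ((mfderiv_comp_apply x hchart hf (chartFrame m x u)).trans
        (DFunLike.congr_fun (chartCoord_eq_mfderiv hfx) _).symm)
  rw [hfderiv, chartFrame_chartCoord hfx]

end ChartMap

section LocalInverse

variable {E : Type*} [NormedAddCommGroup E] [NormedSpace ℝ E]
  {M : Type*} [TopologicalSpace M] [ChartedSpace E M]
  {F : Type*} [NormedAddCommGroup F] [NormedSpace ℝ F]
  {N : Type*} [TopologicalSpace N] [ChartedSpace F N]

lemma contMDiffAt_extend_symm {e : OpenPartialHomeomorph M E}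
    (he : e ∈ IsManifold.maximalAtlas 𝓘(ℝ, E) ∞ M) {y : E} (hy : y ∈ e.target) :
    CMDiffAt ∞ e.symm y := by
  have h := contMDiffOn_extend_symm he
  simp only [modelWithCornersSelf_coe, Set.image_id] at h
  exact (h y hy).contMDiffAt (e.open_target.mem_nhds hy)

lemma exists_leftInverse_of_isImmersionAt {f : N → M} {x : N}
    (h : Manifold.IsImmersionAt 𝓘(ℝ, F) 𝓘(ℝ, E) ∞ f x) :
    ∃ r : M → N, CMDiffAt ∞ r (f x) ∧ ∀ᶠ y in 𝓝 x, r (f y) = y := by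
  have hx := h.mem_domChart_source
  have in_charts : ∀ y ∈ h.domChart.source,
      (h.equiv.symm (h.codChart (f y))).1 = h.domChart y := by
    intro y hy
    have hw := h.writtenInCharts (show h.domChart y ∈ (h.domChart.extend 𝓘(ℝ, F)).target by
      simpa using h.domChart.map_source hy)
    simp only [Function.comp_apply, OpenPartialHomeomorph.extend_coe_symm,
      OpenPartialHomeomorph.extend_coe, modelWithCornersSelf_coe, modelWithCornersSelf_coe_symm,
      id_eq, h.domChart.left_inv hy] at hw
    rw [hw, ContinuousLinearEquiv.symm_apply_apply]
  refine ⟨fun y ↦ h.domChart.symm (h.equiv.symm (h.codChart y)).1, ?_, ?_⟩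
  · have hcod : CMDiffAt ∞ h.codChart (f x) :=
      h.codChart.contMDiffAt_extend h.codChart_mem_maximalAtlas h.mem_codChart_source
    have hfst : ContDiff ℝ ∞ (fun z ↦ (h.equiv.symm z).1) := by fun_prop
    exact ContMDiffAt.comp_of_eq (contMDiffAt_extend_symm h.domChart_mem_maximalAtlas
      (h.domChart.map_source hx)) (hfst.contMDiff.contMDiffAt.comp (f x) hcod) (in_charts x hx)
  · filter_upwards [h.domChart.open_source.mem_nhds hx] with y hy
    rw [in_charts y hy, h.domChart.left_inv hy]

lemma exists_rightInverse_of_isSubmersionAt {f : N → M} {x : N}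
    (h : Manifold.IsSubmersionAt 𝓘(ℝ, F) 𝓘(ℝ, E) ∞ f x) :
    ∃ s : M → N, CMDiffAt ∞ s (f x) ∧ s (f x) = x ∧ ∀ᶠ y in 𝓝 (f x), f (s y) = y := by
  have hx := h.mem_domChart_source
  have in_charts : ∀ u ∈ h.domChart.target,
      h.codChart (f (h.domChart.symm u)) = (h.equiv u).1 := fun u hu ↦
    h.writtenInCharts (show u ∈ (h.domChart.extend 𝓘(ℝ, F)).target by simpa using hu)
  let t : M → F := fun y ↦ h.equiv.symm (h.codChart y, (h.equiv (h.domChart x)).2)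
  have t_self : t (f x) = h.domChart x := by
    have := in_charts _ (h.domChart.map_source hx)
    rw [h.domChart.left_inv hx] at this
    simp [t, this]
  have t_smooth : CMDiffAt ∞ t (f x) := by
    have hsymm : ContDiff ℝ ∞ (fun z ↦ h.equiv.symm (z, (h.equiv (h.domChart x)).2)) := by fun_prop
    exact hsymm.contMDiff.contMDiffAt.comp (f x)
      (h.codChart.contMDiffAt_extend h.codChart_mem_maximalAtlas h.mem_codChart_source)
  refine ⟨fun y ↦ h.domChart.symm (t y), ?_, ?_, ?_⟩
  · exact ContMDiffAt.comp_of_eq (contMDiffAt_extend_symm h.domChart_mem_maximalAtlas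
      (h.domChart.map_source hx)) t_smooth t_self
  · exact (congrArg _ t_self).trans (h.domChart.left_inv hx)
  · have t_mem : ∀ᶠ y in 𝓝 (f x), t y ∈ h.domChart.target :=
      t_smooth.continuousAt.eventually (by
        rw [t_self]; exact h.domChart.open_target.mem_nhds (h.domChart.map_source hx))
    filter_upwards [t_mem, h.codChart.open_source.mem_nhds h.mem_codChart_source] with y ht hy
    refine h.codChart.injOn (h.source_subset_preimage_source (h.domChart.map_target ht)) hy ?_
    rw [in_charts _ ht]
    simp [t]

variable [IsManifold 𝓘(ℝ, E) ∞ M]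

lemma exists_leftInverse_chartMap {f : N → M} {x : N}
    (h : Manifold.IsImmersionAt 𝓘(ℝ, F) 𝓘(ℝ, E) ∞ f x) :
    ∃ r : E → F, ContDiffAt ℝ ∞ r (extChartAt 𝓘(ℝ, E) (f x) (f x)) ∧
      ∀ᶠ y in 𝓝 (extChartAt 𝓘(ℝ, F) x x), r (chartMap f x y) = y := by
  obtain ⟨r, hr, hrf⟩ := exists_leftInverse_of_isImmersionAt h
  have hrfx : CMDiffAt ∞ (extChartAt 𝓘(ℝ, F) x) (r (f x)) := by
    rw [hrf.self_of_nhds]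
    exact contMDiffAt_extChartAt
  refine ⟨_, contDiffAt_comp_extChartAt_symm (hrfx.comp (f x) hr), ?_⟩
  filter_upwards [eventually_extChartAt_symm_mem_source x,
    (tendsto_extChartAt_symm x).eventually hrf,
    (tendsto_extChartAt_symm x).eventually (h.contMDiffAt.continuousAt.eventually
      (extChartAt_source_mem_nhds (I := 𝓘(ℝ, E)) (f x)))] with y hy hry hfy
  simp only [Function.comp_apply, chartMap, (extChartAt 𝓘(ℝ, E) (f x)).left_inv hfy, hry, hy.2]

lemma exists_rightInverse_chartMap {f : N → M} {x : N}
    (h : Manifold.IsSubmersionAt 𝓘(ℝ, F) 𝓘(ℝ, E) ∞ f x) :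
    ∃ s : E → F, ContDiffAt ℝ ∞ s (extChartAt 𝓘(ℝ, E) (f x) (f x)) ∧
      s (extChartAt 𝓘(ℝ, E) (f x) (f x)) = extChartAt 𝓘(ℝ, F) x x ∧
      ∀ᶠ y in 𝓝 (extChartAt 𝓘(ℝ, E) (f x) (f x)), chartMap f x (s y) = y := by
  obtain ⟨s, hs, hsx, hfs⟩ := exists_rightInverse_of_isSubmersionAt h
  have hsfx : CMDiffAt ∞ (extChartAt 𝓘(ℝ, F) x) (s (f x)) := by
    rw [hsx]
    exact contMDiffAt_extChartAt
  have hsource : ∀ᶠ y in 𝓝 (f x), s y ∈ (extChartAt 𝓘(ℝ, F) x).source :=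
    hs.continuousAt.eventually (by rw [hsx]; exact extChartAt_source_mem_nhds x)
  refine ⟨_, contDiffAt_comp_extChartAt_symm (hsfx.comp (f x) hs), ?_, ?_⟩
  · rw [Function.comp_apply, extChartAt_to_inv, Function.comp_apply, hsx]
  · filter_upwards [eventually_extChartAt_symm_mem_source (f x),
      (tendsto_extChartAt_symm (f x)).eventually hfs,
      (tendsto_extChartAt_symm (f x)).eventually hsource] with y hy hfsy hsy
    rw [Function.comp_apply, Function.comp_apply, chartMap_extChartAt f hsy, hfsy, hy.2]

variable [IsManifold 𝓘(ℝ, F) ∞ N]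

lemma exists_leftInverse_fderiv_chartMap {f : N → M} {x : N}
    (h : Manifold.IsImmersionAt 𝓘(ℝ, F) 𝓘(ℝ, E) ∞ f x) :
    ∃ r : E →L[ℝ] F, Function.LeftInverse r
      (fderiv ℝ (chartMap (E := F) (F := E) f x) (extChartAt 𝓘(ℝ, F) x x)) := by
  obtain ⟨r, hr, hrf⟩ := exists_leftInverse_chartMap h
  rw [← chartMap_self (E := F) f x] at hr
  refine ⟨fderiv ℝ r (chartMap f x (extChartAt 𝓘(ℝ, F) x x)), fun u ↦ ?_⟩
  have hcomp := fderiv_comp _ (hr.differentiableAt (by simp))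
    ((contDiffAt_chartMap h.contMDiffAt).differentiableAt (by simp))
  have hid : fderiv ℝ (r ∘ chartMap f x) (extChartAt 𝓘(ℝ, F) x x) = .id ℝ F :=
    (Filter.EventuallyEq.fderiv_eq (f := id) hrf).trans fderiv_id
  exact (DFunLike.congr_fun hcomp u).symm.trans (DFunLike.congr_fun hid u)

lemma exists_rightInverse_fderiv_chartMap {f : N → M} {x : N}
    (h : Manifold.IsSubmersionAt 𝓘(ℝ, F) 𝓘(ℝ, E) ∞ f x) :
    ∃ s : E →L[ℝ] F, Function.RightInverse s
      (fderiv ℝ (chartMap (E := F) (F := E) f x) (extChartAt 𝓘(ℝ, F) x x)) := by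
  obtain ⟨s, hs, hsx, hfs⟩ := exists_rightInverse_chartMap h
  have hf := contDiffAt_chartMap h.isSubmersionAtOfComplement_complement.contMDiffAt
  rw [← hsx] at hf ⊢
  refine ⟨fderiv ℝ s (extChartAt 𝓘(ℝ, E) (f x) (f x)), fun u ↦ ?_⟩
  have hcomp := fderiv_comp _ (hf.differentiableAt (by simp)) (hs.differentiableAt (by simp))
  have hid : fderiv ℝ (chartMap f x ∘ s) (extChartAt 𝓘(ℝ, E) (f x) (f x)) = .id ℝ E :=
    (Filter.EventuallyEq.fderiv_eq (f := id) hfs).trans fderiv_id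
  exact (DFunLike.congr_fun hcomp u).symm.trans (DFunLike.congr_fun hid u)

end LocalInverse

namespace WeakKahlerStructure

variable {E : Type*} [NormedAddCommGroup E] [NormedSpace ℝ E]
  {M : Type*} [TopologicalSpace M] [ChartedSpace E M] [IsManifold 𝓘(ℝ, E) ∞ M]
  (S : WeakKahlerStructure E M)

/-- The complex structure at `x` in the frame of the preferred chart at `m`. -/
def frameJ (m x : M) : E →L[ℝ] E := chartCoord m x ∘L S.J x ∘L chartFrame m x

/-- The complex structure in the preferred chart at `m`. -/
def chartJ (m : M) (y : E) : E →L[ℝ] E := S.frameJ m ((extChartAt 𝓘(ℝ, E) m).symm y)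

lemma contDiffAt_chartJ (m : M) : ContDiffAt ℝ ∞ (S.chartJ m) (extChartAt 𝓘(ℝ, E) m m) := by
  refine contDiffAt_comp_extChartAt_symm (f := S.frameJ m) ?_
  exact ((contMDiffAt_hom_bundle (n := ∞) (x₀ := m) _).1 S.J_smooth.contMDiffAt).2

lemma chartFrame_chartJ {m x : M} (hx : x ∈ (extChartAt 𝓘(ℝ, E) m).source) (v : E) :
    chartFrame m x (S.chartJ m (extChartAt 𝓘(ℝ, E) m x) v) = S.J x (chartFrame m x v) := by
  rw [chartJ, (extChartAt 𝓘(ℝ, E) m).left_inv hx]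
  exact chartFrame_chartCoord hx _

lemma isHermitianStructure_chartJ {m x : M} (hx : x ∈ (extChartAt 𝓘(ℝ, E) m).source) :
    IsHermitianStructure (S.chartMetric m (extChartAt 𝓘(ℝ, E) m x))
      (S.chartJ m (extChartAt 𝓘(ℝ, E) m x)) where
  sq v := chartFrame_injective hx <| by
    rw [S.chartFrame_chartJ hx, S.chartFrame_chartJ hx, S.J_sq, map_neg]
  isometry v w := by
    rw [S.chartMetric_apply hx, S.chartMetric_apply hx, S.chartFrame_chartJ hx,
      S.chartFrame_chartJ hx, S.J_isometry]

lemma chartJ_parallel [CompleteSpace E] (m : M) (u v : E) :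
    fderiv ℝ (S.chartJ m) (extChartAt 𝓘(ℝ, E) m m) u v +
        S.chartChristoffel m u (S.chartJ m (extChartAt 𝓘(ℝ, E) m m) v) =
      S.chartJ m (extChartAt 𝓘(ℝ, E) m m) (S.chartChristoffel m u v) := by
  have hm := mem_extChartAt_source (I := 𝓘(ℝ, E)) m
  have hJv : MDiffAt (T% fun x ↦ S.J x (chartFrame m x v)) m :=
    MDifferentiableAt.clm_bundle_apply (S.J_smooth.mdifferentiableAt (by simp))
      (mdifferentiableAt_chartFrame hm v)
  have in_chart : chartField m (fun x ↦ S.J x (chartFrame m x v)) = (S.chartJ m · v) := rfl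
  apply chartFrame_injective hm
  have h := S.cov_eq_chartFrame hJv u
  rw [in_chart, fderiv_eval ((S.contDiffAt_chartJ m).differentiableAt (by simp))] at h
  rw [← h, S.J_parallel _ _ _ (mdifferentiableAt_chartFrame hm v), S.chartFrame_chartJ hm,
    S.chartFrame_chartChristoffel]

end WeakKahlerStructure

/-- The weak Riemannian structure `T` is the one of the Kähler quotient of `S` at an elliptic
level `c` of the moment map `μ`, fixed by the coadjoint action. -/
structure IsKahlerReduction {E : Type*} [NormedAddCommGroup E] [NormedSpace ℝ E]
    {M : Type*} [TopologicalSpace M] [ChartedSpace E M] [IsManifold 𝓘(ℝ, E) ∞ M]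
    {EG : Type*} [NormedAddCommGroup EG] [NormedSpace ℝ EG] (S : WeakKahlerStructure E M)
    (G : Type*) [TopologicalSpace G] [ChartedSpace EG G] [Group G] [LieGroup 𝓘(ℝ, EG) ∞ G]
    [MulAction G M] [ContMDiffSMul 𝓘(ℝ, EG) 𝓘(ℝ, E) ∞ G M]
    (μ : M → (EG →L[ℝ] ℝ)) (c : EG →L[ℝ] ℝ)
    (EN : Type*) [NormedAddCommGroup EN] [NormedSpace ℝ EN] [ChartedSpace EN (LevelSet μ c)]
    {EQ : Type*} [NormedAddCommGroup EQ] [NormedSpace ℝ EQ]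
    [ChartedSpace EQ (KahlerQuotient G μ c)] [IsManifold 𝓘(ℝ, EQ) ∞ (KahlerQuotient G μ c)]
    (T : WeakRiemannianStructure EQ (KahlerQuotient G μ c)) : Prop where
  moment : S.IsMomentMap G μ
  fixed : ∀ a : G, coadjointAction a c = c
  level : IsLevelSubmanifold E EN μ c
  elliptic : ∀ m : LevelSet μ c, S.IsEllipticAt (EG := EG) G (m : M)
  quotient : S.IsKahlerQuotientStructure G μ c EN T

namespace IsKahlerReduction

variable {E : Type*} [NormedAddCommGroup E] [NormedSpace ℝ E]
  {M : Type*} [TopologicalSpace M] [ChartedSpace E M] [IsManifold 𝓘(ℝ, E) ∞ M]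
  {EG : Type*} [NormedAddCommGroup EG] [NormedSpace ℝ EG]
  {G : Type*} [TopologicalSpace G] [ChartedSpace EG G] [Group G] [LieGroup 𝓘(ℝ, EG) ∞ G]
  [MulAction G M] [ContMDiffSMul 𝓘(ℝ, EG) 𝓘(ℝ, E) ∞ G M]
  {S : WeakKahlerStructure E M} {μ : M → (EG →L[ℝ] ℝ)} {c : EG →L[ℝ] ℝ}
  {EN : Type*} [NormedAddCommGroup EN] [NormedSpace ℝ EN] [ChartedSpace EN (LevelSet μ c)]
  {EQ : Type*} [NormedAddCommGroup EQ] [NormedSpace ℝ EQ]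
  [ChartedSpace EQ (KahlerQuotient G μ c)] [IsManifold 𝓘(ℝ, EQ) ∞ (KahlerQuotient G μ c)]
  {T : WeakRiemannianStructure EQ (KahlerQuotient G μ c)}

lemma isImmersionAt_val (h : IsKahlerReduction S G μ c EN T) (n : LevelSet μ c) :
    Manifold.IsImmersionAt 𝓘(ℝ, EN) 𝓘(ℝ, E) ∞ (Subtype.val : LevelSet μ c → M) n :=
  h.level.embedding.isImmersion.isImmersionAt n

lemma isSubmersionAt_quotientProj (h : IsKahlerReduction S G μ c EN T) (n : LevelSet μ c) :
    Manifold.IsSubmersionAt 𝓘(ℝ, EN) 𝓘(ℝ, EQ) ∞ (quotientProj G μ c) n :=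
  h.quotient.submersion.isSubmersionAt n

lemma contMDiffAt_quotientProj (h : IsKahlerReduction S G μ c EN T) (n : LevelSet μ c) :
    ContMDiffAt 𝓘(ℝ, EN) 𝓘(ℝ, EQ) ∞ (quotientProj G μ c) n :=
  (h.isSubmersionAt_quotientProj n).isSubmersionAtOfComplement_complement.contMDiffAt

lemma mdifferentiableAt_val (h : IsKahlerReduction S G μ c EN T) (n : LevelSet μ c) :
    MDifferentiableAt 𝓘(ℝ, EN) 𝓘(ℝ, E) (Subtype.val : LevelSet μ c → M) n :=
  (h.isImmersionAt_val n).contMDiffAt.mdifferentiableAt (by simp)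

lemma mdifferentiableAt_quotientProj (h : IsKahlerReduction S G μ c EN T) (n : LevelSet μ c) :
    MDifferentiableAt 𝓘(ℝ, EN) 𝓘(ℝ, EQ) (quotientProj G μ c) n :=
  (h.contMDiffAt_quotientProj n).mdifferentiableAt (by simp)

lemma mem_range_inclDeriv_iff (h : IsKahlerReduction S G μ c EN T) {n : LevelSet μ c}
    {e : TangentSpace 𝓘(ℝ, E) (n : M)} :
    (∃ v, inclDeriv (EN := EN) μ c n v = e) ↔
      ∀ W ∈ orbitTangent (E := E) (EG := EG) G (n : M), S.metric n e (S.J n W) = 0 := by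
  have range_eq_ker : (∃ v, inclDeriv (EN := EN) μ c n v = e) ↔
      mvfderiv 𝓘(ℝ, E) μ (n : M) e = 0 := SetLike.ext_iff.1 (h.level.tangent n) e
  rw [range_eq_ker]
  constructor
  · rintro he _ ⟨ρ, rfl⟩
    exact (h.moment.moment _ _ ρ).symm.trans (by rw [he, zero_apply])
  · intro he
    ext ρ
    exact (h.moment.moment _ _ ρ).trans (he _ ⟨ρ, rfl⟩)

lemma inclDeriv_mem_horizontal_iff (h : IsKahlerReduction S G μ c EN T) {n : LevelSet μ c}
    {v : TangentSpace 𝓘(ℝ, EN) n} :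
    inclDeriv μ c n v ∈ S.horizontal (EG := EG) G (n : M) ↔
      ∀ W ∈ orbitTangent (E := E) (EG := EG) G (n : M), S.metric n (inclDeriv μ c n v) W = 0 := by
  constructor
  · rintro hv _ ⟨ρ, rfl⟩
    exact (hv ρ).1
  · exact fun hv ρ ↦ ⟨hv _ ⟨ρ, rfl⟩, h.mem_range_inclDeriv_iff.1 ⟨v, rfl⟩ _ ⟨ρ, rfl⟩⟩

lemma exists_orbitTangent_sub_orthogonal (h : IsKahlerReduction S G μ c EN T) (n : LevelSet μ c)
    (e : TangentSpace 𝓘(ℝ, E) (n : M)) :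
    ∃ U ∈ orbitTangent (E := E) (EG := EG) G (n : M),
      ∀ W ∈ orbitTangent (E := E) (EG := EG) G (n : M), S.metric n (e - U) W = 0 := by
  have hmem : S.Lam (EG := EG) G (n : M) e ∈ LinearMap.range (S.Lam (EG := EG) G (n : M)) :=
    ⟨e, rfl⟩
  rw [h.elliptic n] at hmem
  obtain ⟨U, hU, hUe⟩ := hmem
  refine ⟨U, hU, ?_⟩
  rintro _ ⟨ρ, rfl⟩
  rw [map_sub (S.metric n), sub_apply, sub_eq_zero]
  exact (DFunLike.congr_fun hUe ρ).symm

-- The orbit map of `n` takes values in the level set, where it is smooth by the universal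
-- property of the immersion, and it is constant in the quotient.
lemma orbitTangent_le_map_ker_projDeriv
    (h : IsKahlerReduction S G μ c EN T) (n : LevelSet μ c) :
    orbitTangent (E := E) (EG := EG) G (n : M) ≤
      (WeakKahlerStructure.projDeriv (EN := EN) (EQ := EQ) G μ c n).ker.map
        (inclDeriv (E := E) (EN := EN) μ c n).toLinearMap := by
  rintro _ ⟨ρ, rfl⟩
  have hmem : ∀ a : G, μ (a • (n : M)) = c := fun a ↦ by
    rw [h.moment.equivariant, n.2, h.fixed]
  let orbitMap : G → LevelSet μ c := fun a ↦ ⟨a • (n : M), hmem a⟩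
  have orbitMap_one : orbitMap 1 = n := Subtype.ext (one_smul G (n : M))
  have smooth_action : ContMDiff 𝓘(ℝ, EG) 𝓘(ℝ, E) ∞ (fun a : G ↦ a • (n : M)) :=
    contMDiff_id.smul contMDiff_const
  have smooth_orbitMap : ContMDiffAt 𝓘(ℝ, EG) 𝓘(ℝ, EN) ∞ orbitMap 1 := by
    rw [ContMDiffAt.iff_comp_isImmersionAt (h.isImmersionAt_val (orbitMap 1))]
    exact ⟨(smooth_action.continuous.subtype_mk hmem).continuousAt, smooth_action.contMDiffAt⟩
  have hdiff := smooth_orbitMap.mdifferentiableAt (by simp)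
  have proj_orbitMap : quotientProj G μ c ∘ orbitMap = fun _ ↦ quotientProj G μ c n :=
    funext fun a ↦ Quotient.sound ⟨a, rfl⟩
  refine ⟨(mfderiv 𝓘(ℝ, EG) 𝓘(ℝ, EN) orbitMap 1 : EG →L[ℝ] EN) ρ, ?_, ?_⟩
  · have hcomp := mfderiv_comp_of_eq (h.mdifferentiableAt_quotientProj n) hdiff orbitMap_one
    rw [proj_orbitMap, mfderiv_const] at hcomp
    have hpoint := mfderiv_congr_point (I := 𝓘(ℝ, EN)) (I' := 𝓘(ℝ, EQ))
      (f := quotientProj G μ c) orbitMap_one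
    exact (DFunLike.congr_fun hpoint _).symm.trans (DFunLike.congr_fun hcomp ρ).symm
  · have hcomp := mfderiv_comp_of_eq (h.mdifferentiableAt_val n) hdiff orbitMap_one
    have hpoint := mfderiv_congr_point (I := 𝓘(ℝ, EN)) (I' := 𝓘(ℝ, E))
      (f := (Subtype.val : LevelSet μ c → M)) orbitMap_one
    exact (DFunLike.congr_fun hpoint _).symm.trans (DFunLike.congr_fun hcomp ρ).symm

lemma eventually_mem_extChartAt_source (h : IsKahlerReduction S G μ c EN T) (m : LevelSet μ c) :
    ∀ᶠ y in 𝓝 (extChartAt 𝓘(ℝ, EN) m m), ∃ x : LevelSet μ c,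
      x ∈ (extChartAt 𝓘(ℝ, EN) m).source ∧ (x : M) ∈ (extChartAt 𝓘(ℝ, E) (m : M)).source ∧
      quotientProj G μ c x ∈ (extChartAt 𝓘(ℝ, EQ) (quotientProj G μ c m)).source ∧
      extChartAt 𝓘(ℝ, EN) m x = y := by
  filter_upwards [eventually_extChartAt_symm_mem_source m,
    (tendsto_extChartAt_symm m).eventually ((h.mdifferentiableAt_val m).continuousAt.eventually
      (extChartAt_source_mem_nhds (I := 𝓘(ℝ, E)) (m : M))),
    (tendsto_extChartAt_symm m).eventually
      ((h.mdifferentiableAt_quotientProj m).continuousAt.eventually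
        (extChartAt_source_mem_nhds (I := 𝓘(ℝ, EQ)) (quotientProj G μ c m)))] with y hy hyM hyQ
  exact ⟨_, hy.1, hyM, hyQ, hy.2⟩

-- A vector tangent to the fibre differs from an orbit direction by a horizontal vector which
-- projects to zero, hence has length zero.
lemma map_ker_projDeriv (h : IsKahlerReduction S G μ c EN T) (n : LevelSet μ c) :
    (WeakKahlerStructure.projDeriv (EN := EN) (EQ := EQ) G μ c n).ker.map
        (inclDeriv (E := E) (EN := EN) μ c n).toLinearMap =
      orbitTangent (E := E) (EG := EG) G (n : M) := by
  refine le_antisymm ?_ (h.orbitTangent_le_map_ker_projDeriv n)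
  rintro _ ⟨w, hw, rfl⟩
  obtain ⟨U, hU, horth⟩ := h.exists_orbitTangent_sub_orthogonal n (inclDeriv μ c n w)
  obtain ⟨w', hw', rfl⟩ := h.orbitTangent_le_map_ker_projDeriv n hU
  rw [SetLike.mem_coe, LinearMap.mem_ker, ContinuousLinearMap.coe_coe] at hw hw'
  rw [ContinuousLinearMap.coe_coe, ← map_sub] at horth
  have hhor := h.inclDeriv_mem_horizontal_iff.2 horth
  have hm := h.quotient.metric n _ _ hhor hhor
  rw [map_sub, hw, hw', sub_zero, map_zero] at hm
  have hzero : inclDeriv (E := E) μ c n (w - w') = 0 := by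
    by_contra hne
    exact (S.metric_pos (n : M) _ hne).ne hm
  rw [map_sub, sub_eq_zero] at hzero
  exact (congrArg (· ∈ orbitTangent (E := E) (EG := EG) G (n : M)) hzero).mpr hU

end IsKahlerReduction

/-! ### The Kähler quotient in charts centred at a point -/

section Charts

variable {M : Type*} [TopologicalSpace M] {EG : Type*} [NormedAddCommGroup EG] [NormedSpace ℝ EG]
  (G : Type*) [Group G] [MulAction G M] (μ : M → (EG →L[ℝ] ℝ)) (c : EG →L[ℝ] ℝ)
  (E : Type*) [NormedAddCommGroup E] [NormedSpace ℝ E] [ChartedSpace E M]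
  (EN : Type*) [NormedAddCommGroup EN] [NormedSpace ℝ EN] [ChartedSpace EN (LevelSet μ c)]
  (EQ : Type*) [NormedAddCommGroup EQ] [NormedSpace ℝ EQ] [ChartedSpace EQ (KahlerQuotient G μ c)]

/-- The inclusion of the level set in the charts at `m`. -/
def inclChart (m : LevelSet μ c) : EN → E := chartMap Subtype.val m

/-- The orbit projection of the level set in the charts at `m`. -/
def projChart (m : LevelSet μ c) : EN → EQ := chartMap (quotientProj G μ c) m

/-- The tangent spaces to the fibres of the orbit projection, as subspaces of the tangent spaces
of `M`, in the charts at `m`. -/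
def verticalChart (m : LevelSet μ c) (y : EN) : Submodule ℝ E :=
  (fderiv ℝ (projChart G μ c EN EQ m) y).ker.map
    (fderiv ℝ (inclChart μ c E EN m) y).toLinearMap

end Charts

namespace WeakKahlerStructure

variable {E : Type*} [NormedAddCommGroup E] [NormedSpace ℝ E]
  {M : Type*} [TopologicalSpace M] [ChartedSpace E M] [IsManifold 𝓘(ℝ, E) ∞ M]
  {EG : Type*} [NormedAddCommGroup EG] [NormedSpace ℝ EG] (S : WeakKahlerStructure E M)
  {μ : M → (EG →L[ℝ] ℝ)} {c : EG →L[ℝ] ℝ}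
  {EN : Type*} [NormedAddCommGroup EN] [NormedSpace ℝ EN] [ChartedSpace EN (LevelSet μ c)]
  {m x : LevelSet μ c} (hx : x ∈ (extChartAt 𝓘(ℝ, EN) m).source)
  (hxM : (x : M) ∈ (extChartAt 𝓘(ℝ, E) (m : M)).source)
include hx hxM

lemma chartMetric_inclChart (v w : E) :
    S.chartMetric m (inclChart μ c E EN m (extChartAt 𝓘(ℝ, EN) m x)) v w =
      S.metric (x : M) (chartFrame (m : M) x v) (chartFrame (m : M) x w) := by
  rw [inclChart, chartMap_extChartAt _ hx]
  exact S.chartMetric_apply hxM v w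

lemma chartFrame_chartJ_inclChart (v : E) :
    chartFrame (m : M) (x : M)
      (S.chartJ m (inclChart μ c E EN m (extChartAt 𝓘(ℝ, EN) m x)) v) =
      S.J x (chartFrame (m : M) x v) := by
  rw [inclChart, chartMap_extChartAt _ hx]
  exact S.chartFrame_chartJ hxM v

end WeakKahlerStructure

namespace IsKahlerReduction

variable {E : Type*} [NormedAddCommGroup E] [NormedSpace ℝ E]
  {M : Type*} [TopologicalSpace M] [ChartedSpace E M] [IsManifold 𝓘(ℝ, E) ∞ M]
  {EG : Type*} [NormedAddCommGroup EG] [NormedSpace ℝ EG]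
  {G : Type*} [TopologicalSpace G] [ChartedSpace EG G] [Group G] [LieGroup 𝓘(ℝ, EG) ∞ G]
  [MulAction G M] [ContMDiffSMul 𝓘(ℝ, EG) 𝓘(ℝ, E) ∞ G M]
  {S : WeakKahlerStructure E M} {μ : M → (EG →L[ℝ] ℝ)} {c : EG →L[ℝ] ℝ}
  {EN : Type*} [NormedAddCommGroup EN] [NormedSpace ℝ EN] [ChartedSpace EN (LevelSet μ c)]
  [IsManifold 𝓘(ℝ, EN) ∞ (LevelSet μ c)]
  {EQ : Type*} [NormedAddCommGroup EQ] [NormedSpace ℝ EQ]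
  [ChartedSpace EQ (KahlerQuotient G μ c)] [IsManifold 𝓘(ℝ, EQ) ∞ (KahlerQuotient G μ c)]
  {T : WeakRiemannianStructure EQ (KahlerQuotient G μ c)}
  (h : IsKahlerReduction S G μ c EN T)

include h

section Pointwise

variable {m x : LevelSet μ c} (hx : x ∈ (extChartAt 𝓘(ℝ, EN) m).source)
  (hxM : (x : M) ∈ (extChartAt 𝓘(ℝ, E) (m : M)).source)
  (hxQ : quotientProj G μ c x ∈ (extChartAt 𝓘(ℝ, EQ) (quotientProj G μ c m)).source)
include hx

lemma chartFrame_fderiv_projChart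
    (hxQ : quotientProj G μ c x ∈ (extChartAt 𝓘(ℝ, EQ) (quotientProj G μ c m)).source) (u : EN) :
    chartFrame (quotientProj G μ c m) (quotientProj G μ c x)
      (fderiv ℝ (projChart G μ c EN EQ m) (extChartAt 𝓘(ℝ, EN) m x) u) =
      WeakKahlerStructure.projDeriv (EQ := EQ) G μ c x (chartFrame m x u) :=
  chartFrame_fderiv_chartMap hx hxQ (h.mdifferentiableAt_quotientProj x) u

include hxM

lemma chartFrame_fderiv_inclChart (u : EN) :
    chartFrame (m : M) (x : M)
      (fderiv ℝ (inclChart μ c E EN m) (extChartAt 𝓘(ℝ, EN) m x) u) =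
      inclDeriv μ c x (chartFrame m x u) :=
  chartFrame_fderiv_chartMap hx hxM (h.mdifferentiableAt_val x) u

include hxQ

lemma mem_verticalChart_iff {e : E} :
    e ∈ verticalChart G μ c E EN EQ m (extChartAt 𝓘(ℝ, EN) m x) ↔
      chartFrame (m : M) (x : M) e ∈ orbitTangent (E := E) (EG := EG) G (x : M) := by
  rw [← h.map_ker_projDeriv x]
  constructor
  · rintro ⟨w, hw, rfl⟩
    refine ⟨chartFrame m x w, ?_, (h.chartFrame_fderiv_inclChart hx hxM w).symm⟩
    exact (h.chartFrame_fderiv_projChart hx hxQ w).symm.trans ((congrArg _ hw).trans (map_zero _))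
  · rintro ⟨w, hw, hwe⟩
    rw [← chartFrame_chartCoord (E := EN) hx w] at hw hwe
    refine ⟨chartCoord m x w, chartFrame_injective hxQ ?_, chartFrame_injective hxM ?_⟩
    · exact (h.chartFrame_fderiv_projChart hx hxQ _).trans (hw.trans (map_zero _).symm)
    · exact (h.chartFrame_fderiv_inclChart hx hxM _).trans hwe

lemma forall_mem_verticalChart_iff {p : TangentSpace 𝓘(ℝ, E) (x : M) → Prop} :
    (∀ w ∈ verticalChart G μ c E EN EQ m (extChartAt 𝓘(ℝ, EN) m x),
        p (chartFrame (m : M) (x : M) w)) ↔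
      ∀ W ∈ orbitTangent (E := E) (EG := EG) G (x : M), p W := by
  refine ⟨fun hp W hW ↦ ?_, fun hp w hw ↦ hp _ ((h.mem_verticalChart_iff hx hxM hxQ).1 hw)⟩
  rw [← chartFrame_chartCoord hxM W] at hW ⊢
  exact hp _ ((h.mem_verticalChart_iff hx hxM hxQ).2 hW)

lemma forall_chartMetric_eq_zero_iff {e : E} :
    (∀ w ∈ verticalChart G μ c E EN EQ m (extChartAt 𝓘(ℝ, EN) m x),
        S.chartMetric m (inclChart μ c E EN m (extChartAt 𝓘(ℝ, EN) m x)) e w = 0) ↔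
      ∀ W ∈ orbitTangent (E := E) (EG := EG) G (x : M),
        S.metric x (chartFrame (m : M) x e) W = 0 := by
  rw [← h.forall_mem_verticalChart_iff hx hxM hxQ]
  exact forall₂_congr fun w _ ↦ by rw [S.chartMetric_inclChart hx hxM]

lemma forall_chartMetric_chartJ_eq_zero_iff {e : E} :
    (∀ w ∈ verticalChart G μ c E EN EQ m (extChartAt 𝓘(ℝ, EN) m x),
        S.chartMetric m (inclChart μ c E EN m (extChartAt 𝓘(ℝ, EN) m x)) e
          (S.chartJ m (inclChart μ c E EN m (extChartAt 𝓘(ℝ, EN) m x)) w) = 0) ↔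
      ∃ v, fderiv ℝ (inclChart μ c E EN m) (extChartAt 𝓘(ℝ, EN) m x) v = e := by
  have hrange : (∃ v, fderiv ℝ (inclChart μ c E EN m) (extChartAt 𝓘(ℝ, EN) m x) v = e) ↔
      ∃ v, inclDeriv (EN := EN) μ c x v = chartFrame (m : M) (x : M) e := by
    constructor
    · rintro ⟨v, rfl⟩
      exact ⟨_, (h.chartFrame_fderiv_inclChart hx hxM v).symm⟩
    · rintro ⟨v, hv⟩
      rw [← chartFrame_chartCoord (E := EN) hx v] at hv
      exact ⟨_, chartFrame_injective hxM ((h.chartFrame_fderiv_inclChart hx hxM _).trans hv)⟩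
  rw [hrange, h.mem_range_inclDeriv_iff,
    ← h.forall_mem_verticalChart_iff hx hxM hxQ
      (p := fun W ↦ S.metric x (chartFrame (m : M) (x : M) e) (S.J x W) = 0)]
  exact forall₂_congr fun w _ ↦ by
    rw [S.chartMetric_inclChart hx hxM, S.chartFrame_chartJ_inclChart hx hxM]

lemma inclDeriv_chartFrame_mem_horizontal_iff {u : EN} :
    inclDeriv μ c x (chartFrame m x u) ∈ S.horizontal (EG := EG) G (x : M) ↔
      ∀ w ∈ verticalChart G μ c E EN EQ m (extChartAt 𝓘(ℝ, EN) m x),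
        S.chartMetric m (inclChart μ c E EN m (extChartAt 𝓘(ℝ, EN) m x))
          (fderiv ℝ (inclChart μ c E EN m) (extChartAt 𝓘(ℝ, EN) m x) u) w = 0 := by
  rw [h.inclDeriv_mem_horizontal_iff, h.forall_chartMetric_eq_zero_iff hx hxM hxQ,
    h.chartFrame_fderiv_inclChart hx hxM]

lemma chartMetric_projChart {v w : EN}
    (hv : inclDeriv μ c x (chartFrame m x v) ∈ S.horizontal (EG := EG) G (x : M))
    (hw : inclDeriv μ c x (chartFrame m x w) ∈ S.horizontal (EG := EG) G (x : M)) :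
    T.chartMetric (quotientProj G μ c m) (projChart G μ c EN EQ m (extChartAt 𝓘(ℝ, EN) m x))
        (fderiv ℝ (projChart G μ c EN EQ m) (extChartAt 𝓘(ℝ, EN) m x) v)
        (fderiv ℝ (projChart G μ c EN EQ m) (extChartAt 𝓘(ℝ, EN) m x) w) =
      S.chartMetric m (inclChart μ c E EN m (extChartAt 𝓘(ℝ, EN) m x))
        (fderiv ℝ (inclChart μ c E EN m) (extChartAt 𝓘(ℝ, EN) m x) v)
        (fderiv ℝ (inclChart μ c E EN m) (extChartAt 𝓘(ℝ, EN) m x) w) := by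
  have hQ := T.chartMetric_apply hxQ
    (fderiv ℝ (projChart G μ c EN EQ m) (extChartAt 𝓘(ℝ, EN) m x) v)
    (fderiv ℝ (projChart G μ c EN EQ m) (extChartAt 𝓘(ℝ, EN) m x) w)
  rw [h.chartFrame_fderiv_projChart hx hxQ, h.chartFrame_fderiv_projChart hx hxQ,
    h.quotient.metric x _ _ hv hw] at hQ
  rw [S.chartMetric_inclChart hx hxM, h.chartFrame_fderiv_inclChart hx hxM,
    h.chartFrame_fderiv_inclChart hx hxM, projChart, chartMap_extChartAt _ hx]
  exact hQ

end Pointwise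

variable [CompleteSpace E] [CompleteSpace EQ]

/-- The Kähler quotient read in the charts at a point `m` of the level set, at its image in the
quotient, and at `m` as a point of `M`. -/
def toLocal (h : IsKahlerReduction S G μ c EN T) (m : LevelSet μ c) :
    LocalKahlerQuotient EN E EQ where
  g := S.chartMetric m
  J := S.chartJ m
  gQ := T.chartMetric (quotientProj G μ c m)
  ψ := inclChart μ c E EN m
  p := projChart G μ c EN EQ m
  n₀ := extChartAt 𝓘(ℝ, EN) m m
  Γ := S.chartChristoffel m
  ΓQ := T.chartChristoffel (quotientProj G μ c m)
  contDiffAt_g := by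
    rw [inclChart, chartMap_self]
    exact S.contDiffAt_chartMetric m
  contDiffAt_J := by
    rw [inclChart, chartMap_self]
    exact S.contDiffAt_chartJ m
  contDiffAt_gQ := by
    rw [projChart, chartMap_self]
    exact T.contDiffAt_chartMetric (quotientProj G μ c m)
  contDiffAt_ψ := contDiffAt_chartMap (h.isImmersionAt_val m).contMDiffAt
  contDiffAt_p := contDiffAt_chartMap (h.contMDiffAt_quotientProj m)
  g_symm := S.chartMetric_symm m
  gQ_symm := T.chartMetric_symm (quotientProj G μ c m)
  isInnerProduct_g := by
    refine (h.eventually_mem_extChartAt_source m).mono ?_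
    rintro _ ⟨x, hx, hxM, -, rfl⟩
    rw [inclChart, chartMap_extChartAt _ hx]
    exact S.isInnerProduct_chartMetric hxM
  isInnerProduct_gQ := by
    rw [projChart, chartMap_self]
    exact T.isInnerProduct_chartMetric (mem_extChartAt_source _)
  isHermitianStructure_J := by
    refine (h.eventually_mem_extChartAt_source m).mono ?_
    rintro _ ⟨x, hx, hxM, -, rfl⟩
    rw [inclChart, chartMap_extChartAt _ hx]
    exact S.isHermitianStructure_chartJ hxM
  isChristoffelSymbol_Γ := by
    rw [inclChart, chartMap_self]
    exact S.isChristoffelSymbol_chartChristoffel m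
  isChristoffelSymbol_ΓQ := by
    rw [projChart, chartMap_self]
    exact T.isChristoffelSymbol_chartChristoffel (quotientProj G μ c m)
  J_parallel := by
    rw [inclChart, chartMap_self]
    exact S.chartJ_parallel m
  exists_leftInverse := exists_leftInverse_fderiv_chartMap (h.isImmersionAt_val m)
  exists_rightInverse := exists_rightInverse_fderiv_chartMap (h.isSubmersionAt_quotientProj m)
  orthogonal := by
    refine (h.eventually_mem_extChartAt_source m).mono ?_
    rintro _ ⟨x, hx, hxM, hxQ, rfl⟩ v
    exact (h.forall_chartMetric_chartJ_eq_zero_iff hx hxM hxQ).2 ⟨v, rfl⟩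
  riemannian := by
    refine (h.eventually_mem_extChartAt_source m).mono ?_
    rintro _ ⟨x, hx, hxM, hxQ, rfl⟩ v w hv hw
    exact h.chartMetric_projChart hx hxM hxQ
      ((h.inclDeriv_chartFrame_mem_horizontal_iff hx hxM hxQ).2 hv)
      ((h.inclDeriv_chartFrame_mem_horizontal_iff hx hxM hxQ).2 hw)
  elliptic e := by
    have hx := mem_extChartAt_source (I := 𝓘(ℝ, EN)) m
    have hxM := mem_extChartAt_source (I := 𝓘(ℝ, E)) (m : M)
    have hxQ := mem_extChartAt_source (I := 𝓘(ℝ, EQ)) (quotientProj G μ c m)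
    obtain ⟨U, hU, horth⟩ := h.exists_orbitTangent_sub_orthogonal m (chartFrame (m : M) (m : M) e)
    rw [← chartFrame_chartCoord hxM U, ← map_sub] at horth
    rw [← chartFrame_chartCoord hxM U] at hU
    exact ⟨_, (h.mem_verticalChart_iff hx hxM hxQ).2 hU,
      (h.forall_chartMetric_eq_zero_iff hx hxM hxQ).2 horth⟩
  tangent _ := (h.forall_chartMetric_chartJ_eq_zero_iff (mem_extChartAt_source m)
    (mem_extChartAt_source (m : M)) (mem_extChartAt_source (quotientProj G μ c m))).1

end IsKahlerReduction

/-! ### The O'Neill tensor in charts -/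

namespace IsKahlerReduction

variable {E : Type*} [NormedAddCommGroup E] [NormedSpace ℝ E] [CompleteSpace E]
  {M : Type*} [TopologicalSpace M] [ChartedSpace E M] [IsManifold 𝓘(ℝ, E) ∞ M]
  {EG : Type*} [NormedAddCommGroup EG] [NormedSpace ℝ EG]
  {G : Type*} [TopologicalSpace G] [ChartedSpace EG G] [Group G] [LieGroup 𝓘(ℝ, EG) ∞ G]
  [MulAction G M] [ContMDiffSMul 𝓘(ℝ, EG) 𝓘(ℝ, E) ∞ G M]
  {S : WeakKahlerStructure E M} {μ : M → (EG →L[ℝ] ℝ)} {c : EG →L[ℝ] ℝ}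
  {EN : Type*} [NormedAddCommGroup EN] [NormedSpace ℝ EN] [ChartedSpace EN (LevelSet μ c)]
  [IsManifold 𝓘(ℝ, EN) ∞ (LevelSet μ c)]
  {EQ : Type*} [NormedAddCommGroup EQ] [NormedSpace ℝ EQ] [CompleteSpace EQ]
  [ChartedSpace EQ (KahlerQuotient G μ c)] [IsManifold 𝓘(ℝ, EQ) ∞ (KahlerQuotient G μ c)]
  {T : WeakRiemannianStructure EQ (KahlerQuotient G μ c)}
  (h : IsKahlerReduction S G μ c EN T) (m : LevelSet μ c)

lemma chartFrame_dψ (v : EN) :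
    chartFrame (m : M) (m : M) ((h.toLocal m).dψ v) = inclDeriv μ c m (chartFrame m m v) :=
  h.chartFrame_fderiv_inclChart (mem_extChartAt_source m) (mem_extChartAt_source (m : M)) v

lemma chartFrame_dp (v : EN) :
    chartFrame (quotientProj G μ c m) (quotientProj G μ c m) ((h.toLocal m).dp v) =
      WeakKahlerStructure.projDeriv (EQ := EQ) G μ c m (chartFrame m m v) :=
  h.chartFrame_fderiv_projChart (mem_extChartAt_source m)
    (mem_extChartAt_source (quotientProj G μ c m)) v

lemma inner_toLocal (v w : E) :
    (h.toLocal m).inner v w =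
      S.metric (m : M) (chartFrame (m : M) (m : M) v) (chartFrame (m : M) (m : M) w) :=
  S.chartMetric_inclChart (mem_extChartAt_source m) (mem_extChartAt_source (m : M)) v w

lemma mem_vertical_toLocal_iff {e : E} :
    e ∈ (h.toLocal m).vertical (h.toLocal m).n₀ ↔
      chartFrame (m : M) (m : M) e ∈ orbitTangent (E := E) (EG := EG) G (m : M) :=
  h.mem_verticalChart_iff (mem_extChartAt_source m) (mem_extChartAt_source (m : M))
    (mem_extChartAt_source (quotientProj G μ c m))

lemma forall_inner_toLocal_eq_zero_iff {e : E} :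
    (∀ w ∈ (h.toLocal m).vertical (h.toLocal m).n₀, (h.toLocal m).inner e w = 0) ↔
      ∀ W ∈ orbitTangent (E := E) (EG := EG) G (m : M),
        S.metric (m : M) (chartFrame (m : M) (m : M) e) W = 0 :=
  h.forall_chartMetric_eq_zero_iff (mem_extChartAt_source m) (mem_extChartAt_source (m : M))
    (mem_extChartAt_source (quotientProj G μ c m))

lemma mem_horizontal_toLocal_iff {v : EN} :
    v ∈ (h.toLocal m).horizontal ↔
      inclDeriv μ c m (chartFrame m m v) ∈ S.horizontal (EG := EG) G (m : M) :=
  (h.inclDeriv_chartFrame_mem_horizontal_iff (mem_extChartAt_source m)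
    (mem_extChartAt_source (m : M)) (mem_extChartAt_source (quotientProj G μ c m))).symm

lemma mem_horizontal_iff_exists {X : TangentSpace 𝓘(ℝ, E) (m : M)} :
    X ∈ S.horizontal (EG := EG) G (m : M) ↔
      ∃ v ∈ (h.toLocal m).horizontal, chartFrame (m : M) (m : M) ((h.toLocal m).dψ v) = X := by
  constructor
  · intro hX
    obtain ⟨v, rfl⟩ : ∃ v, inclDeriv (EN := EN) μ c m v = X := h.mem_range_inclDeriv_iff.2 <| by
      rintro _ ⟨ρ, rfl⟩
      exact (hX ρ).2
    rw [← chartFrame_chartCoord (mem_extChartAt_source m) v] at hX ⊢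
    exact ⟨_, (h.mem_horizontal_toLocal_iff m).2 hX, h.chartFrame_dψ m _⟩
  · rintro ⟨v, hv, rfl⟩
    rw [h.chartFrame_dψ]
    exact (h.mem_horizontal_toLocal_iff m).1 hv

variable {P : EN → E →L[ℝ] E}

lemma chartFrame_apply_eq_iff (hP : (h.toLocal m).IsVerticalProjection P)
    {e Z : TangentSpace 𝓘(ℝ, E) (m : M)} :
    chartFrame (m : M) (m : M) (P (h.toLocal m).n₀ (chartCoord (m : M) (m : M) e)) = Z ↔
      Z ∈ orbitTangent (E := E) (EG := EG) G (m : M) ∧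
        ∀ W ∈ orbitTangent (E := E) (EG := EG) G (m : M), S.metric (m : M) (e - Z) W = 0 := by
  have hm := mem_extChartAt_source (I := 𝓘(ℝ, E)) (m : M)
  have hproj := hP.eventually.self_of_nhds
  constructor
  · rintro rfl
    refine ⟨(h.mem_vertical_toLocal_iff m).1 (hproj.mem _), ?_⟩
    nth_rw 1 [← chartFrame_chartCoord hm e]
    rw [← map_sub]
    exact (h.forall_inner_toLocal_eq_zero_iff m).1 (hproj.orthogonal _)
  · rintro ⟨hZ, horth⟩
    rw [← chartFrame_chartCoord hm Z] at hZ ⊢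
    nth_rw 1 [← chartFrame_chartCoord hm e] at horth
    rw [← chartFrame_chartCoord hm Z, ← map_sub] at horth
    exact congrArg _ (hproj.apply_eq (h.toLocal m).isInnerProduct_inner
      ((h.mem_vertical_toLocal_iff m).2 hZ) ((h.forall_inner_toLocal_eq_zero_iff m).2 horth))

lemma chartFrame_mem_horizontal_iff {m x : LevelSet μ c}
    (hx : x ∈ (extChartAt 𝓘(ℝ, EN) m).source)
    (hxM : (x : M) ∈ (extChartAt 𝓘(ℝ, E) (m : M)).source)
    (hxQ : quotientProj G μ c x ∈ (extChartAt 𝓘(ℝ, EQ) (quotientProj G μ c m)).source) {e : E} :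
    chartFrame (m : M) (x : M) e ∈ S.horizontal (EG := EG) G (x : M) ↔
      ∀ w ∈ (h.toLocal m).vertical (extChartAt 𝓘(ℝ, EN) m x),
        (h.toLocal m).g ((h.toLocal m).ψ (extChartAt 𝓘(ℝ, EN) m x)) e w = 0 ∧
        (h.toLocal m).g ((h.toLocal m).ψ (extChartAt 𝓘(ℝ, EN) m x)) e
          ((h.toLocal m).J ((h.toLocal m).ψ (extChartAt 𝓘(ℝ, EN) m x)) w) = 0 := by
  have in_chart (w : E) :
      (S.metric (x : M) (chartFrame (m : M) (x : M) e) (chartFrame (m : M) (x : M) w) = 0 ∧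
        S.metric (x : M) (chartFrame (m : M) (x : M) e)
          (S.J x (chartFrame (m : M) (x : M) w)) = 0) ↔
      (h.toLocal m).g ((h.toLocal m).ψ (extChartAt 𝓘(ℝ, EN) m x)) e w = 0 ∧
        (h.toLocal m).g ((h.toLocal m).ψ (extChartAt 𝓘(ℝ, EN) m x)) e
          ((h.toLocal m).J ((h.toLocal m).ψ (extChartAt 𝓘(ℝ, EN) m x)) w) = 0 := by
    rw [← S.chartFrame_chartJ_inclChart hx hxM, ← S.chartMetric_inclChart hx hxM,
      ← S.chartMetric_inclChart hx hxM]
    rfl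
  refine Iff.trans ?_ (forall₂_congr fun w _ ↦ in_chart w)
  refine Iff.trans ?_ (h.forall_mem_verticalChart_iff hx hxM hxQ (p := fun W ↦
    S.metric (x : M) (chartFrame (m : M) (x : M) e) W = 0 ∧
      S.metric (x : M) (chartFrame (m : M) (x : M) e) (S.J x W) = 0)).symm
  exact ⟨by rintro he _ ⟨ρ, rfl⟩; exact he ρ, fun he ρ ↦ he _ ⟨ρ, rfl⟩⟩

lemma eventually_apply_chartField_eq_zero (hP : (h.toLocal m).IsVerticalProjection P)
    {Y : Π x : M, TangentSpace 𝓘(ℝ, E) x}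
    (hY : ∀ᶠ x in 𝓝 (m : M), μ x = μ m → Y x ∈ S.horizontal (EG := EG) G x) :
    ∀ᶠ n in 𝓝 (h.toLocal m).n₀, P n (chartField (m : M) Y ((h.toLocal m).ψ n)) = 0 := by
  have hYlevel : ∀ᶠ x : LevelSet μ c in 𝓝 m, Y x ∈ S.horizontal (EG := EG) G (x : M) :=
    (continuous_subtype_val.continuousAt.eventually hY).mono fun x hx ↦ hx (x.2.trans m.2.symm)
  filter_upwards [h.eventually_mem_extChartAt_source m, hP.eventually,
    (h.toLocal m).isInnerProduct_g, (tendsto_extChartAt_symm m).eventually hYlevel]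
  rintro _ ⟨x, hx, hxM, hxQ, rfl⟩ hproj hinner hYx
  rw [(extChartAt 𝓘(ℝ, EN) m).left_inv hx, ← chartFrame_chartField hxM Y,
    h.chartFrame_mem_horizontal_iff hx hxM hxQ] at hYx
  refine (hproj.apply_eq_zero_iff hinner).2 fun w hw ↦ ?_
  have hψ : (h.toLocal m).ψ (extChartAt 𝓘(ℝ, EN) m x) = extChartAt 𝓘(ℝ, E) (m : M) x :=
    chartMap_extChartAt _ hx
  refine (congrArg (fun y ↦ (h.toLocal m).g ((h.toLocal m).ψ _) (chartField (m : M) Y y) w)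
    hψ).trans (hYx w hw).1

lemma cov_chartFrame_dψ {Y : Π x : M, TangentSpace 𝓘(ℝ, E) x} (hY : MDiffAt (T% Y) (m : M))
    (v : EN) :
    chartCoord (m : M) (m : M)
      (S.cov Y m (chartFrame (m : M) (m : M) ((h.toLocal m).dψ v))) =
      fderiv ℝ (fun n ↦ chartField (m : M) Y ((h.toLocal m).ψ n)) (h.toLocal m).n₀ v +
        (h.toLocal m).Γ ((h.toLocal m).dψ v)
          (chartField (m : M) Y ((h.toLocal m).ψ (h.toLocal m).n₀)) := by
  have hψ₀ : (h.toLocal m).ψ (h.toLocal m).n₀ = extChartAt 𝓘(ℝ, E) (m : M) m :=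
    chartMap_self _ m
  have hy := differentiableAt_chartField hY
  rw [← hψ₀] at hy
  rw [fderiv_comp_eval hy ((h.toLocal m).contDiffAt_ψ.differentiableAt (by simp)), hψ₀,
    S.cov_eq_chartFrame hY]
  exact chartCoord_chartFrame (mem_extChartAt_source (m : M)) _

lemma eventually_horizontalField_mem_horizontal (hP : (h.toLocal m).IsVerticalProjection P)
    (v : EN) :
    ∀ᶠ x : LevelSet μ c in 𝓝 m,
      chartFrame (m : M) (x : M)
        ((h.toLocal m).horizontalField P v (extChartAt 𝓘(ℝ, EN) m x)) ∈
        S.horizontal (EG := EG) G (x : M) := by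
  filter_upwards [(continuousAt_extChartAt m).eventually
      ((h.eventually_mem_extChartAt_source m).and
        (LocalKahlerQuotient.inner_horizontalField hP v)),
    extChartAt_source_mem_nhds (I := 𝓘(ℝ, EN)) m]
  rintro x ⟨⟨x', hx', hxM, hxQ, hxx'⟩, horth⟩ hx
  obtain rfl := (extChartAt 𝓘(ℝ, EN) m).injOn hx' hx hxx'
  exact (h.chartFrame_mem_horizontal_iff hx hxM hxQ).2 horth

lemma exists_horizontal_extension (hP : (h.toLocal m).IsVerticalProjection P) {v : EN}
    (hv : v ∈ (h.toLocal m).horizontal) :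
    ∃ Y : Π x : M, TangentSpace 𝓘(ℝ, E) x, CMDiffAt ∞ (T% Y) (m : M) ∧
      Y m = chartFrame (m : M) (m : M) ((h.toLocal m).dψ v) ∧
      ∀ᶠ x in 𝓝 (m : M), μ x = μ m → Y x ∈ S.horizontal (EG := EG) G x := by
  obtain ⟨r, hr, hrψ⟩ := exists_leftInverse_chartMap (h.isImmersionAt_val m)
  have hr₀ : r (extChartAt 𝓘(ℝ, E) (m : M) m) = (h.toLocal m).n₀ := by
    rw [← chartMap_self (E := EN) Subtype.val m]
    exact hrψ.self_of_nhds
  let field : M → E := fun x ↦ (h.toLocal m).horizontalField P v (r (extChartAt 𝓘(ℝ, E) (m : M) x))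
  have field_self : field m = (h.toLocal m).dψ v :=
    (congrArg _ hr₀).trans (LocalKahlerQuotient.horizontalField_self hP hv)
  have smooth_field : CMDiffAt ∞ field (m : M) := by
    have hfield := LocalKahlerQuotient.contDiffAt_horizontalField hP v
    rw [← hr₀] at hfield
    exact (hfield.comp _ hr).contMDiffAt.comp (m : M) contMDiffAt_extChartAt
  refine ⟨fun x ↦ chartFrame (m : M) x (field x),
    contMDiffAt_chartFrame (mem_extChartAt_source (m : M)) (n := ⊤) smooth_field,
    congrArg _ field_self, ?_⟩
  have horizontal_near : ∀ᶠ x : LevelSet μ c in 𝓝 m,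
      chartFrame (m : M) (x : M) (field x) ∈ S.horizontal (EG := EG) G (x : M) := by
    filter_upwards [h.eventually_horizontalField_mem_horizontal m hP v,
      (continuousAt_extChartAt m).eventually hrψ,
      extChartAt_source_mem_nhds (I := 𝓘(ℝ, EN)) m] with x hfield hrx hx
    rw [chartMap_extChartAt _ hx] at hrx
    rwa [← hrx] at hfield
  rw [nhds_subtype_eq_comap, Filter.eventually_comap] at horizontal_near
  exact horizontal_near.mono fun x hx hxμ ↦ hx ⟨x, hxμ.trans m.2⟩ rfl

lemma chartFrame_oneill_eq_iff (hP : (h.toLocal m).IsVerticalProjection P) {v w : EN}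
    {Y : Π x : M, TangentSpace 𝓘(ℝ, E) x} (hY : MDiffAt (T% Y) (m : M))
    (hYm : Y m = chartFrame (m : M) (m : M) ((h.toLocal m).dψ w))
    (hYhor : ∀ᶠ x in 𝓝 (m : M), μ x = μ m → Y x ∈ S.horizontal (EG := EG) G x)
    {Z : TangentSpace 𝓘(ℝ, E) (m : M)} :
    chartFrame (m : M) (m : M) ((h.toLocal m).oneill P v ((h.toLocal m).dψ w)) = Z ↔
      Z ∈ orbitTangent (E := E) (EG := EG) G (m : M) ∧
        ∀ W ∈ orbitTangent (E := E) (EG := EG) G (m : M),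
          S.metric (m : M)
            (S.cov Y m (chartFrame (m : M) (m : M) ((h.toLocal m).dψ v)) - Z) W = 0 := by
  have hψ₀ : (h.toLocal m).ψ (h.toLocal m).n₀ = extChartAt 𝓘(ℝ, E) (m : M) m := chartMap_self _ m
  have hYψ₀ : chartField (m : M) Y ((h.toLocal m).ψ (h.toLocal m).n₀) = (h.toLocal m).dψ w := by
    have hm := mem_extChartAt_source (I := 𝓘(ℝ, E)) (m : M)
    rw [hψ₀]
    exact chartFrame_injective hm ((chartFrame_chartField hm Y).trans hYm)
  have hy : DifferentiableAt ℝ (fun n ↦ chartField (m : M) Y ((h.toLocal m).ψ n))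
      (h.toLocal m).n₀ := by
    have hchart := differentiableAt_chartField hY
    rw [← hψ₀] at hchart
    exact hchart.comp _ ((h.toLocal m).contDiffAt_ψ.differentiableAt (by simp))
  rw [← h.chartFrame_apply_eq_iff m hP, h.cov_chartFrame_dψ m hY,
    LocalKahlerQuotient.apply_fderiv_add_christoffel hP hy
      (h.eventually_apply_chartField_eq_zero m hP hYhor), hYψ₀]

lemma isONeill_iff (hP : (h.toLocal m).IsVerticalProjection P)
    {X Y Z : TangentSpace 𝓘(ℝ, E) (m : M)} :
    S.IsONeill G μ (m : M) X Y Z ↔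
      ∃ v ∈ (h.toLocal m).horizontal, ∃ w ∈ (h.toLocal m).horizontal,
        chartFrame (m : M) (m : M) ((h.toLocal m).dψ v) = X ∧
        chartFrame (m : M) (m : M) ((h.toLocal m).dψ w) = Y ∧
        chartFrame (m : M) (m : M) ((h.toLocal m).oneill P v ((h.toLocal m).dψ w)) = Z := by
  constructor
  · rintro ⟨hX, hY, hZ, Yext, hYext, hYm, hYhor, hcov⟩
    obtain ⟨v, hv, rfl⟩ := (h.mem_horizontal_iff_exists m).1 hX
    obtain ⟨w, hw, rfl⟩ := (h.mem_horizontal_iff_exists m).1 hY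
    exact ⟨v, hv, w, hw, rfl, rfl, (h.chartFrame_oneill_eq_iff m hP
      (hYext.mdifferentiableAt (by simp)) hYm hYhor).2 ⟨hZ, hcov⟩⟩
  · rintro ⟨v, hv, w, hw, rfl, rfl, hZ⟩
    obtain ⟨Yext, hYext, hYm, hYhor⟩ := h.exists_horizontal_extension m hP hw
    obtain ⟨hZ, hcov⟩ := (h.chartFrame_oneill_eq_iff m hP
      (hYext.mdifferentiableAt (by simp)) hYm hYhor).1 hZ
    exact ⟨(h.mem_horizontal_iff_exists m).2 ⟨v, hv, rfl⟩,
      (h.mem_horizontal_iff_exists m).2 ⟨w, hw, rfl⟩, hZ, Yext, hYext, hYm, hYhor, hcov⟩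

end IsKahlerReduction

/-! ### Sectional curvatures -/

namespace IsKahlerReduction

variable {E : Type*} [NormedAddCommGroup E] [NormedSpace ℝ E] [CompleteSpace E]
  {M : Type*} [TopologicalSpace M] [ChartedSpace E M] [IsManifold 𝓘(ℝ, E) ∞ M]
  {EG : Type*} [NormedAddCommGroup EG] [NormedSpace ℝ EG]
  {G : Type*} [TopologicalSpace G] [ChartedSpace EG G] [Group G] [LieGroup 𝓘(ℝ, EG) ∞ G]
  [MulAction G M] [ContMDiffSMul 𝓘(ℝ, EG) 𝓘(ℝ, E) ∞ G M]
  {S : WeakKahlerStructure E M} {μ : M → (EG →L[ℝ] ℝ)} {c : EG →L[ℝ] ℝ}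
  {EN : Type*} [NormedAddCommGroup EN] [NormedSpace ℝ EN] [ChartedSpace EN (LevelSet μ c)]
  [IsManifold 𝓘(ℝ, EN) ∞ (LevelSet μ c)]
  {EQ : Type*} [NormedAddCommGroup EQ] [NormedSpace ℝ EQ] [CompleteSpace EQ]
  [ChartedSpace EQ (KahlerQuotient G μ c)] [IsManifold 𝓘(ℝ, EQ) ∞ (KahlerQuotient G μ c)]
  {T : WeakRiemannianStructure EQ (KahlerQuotient G μ c)}
  (h : IsKahlerReduction S G μ c EN T) (m : LevelSet μ c)

/-- The plane in the tangent space of the quotient at the orbit of `m` which is spanned by the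
projections of two vectors given in the chart of the level set at `m`. -/
def quotientPlane (i j : EN) : Submodule ℝ (TangentSpace 𝓘(ℝ, EQ) (quotientProj G μ c m)) :=
  Submodule.span ℝ {chartFrame (quotientProj G μ c m) (quotientProj G μ c m) ((h.toLocal m).dp i),
    chartFrame (quotientProj G μ c m) (quotientProj G μ c m) ((h.toLocal m).dp j)}

lemma innerQ_toLocal (v w : EQ) :
    (h.toLocal m).innerQ v w =
      T.metric (quotientProj G μ c m)
        (chartFrame (quotientProj G μ c m) (quotientProj G μ c m) v)
        (chartFrame (quotientProj G μ c m) (quotientProj G μ c m) w) := by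
  have hp₀ : (h.toLocal m).p (h.toLocal m).n₀ =
      extChartAt 𝓘(ℝ, EQ) (quotientProj G μ c m) (quotientProj G μ c m) := chartMap_self _ m
  exact (congrArg (fun q ↦ (h.toLocal m).gQ q v w) hp₀).trans
    (T.chartMetric_apply (mem_extChartAt_source _) v w)

variable {m}

lemma mem_horizontalLift_iff
    {Pl : Submodule ℝ (TangentSpace 𝓘(ℝ, EQ) (quotientProj G μ c m))}
    {X : TangentSpace 𝓘(ℝ, E) (m : M)} :
    X ∈ S.horizontalLift G μ c EN m Pl ↔ ∃ v ∈ (h.toLocal m).horizontal,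
      chartFrame (quotientProj G μ c m) (quotientProj G μ c m) ((h.toLocal m).dp v) ∈ Pl ∧
        chartFrame (m : M) (m : M) ((h.toLocal m).dψ v) = X := by
  constructor
  · rintro ⟨⟨v, hv, rfl⟩, hX⟩
    obtain ⟨v, rfl⟩ : ∃ v', chartFrame m m v' = v :=
      ⟨_, chartFrame_chartCoord (mem_extChartAt_source m) v⟩
    exact ⟨v, (h.mem_horizontal_toLocal_iff m).2 hX, (h.chartFrame_dp m v) ▸ hv,
      h.chartFrame_dψ m v⟩
  · rintro ⟨v, hv, hPl, rfl⟩
    rw [h.chartFrame_dp] at hPl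
    rw [h.chartFrame_dψ]
    exact ⟨⟨_, hPl, rfl⟩, (h.mem_horizontal_toLocal_iff m).1 hv⟩

variable {i j : EN} (hi : i ∈ (h.toLocal m).horizontal) (hj : j ∈ (h.toLocal m).horizontal)

include hi hj

lemma horizontalLift_quotientPlane :
    S.horizontalLift G μ c EN m (h.quotientPlane m i j) =
      Submodule.span ℝ {chartFrame (m : M) (m : M) ((h.toLocal m).dψ i),
        chartFrame (m : M) (m : M) ((h.toLocal m).dψ j)} := by
  ext X
  rw [h.mem_horizontalLift_iff, Submodule.mem_span_pair]
  constructor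
  · rintro ⟨v, hv, hmem, rfl⟩
    obtain ⟨a, b, hab⟩ := Submodule.mem_span_pair.1 hmem
    simp only [← map_smul, ← map_add] at hab
    have hvij : a • i + b • j = v := (h.toLocal m).injOn_dp_horizontal
      (add_mem (Submodule.smul_mem _ a hi) (Submodule.smul_mem _ b hj)) hv
      (chartFrame_injective (mem_extChartAt_source _) hab)
    exact ⟨a, b, by simp only [← hvij, map_add, map_smul]⟩
  · rintro ⟨a, b, rfl⟩
    refine ⟨a • i + b • j, add_mem (Submodule.smul_mem _ a hi) (Submodule.smul_mem _ b hj),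
      Submodule.mem_span_pair.2 ⟨a, b, ?_⟩, ?_⟩ <;> simp only [map_add, map_smul]

variable (hi₁ : (h.toLocal m).inner ((h.toLocal m).dψ i) ((h.toLocal m).dψ i) = 1)
  (hj₁ : (h.toLocal m).inner ((h.toLocal m).dψ j) ((h.toLocal m).dψ j) = 1)
  (hij : (h.toLocal m).inner ((h.toLocal m).dψ i) ((h.toLocal m).dψ j) = 0)

include hi₁ hj₁ hij

lemma finrank_quotientPlane : Module.finrank ℝ (h.quotientPlane m i j) = 2 := by
  rw [← (h.toLocal m).innerQ_dp hi hi, h.innerQ_toLocal] at hi₁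
  rw [← (h.toLocal m).innerQ_dp hj hj, h.innerQ_toLocal] at hj₁
  rw [← (h.toLocal m).innerQ_dp hi hj, h.innerQ_toLocal] at hij
  exact IsInnerProduct.finrank_span_of_orthonormal hi₁ hj₁ hij

lemma sectionalCurvature_sub_horizontalLift :
    T.sectionalCurvature (h.quotientPlane m i j) -
        S.sectionalCurvature (S.horizontalLift G μ c EN m (h.quotientPlane m i j)) =
      (h.toLocal m).curvatureDefect i j := by
  have hψ₀ : (h.toLocal m).ψ (h.toLocal m).n₀ = extChartAt 𝓘(ℝ, E) (m : M) m := chartMap_self _ m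
  have hp₀ : (h.toLocal m).p (h.toLocal m).n₀ =
      extChartAt 𝓘(ℝ, EQ) (quotientProj G μ c m) (quotientProj G μ c m) := chartMap_self _ m
  rw [h.horizontalLift_quotientPlane hi hj, LocalKahlerQuotient.curvatureDefect]
  have hiQ := ((h.toLocal m).innerQ_dp hi hi).trans hi₁
  have hjQ := ((h.toLocal m).innerQ_dp hj hj).trans hj₁
  have hijQ := ((h.toLocal m).innerQ_dp hi hj).trans hij
  simp only [LocalKahlerQuotient.inner, LocalKahlerQuotient.innerQ, hψ₀, hp₀] at *
  exact congrArg₂ _ (T.sectionalCurvature_span_chartFrame hiQ hjQ hijQ)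
    (S.sectionalCurvature_span_chartFrame hi₁ hj₁ hij)

omit hi hj hi₁ hj₁ hij

variable (m) in
lemma exists_quotientPlane_eq
    {Pl : Submodule ℝ (TangentSpace 𝓘(ℝ, EQ) (quotientProj G μ c m))}
    (hPl : Module.finrank ℝ Pl = 2) :
    ∃ i ∈ (h.toLocal m).horizontal, ∃ j ∈ (h.toLocal m).horizontal,
      (h.toLocal m).inner ((h.toLocal m).dψ i) ((h.toLocal m).dψ i) = 1 ∧
      (h.toLocal m).inner ((h.toLocal m).dψ j) ((h.toLocal m).dψ j) = 1 ∧
      (h.toLocal m).inner ((h.toLocal m).dψ i) ((h.toLocal m).dψ j) = 0 ∧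
      h.quotientPlane m i j = Pl := by
  have lift (u : TangentSpace 𝓘(ℝ, EQ) (quotientProj G μ c m)) :
      ∃ i ∈ (h.toLocal m).horizontal,
        chartFrame (quotientProj G μ c m) (quotientProj G μ c m) ((h.toLocal m).dp i) = u := by
    obtain ⟨i, hi, hiu⟩ := (h.toLocal m).exists_horizontal_dp_eq (chartCoord _ _ u)
    exact ⟨i, hi, hiu ▸ chartFrame_chartCoord (mem_extChartAt_source _) u⟩
  have hT : IsInnerProduct (T.metric (quotientProj G μ c m)) := ⟨T.metric_symm _, T.metric_pos _⟩
  obtain ⟨u, v, hu, hv, huv, hspan⟩ := hT.exists_orthonormal_span_eq hPl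
  obtain ⟨i, hi, rfl⟩ := lift u
  obtain ⟨j, hj, rfl⟩ := lift v
  rw [← h.innerQ_toLocal] at hu hv huv
  exact ⟨i, hi, j, hj, ((h.toLocal m).innerQ_dp hi hi).symm.trans hu,
    ((h.toLocal m).innerQ_dp hj hj).symm.trans hv, ((h.toLocal m).innerQ_dp hi hj).symm.trans huv,
    hspan⟩

variable {P : EN → E →L[ℝ] E} (hP : (h.toLocal m).IsVerticalProjection P)

include hP

lemma ofReal_sqrt_oneill_le (hi : i ∈ (h.toLocal m).horizontal)
    (hj : j ∈ (h.toLocal m).horizontal)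
    (hi₁ : (h.toLocal m).inner ((h.toLocal m).dψ i) ((h.toLocal m).dψ i) = 1)
    (hj₁ : (h.toLocal m).inner ((h.toLocal m).dψ j) ((h.toLocal m).dψ j) = 1) :
    ENNReal.ofReal √((h.toLocal m).inner ((h.toLocal m).oneill P i ((h.toLocal m).dψ j))
      ((h.toLocal m).oneill P i ((h.toLocal m).dψ j))) ≤ S.oneillNorm G μ (m : M) := by
  rw [h.inner_toLocal] at hi₁ hj₁ ⊢
  have length_eq_one {X : TangentSpace 𝓘(ℝ, E) (m : M)} (hX : S.metric (m : M) X X = 1) :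
      S.length X = 1 := by rw [WeakRiemannianStructure.length, hX, Real.sqrt_one]
  have ne_zero {X : TangentSpace 𝓘(ℝ, E) (m : M)} (hX : S.metric (m : M) X X = 1) : X ≠ 0 := by
    rintro rfl
    simp at hX
  refine le_iSup₂_of_le _ _ <| le_iSup₂_of_le _ (ne_zero hi₁) <| le_iSup₂_of_le (ne_zero hj₁)
    ((h.isONeill_iff m hP).2 ⟨i, hi, j, hj, rfl, rfl, rfl⟩) ?_
  rw [length_eq_one hi₁, length_eq_one hj₁, mul_one, div_one]
  rfl

lemma oneillNorm_le_ofReal_sqrt {C : ℝ} (hC₀ : 0 ≤ C)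
    (hC : ∀ v ∈ (h.toLocal m).horizontal,
      (h.toLocal m).inner ((h.toLocal m).dψ v) ((h.toLocal m).dψ v) = 1 →
      (h.toLocal m).inner ((h.toLocal m).secondForm P v v)
        ((h.toLocal m).secondForm P v v) ≤ C) :
    S.oneillNorm G μ (m : M) ≤ ENNReal.ofReal √C := by
  refine iSup₂_le fun X Y ↦ iSup₂_le fun Z hX ↦ iSup₂_le fun hY hZ ↦
    ENNReal.ofReal_le_ofReal ?_
  obtain ⟨v, hv, w, hw, rfl, rfl, rfl⟩ := (h.isONeill_iff m hP).1 hZ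
  have hX₀ := S.metric_pos _ _ hX
  have hY₀ := S.metric_pos _ _ hY
  have hA := LocalKahlerQuotient.oneill_le_of_secondForm_le hP hC hv hw
  simp only [h.inner_toLocal] at hA
  rw [WeakRiemannianStructure.length, WeakRiemannianStructure.length,
    WeakRiemannianStructure.length, div_le_iff₀ (mul_pos (Real.sqrt_pos.2 hX₀)
      (Real.sqrt_pos.2 hY₀)), ← Real.sqrt_mul hX₀.le, ← Real.sqrt_mul hC₀]
  exact Real.sqrt_le_sqrt hA

lemma exists_finrank_eq_two_sectionalCurvature_sub_eq {v : EN} (hv : v ∈ (h.toLocal m).horizontal)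
    (hv₁ : (h.toLocal m).inner ((h.toLocal m).dψ v) ((h.toLocal m).dψ v) = 1) :
    ∃ Pl : Submodule ℝ (TangentSpace 𝓘(ℝ, EQ) (quotientProj G μ c m)),
      Module.finrank ℝ Pl = 2 ∧
      T.sectionalCurvature Pl - S.sectionalCurvature (S.horizontalLift G μ c EN m Pl) =
        4 * (h.toLocal m).inner ((h.toLocal m).secondForm P v v)
          ((h.toLocal m).secondForm P v v) := by
  have hJ₀ := (h.toLocal m).isHermitianStructure_J₀
  obtain ⟨v', hv', hJ⟩ := (h.toLocal m).exists_horizontal_dψ_eq_J₀ hv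
  have hv'₁ : (h.toLocal m).inner ((h.toLocal m).dψ v') ((h.toLocal m).dψ v') = 1 := by
    rw [hJ, hJ₀.isometry, hv₁]
  have hvv' : (h.toLocal m).inner ((h.toLocal m).dψ v) ((h.toLocal m).dψ v') = 0 := by
    rw [hJ]
    exact hJ₀.apply_self (h.toLocal m).isInnerProduct_inner _
  exact ⟨_, h.finrank_quotientPlane hv hv' hv₁ hv'₁ hvv',
    (h.sectionalCurvature_sub_horizontalLift hv hv' hv₁ hv'₁ hvv').trans
      (LocalKahlerQuotient.curvatureDefect_J₀ hP hv hv' hJ)⟩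

omit hP
include h

variable (m)

lemma ofReal_abs_sectionalCurvature_sub_le
    {Pl : Submodule ℝ (TangentSpace 𝓘(ℝ, EQ) (quotientProj G μ c m))}
    (hPl : Module.finrank ℝ Pl = 2) :
    ENNReal.ofReal
        |T.sectionalCurvature Pl - S.sectionalCurvature (S.horizontalLift G μ c EN m Pl)| ≤
      4 * S.oneillNorm G μ (m : M) ^ 2 := by
  obtain ⟨P, hP⟩ := (h.toLocal m).exists_isVerticalProjection
  obtain ⟨i, hi, j, hj, hi₁, hj₁, hij, rfl⟩ := h.exists_quotientPlane_eq m hPl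
  rw [h.sectionalCurvature_sub_horizontalLift hi hj hi₁ hj₁ hij]
  have hA (v) (hv : v ∈ (h.toLocal m).horizontal) (w) (hw : w ∈ (h.toLocal m).horizontal) :=
    h.ofReal_sqrt_oneill_le hP hv hw
  by_cases htop : S.oneillNorm G μ (m : M) = ⊤
  · simp [htop]
  lift S.oneillNorm G μ (m : M) to NNReal using htop with r
  have hdefect := LocalKahlerQuotient.abs_curvatureDefect_le hP
    (fun v hv w hw hv₁ hw₁ ↦
      (Real.sqrt_le_left r.2).1 (ENNReal.ofReal_le_coe.1 (hA v hv w hw hv₁ hw₁)))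
    hi hj hi₁ hj₁
  refine (ENNReal.ofReal_le_ofReal hdefect).trans_eq ?_
  rw [ENNReal.ofReal_mul (by norm_num)]
  simp [ENNReal.ofReal_pow]

lemma exists_unit_horizontal [Nontrivial (TangentSpace 𝓘(ℝ, EQ) (quotientProj G μ c m))] :
    ∃ v ∈ (h.toLocal m).horizontal,
      (h.toLocal m).inner ((h.toLocal m).dψ v) ((h.toLocal m).dψ v) = 1 := by
  obtain ⟨q, hq⟩ := exists_ne (0 : TangentSpace 𝓘(ℝ, EQ) (quotientProj G μ c m))
  obtain ⟨v, hv, hvq⟩ := (h.toLocal m).exists_horizontal_dp_eq q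
  have hψv : (h.toLocal m).dψ v ≠ 0 := fun h₀ ↦ hq <| by
    rw [← hvq, (h.toLocal m).dψ_injective (h₀.trans (map_zero _).symm), map_zero]
    rfl
  obtain ⟨r, hr⟩ := (h.toLocal m).isInnerProduct_inner.exists_smul_apply_self_eq_one hψv
  exact ⟨r • v, Submodule.smul_mem _ r hv, by rwa [map_smul]⟩

lemma four_mul_oneillNorm_sq_le [Nontrivial (TangentSpace 𝓘(ℝ, EQ) (quotientProj G μ c m))]
    {R : EReal}
    (hR : ∀ Pl : Submodule ℝ (TangentSpace 𝓘(ℝ, EQ) (quotientProj G μ c m)),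
      Module.finrank ℝ Pl = 2 →
        ((T.sectionalCurvature Pl
          - S.sectionalCurvature (S.horizontalLift G μ c EN m Pl) : ℝ) : EReal) ≤ R) :
    ((4 * S.oneillNorm G μ (m : M) ^ 2 : ℝ≥0∞) : EReal) ≤ R := by
  obtain ⟨P, hP⟩ := (h.toLocal m).exists_isVerticalProjection
  have four_mul_le (v : EN) (hv : v ∈ (h.toLocal m).horizontal)
      (hv₁ : (h.toLocal m).inner ((h.toLocal m).dψ v) ((h.toLocal m).dψ v) = 1) :
      ((4 * (h.toLocal m).inner ((h.toLocal m).secondForm P v v)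
        ((h.toLocal m).secondForm P v v) : ℝ) : EReal) ≤ R := by
    obtain ⟨Pl, hPl, hcurv⟩ := h.exists_finrank_eq_two_sectionalCurvature_sub_eq hP hv hv₁
    rw [← hcurv]
    exact hR Pl hPl
  have hR₀ : 0 ≤ R := by
    obtain ⟨v, hv, hv₁⟩ := h.exists_unit_horizontal m
    refine le_trans (EReal.coe_nonneg.2 (mul_nonneg (by norm_num) ?_)) (four_mul_le v hv hv₁)
    exact (h.toLocal m).isInnerProduct_inner.nonneg _
  by_cases htop : R = ⊤
  · exact htop ▸ le_top
  lift R to ℝ using ⟨htop, fun hbot ↦ by simp [hbot] at hR₀⟩ with C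
  have hC₀ : 0 ≤ C / 4 := div_nonneg (EReal.coe_nonneg.1 hR₀) (by norm_num)
  have hV := h.oneillNorm_le_ofReal_sqrt hP hC₀ fun v hv hv₁ ↦ by
    linarith [EReal.coe_le_coe_iff.1 (four_mul_le v hv hv₁)]
  calc ((4 * S.oneillNorm G μ (m : M) ^ 2 : ℝ≥0∞) : EReal)
      ≤ ((4 * ENNReal.ofReal √(C / 4) ^ 2 : ℝ≥0∞) : EReal) :=
        EReal.coe_ennreal_le_coe_ennreal_iff.2 (by gcongr)
    _ = ((ENNReal.ofReal C : ℝ≥0∞) : EReal) := by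
      rw [← ENNReal.ofReal_pow (Real.sqrt_nonneg _), Real.sq_sqrt hC₀,
        ← ENNReal.ofReal_ofNat, ← ENNReal.ofReal_mul (by norm_num), mul_div_cancel₀ _ (by norm_num)]
    _ = C := by rw [EReal.coe_ennreal_ofReal, max_eq_left (EReal.coe_nonneg.1 hR₀)]

end IsKahlerReduction

theorem mainTheorem6_general
    {E : Type*} [NormedAddCommGroup E] [NormedSpace ℝ E] [CompleteSpace E]
    {M : Type*} [TopologicalSpace M] [ChartedSpace E M] [IsManifold 𝓘(ℝ, E) ∞ M]
    {EG : Type*} [NormedAddCommGroup EG] [NormedSpace ℝ EG]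
    {G : Type*} [TopologicalSpace G] [ChartedSpace EG G] [Group G] [LieGroup 𝓘(ℝ, EG) ∞ G]
    [MulAction G M] [ContMDiffSMul 𝓘(ℝ, EG) 𝓘(ℝ, E) ∞ G M]
    {S : WeakKahlerStructure E M} {μ : M → (EG →L[ℝ] ℝ)} {c : EG →L[ℝ] ℝ}
    {EN : Type*} [NormedAddCommGroup EN] [NormedSpace ℝ EN]
    [ChartedSpace EN (LevelSet μ c)] [IsManifold 𝓘(ℝ, EN) ∞ (LevelSet μ c)]
    {EQ : Type*} [NormedAddCommGroup EQ] [NormedSpace ℝ EQ] [CompleteSpace EQ]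
    [ChartedSpace EQ (KahlerQuotient G μ c)] [IsManifold 𝓘(ℝ, EQ) ∞ (KahlerQuotient G μ c)]
    {T : WeakRiemannianStructure EQ (KahlerQuotient G μ c)}
    (h : IsKahlerReduction S G μ c EN T) (m : LevelSet μ c) :
    (∀ P : Submodule ℝ (TangentSpace 𝓘(ℝ, EQ) (quotientProj G μ c m)), Module.finrank ℝ P = 2 →
      ENNReal.ofReal
          |T.sectionalCurvature P - S.sectionalCurvature (S.horizontalLift G μ c EN m P)| ≤
        4 * S.oneillNorm G μ (m : M) ^ 2) ∧
    (Nontrivial (TangentSpace 𝓘(ℝ, EQ) (quotientProj G μ c m)) →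
      ((4 * S.oneillNorm G μ (m : M) ^ 2 : ℝ≥0∞) : EReal) ≤
        ⨆ P : {P : Submodule ℝ (TangentSpace 𝓘(ℝ, EQ) (quotientProj G μ c m)) //
            Module.finrank ℝ P = 2},
          ((T.sectionalCurvature P.1
            - S.sectionalCurvature (S.horizontalLift G μ c EN m P.1) : ℝ) : EReal)) :=
  ⟨fun _ hP ↦ h.ofReal_abs_sectionalCurvature_sub_le m hP, fun _ ↦
    h.four_mul_oneillNorm_sq_le m fun P hP ↦ le_iSup_of_le ⟨P, hP⟩ le_rfl⟩

end

theorem mainTheorem6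
    {E : Type*} [NormedAddCommGroup E] [NormedSpace ℝ E] [CompleteSpace E]
    {M : Type*} [TopologicalSpace M] [T2Space M] [ChartedSpace E M] [IsManifold 𝓘(ℝ, E) ∞ M]
    {EG : Type*} [NormedAddCommGroup EG] [NormedSpace ℝ EG] [CompleteSpace EG]
    {G : Type*} [TopologicalSpace G] [ChartedSpace EG G] [Group G] [LieGroup 𝓘(ℝ, EG) ∞ G]
    [MulAction G M] [ContMDiffSMul 𝓘(ℝ, EG) 𝓘(ℝ, E) ∞ G M]
    (S : WeakKahlerStructure E M)
    (μ : M → (EG →L[ℝ] ℝ)) (hμ : S.IsMomentMap G μ)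
    (c : EG →L[ℝ] ℝ) (hc : ∀ a : G, coadjointAction a c = c)
    -- the level set of the moment map is a submanifold
    {EN : Type*} [NormedAddCommGroup EN] [NormedSpace ℝ EN] [CompleteSpace EN]
    [ChartedSpace EN (LevelSet μ c)] [IsManifold 𝓘(ℝ, EN) ∞ (LevelSet μ c)]
    (hN : IsLevelSubmanifold E EN μ c)
    -- on which the action is free, proper, isometric and elliptic
    (hG : S.IsGoodOnLevel EN G μ c)
    -- the Kähler quotient, with its quotient metric and Levi-Civita connection
    {EQ : Type*} [NormedAddCommGroup EQ] [NormedSpace ℝ EQ] [CompleteSpace EQ]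
    [ChartedSpace EQ (KahlerQuotient G μ c)] [IsManifold 𝓘(ℝ, EQ) ∞ (KahlerQuotient G μ c)]
    (T : WeakRiemannianStructure EQ (KahlerQuotient G μ c))
    (hT : S.IsKahlerQuotientStructure G μ c EN T)
    (m : LevelSet μ c) :
    (∀ P : Submodule ℝ (TangentSpace 𝓘(ℝ, EQ) (quotientProj G μ c m)), Module.finrank ℝ P = 2 →
      ENNReal.ofReal
          |T.sectionalCurvature P - S.sectionalCurvature (S.horizontalLift G μ c EN m P)| ≤
        5 * S.oneillNorm G μ (m : M) ^ 2) ∧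
    (Nontrivial (TangentSpace 𝓘(ℝ, EQ) (quotientProj G μ c m)) →
      ((S.oneillNorm G μ (m : M) ^ 2 : ℝ≥0∞) : EReal) ≤
        ⨆ P : {P : Submodule ℝ (TangentSpace 𝓘(ℝ, EQ) (quotientProj G μ c m)) //
            Module.finrank ℝ P = 2},
          ((T.sectionalCurvature P.1
            - S.sectionalCurvature (S.horizontalLift G μ c EN m P.1) : ℝ) : EReal)) := by
  obtain ⟨upper, lower⟩ := mainTheorem6_general ⟨hμ, hc, hN, hG.elliptic, hT⟩ m
  exact ⟨fun P hP ↦ (upper P hP).trans (by gcongr; norm_num), fun hQ ↦ le_trans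
    (EReal.coe_ennreal_le_coe_ennreal_iff.2 (le_mul_of_one_le_left' (by norm_num))) (lower hQ)⟩
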